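/- Cohomology is singular cohomology with integer coefficients. Let $B$ be a smooth manifold of dimension $n$ without boundary (Hausdorff, second countable) and let $F\subset B$ be a compact smoothly embedded submanifold of dimension $k$. A *compactification* of $B$ here is a compact Hausdorff space $\tilde B$ together with an open embedding $i:B\hookrightarrow\tilde B$ (density of $i(B)$ is not required; a dense embedding of $B$ into a compact Hausdorff space is automatically open). We write $F$ also for $i(F)$. $B$ carries a smooth Riemannian metric. For any such metric $g$, let $D(F)$ and $S(F)$ be the closed unit disc bundle and the unit sphere bundle of the normal bundle $(TF)^\perp\subset TB|_F$, and let $Y=\mathrm{TD}(F)=D(F)/S(F)$ be the Thom space (the quotient of $D(F)\sqcup\{*\}$ that identifies every point of $S(F)$ with $*$). A *tubular neighbourhood* of $F$ is a continuous injection $t:D(F)\to B$ that restricts to the inclusion $F\subset B$ on the zero section and maps the open disc bundle diffeomorphically onto an open set $N(F)\subset B$. Then: 1. $F$ has a tubular neighbourhood. 2. Let $t$ be any tubular neighbourhood. For every compactification $i:B\hookrightarrow\tilde B$ the collapse map $\lambda_{\tilde B}:\tilde B\to Y$, given by $\lambda_{\tilde B}(i(t(\xi)))=[\xi]$ for $\xi\in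 D(F)$ and $\lambda_{\tilde B}(x)=*$ for $x\notin i(t(D(F)))$, is continuous. Put $\varphi_{\tilde B}=\lambda_{\tilde B}^*:H^3(Y)\to H^3(\tilde B)$. 3. There is a homomorphism $\psi:H^3(B,B-F)\to H^3(Y)$, independent of the compactification, such that for every compactification $\tilde B$ of $B$ the restriction $H^3(\tilde B,\tilde B-F)\to H^3(B,B-F)$ is an isomorphism and the canonical map $$H^3(B,B-F)\xrightarrow{\ \cong\ }H^3(\tilde B,\tilde B-F)\to H^3(\tilde B)$$ (the inverse of that isomorphism followed by the map of the long exact sequence of the pair) equals $\varphi_{\tilde B}\circ\psi$. 4. $\varphi$ is natural in the compactification: if $i:B\hookrightarrow\tilde B$ and $i':B\hookrightarrow\tilde B'$ are compactifications and $h:\tilde B\to\tilde B'$ is continuous with $h\circ i=i'$ and $h(\tilde B- i(B))\subset\tilde B'- i'(B)$, then $\varphi_{\tilde B}=h^*\circ\varphi_{\tilde B'}$. -/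

import Mathlib

open Set Topology Manifold
open scoped ContDiff

universe u v w

noncomputable section

/-! ### Singular cohomology of pairs, with integer coefficients -/

/-- Singular `n`-simplices of `X`. -/
abbrev SingularSimplex (n : ℕ) (X : Type u) [TopologicalSpace X] : Type u :=
  C(stdSimplex ℝ (Fin (n + 1)), X)

/-- The `i`-th face of a singular simplex: restriction to the face opposite to the `i`-th vertex. -/
def SingularSimplex.face {n : ℕ} {X : Type u} [TopologicalSpace X]
    (σ : SingularSimplex (n + 1) X) (i : Fin (n + 2)) : SingularSimplex n X :=
  ContinuousMap.comp σ ⟨stdSimplex.map i.succAbove, stdSimplex.continuous_map i.succAbove⟩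

/-- Singular `n`-cochains of `X` with integer coefficients. -/
abbrev SingularCochain (n : ℕ) (X : Type u) [TopologicalSpace X] : Type u :=
  SingularSimplex n X → ℤ

/-- The coboundary `(δ c)(σ) = ∑ i, (-1)^i c(dᵢ σ)`. -/
def coboundary (n : ℕ) (X : Type u) [TopologicalSpace X] :
    SingularCochain n X →+ SingularCochain (n + 1) X where
  toFun c := fun σ => ∑ i : Fin (n + 2), (-1) ^ (i : ℕ) * c (σ.face i)
  map_zero' := by
    funext σ
    simp
  map_add' c c' := by
    funext σ
    simp [mul_add, Finset.sum_add_distrib]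

/-- Pull-back of cochains along a continuous map. -/
def SingularCochain.pullback {X : Type u} {X' : Type v} [TopologicalSpace X] [TopologicalSpace X']
    (f : C(X, X')) (n : ℕ) : SingularCochain n X' →+ SingularCochain n X where
  toFun c := fun σ => c (f.comp σ)
  map_zero' := rfl
  map_add' _ _ := rfl

/-- Cochains of the pair `(X, A)`: the cochains of `X` that vanish on the simplices lying in `A`. -/
def relCochain (n : ℕ) {X : Type u} [TopologicalSpace X] (A : Set X) :
    AddSubgroup (SingularCochain n X) where
  carrier := {c | ∀ σ : SingularSimplex n X, (∀ p, σ p ∈ A) → c σ = 0}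
  zero_mem' := fun _ _ => rfl
  add_mem' := by
    intro c c' hc hc' σ hσ
    simp [hc σ hσ, hc' σ hσ]
  neg_mem' := by
    intro c hc σ hσ
    simp [hc σ hσ]

/-- Cocycles of the pair `(X, A)`. -/
def relCocycle (n : ℕ) {X : Type u} [TopologicalSpace X] (A : Set X) :
    AddSubgroup (SingularCochain n X) :=
  relCochain n A ⊓ (coboundary n X).ker

/-- Coboundaries of the pair `(X, A)`. -/
def relCoboundary (n : ℕ) {X : Type u} [TopologicalSpace X] (A : Set X) :
    AddSubgroup (SingularCochain n X) :=
  match n with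
  | 0 => ⊥
  | m + 1 => (relCochain m A).map (coboundary m X)

/-- The singular cohomology group `Hⁿ(X, A; ℤ)`. -/
def RelCohomology (n : ℕ) (X : Type u) [TopologicalSpace X] (A : Set X) : Type u :=
  relCocycle n A ⧸ (relCoboundary n A).addSubgroupOf (relCocycle n A)

instance (n : ℕ) (X : Type u) [TopologicalSpace X] (A : Set X) :
    AddCommGroup (RelCohomology n X A) :=
  inferInstanceAs (AddCommGroup (relCocycle n A ⧸ (relCoboundary n A).addSubgroupOf _))

/-- The singular cohomology group `Hⁿ(X; ℤ)`. -/
abbrev Cohomology (n : ℕ) (X : Type u) [TopologicalSpace X] : Type u :=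
  RelCohomology n X (∅ : Set X)

section Functoriality

variable {X : Type u} {X' : Type v} [TopologicalSpace X] [TopologicalSpace X']

theorem pullback_coboundary (f : C(X, X')) (n : ℕ) (c : SingularCochain n X') :
    SingularCochain.pullback f (n + 1) (coboundary n X' c) =
      coboundary n X (SingularCochain.pullback f n c) := rfl

theorem pullback_mem_relCochain (f : C(X, X')) (n : ℕ) {A : Set X} {A' : Set X'}
    (h : MapsTo f A A') {c : SingularCochain n X'} (hc : c ∈ relCochain n A') :
    SingularCochain.pullback f n c ∈ relCochain n A :=
  fun σ hσ => hc (f.comp σ) fun p => h (hσ p)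

theorem pullback_mem_relCocycle (f : C(X, X')) (n : ℕ) {A : Set X} {A' : Set X'}
    (h : MapsTo f A A') {c : SingularCochain n X'} (hc : c ∈ relCocycle n A') :
    SingularCochain.pullback f n c ∈ relCocycle n A := by
  refine ⟨pullback_mem_relCochain f n h hc.1, ?_⟩
  have h2 : coboundary n X' c = 0 := hc.2
  change coboundary n X (SingularCochain.pullback f n c) = 0
  rw [← pullback_coboundary, h2, map_zero]

theorem pullback_mem_relCoboundary (f : C(X, X')) (n : ℕ) {A : Set X} {A' : Set X'}
    (h : MapsTo f A A') {c : SingularCochain n X'} (hc : c ∈ relCoboundary n A') :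
    SingularCochain.pullback f n c ∈ relCoboundary n A := by
  cases n with
  | zero =>
    have h0 : c = 0 := hc
    rw [h0, map_zero]
    exact zero_mem _
  | succ m =>
    obtain ⟨b, hb, rfl⟩ := hc
    exact ⟨SingularCochain.pullback f m b, pullback_mem_relCochain f m h hb, rfl⟩

/-- The homomorphism `f* : Hⁿ(X', A') → Hⁿ(X, A)` induced by a map of pairs. -/
def RelCohomology.pullback (n : ℕ) (f : C(X, X')) {A : Set X} {A' : Set X'}
    (h : MapsTo f A A') : RelCohomology n X' A' →+ RelCohomology n X A :=
  QuotientAddGroup.map _ _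
    (((SingularCochain.pullback f n).comp (relCocycle n A').subtype).codRestrict (relCocycle n A)
      fun c => pullback_mem_relCocycle f n h c.2)
    (fun _ hc => pullback_mem_relCoboundary f n h hc)

/-- The homomorphism `f* : Hⁿ(X') → Hⁿ(X)` induced by a continuous map. -/
def Cohomology.pullback (n : ℕ) (f : C(X, X')) : Cohomology n X' →+ Cohomology n X :=
  RelCohomology.pullback n f (mapsTo_empty f ∅)

/-- The homomorphism `Hⁿ(X, A) → Hⁿ(X)` of the long exact sequence of the pair. -/
def RelCohomology.toAbsolute (n : ℕ) (A : Set X) : RelCohomology n X A →+ Cohomology n X :=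
  RelCohomology.pullback n (ContinuousMap.id X) (mapsTo_empty _ A)

end Functoriality

/-! ### Normal bundle, disc bundle and Thom space of an embedded submanifold -/

/-- Smooth Riemannian metrics on the `n`-manifold `B`. -/
abbrev SmoothMetric (n : ℕ) (B : Type u) [TopologicalSpace B]
    [ChartedSpace (EuclideanSpace ℝ (Fin n)) B] [IsManifold (𝓡 n) ∞ B] : Type u :=
  Bundle.ContMDiffRiemannianMetric (𝓡 n) ∞ (EuclideanSpace ℝ (Fin n))
    (fun x : B => TangentSpace (𝓡 n) x)

section Normal

variable {n k : ℕ} {B : Type u} [TopologicalSpace B]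
  [ChartedSpace (EuclideanSpace ℝ (Fin n)) B] [IsManifold (𝓡 n) ∞ B]
  {F : Type v} [TopologicalSpace F] [ChartedSpace (EuclideanSpace ℝ (Fin k)) F]

/-- The total space of the normal bundle of the submanifold `f : F → B`, as a subspace of `TB`:
the tangent vectors of `B` at points of `F` that are orthogonal to `F`. -/
def normalBundle (k : ℕ) [ChartedSpace (EuclideanSpace ℝ (Fin k)) F]
    (f : F → B) (g : SmoothMetric n B) : Set (TangentBundle (𝓡 n) B) :=
  {ξ | ∃ (p : F) (ν : TangentSpace (𝓡 n) (f p)), ξ = ⟨f p, ν⟩ ∧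
    ∀ τ : TangentSpace (𝓡 k) p, g.inner (f p) (mfderiv (𝓡 k) (𝓡 n) f p τ) ν = 0}

/-- The closed unit disc bundle `D(F)` of the normal bundle. -/
def discBundle (k : ℕ) [ChartedSpace (EuclideanSpace ℝ (Fin k)) F]
    (f : F → B) (g : SmoothMetric n B) : Set (TangentBundle (𝓡 n) B) :=
  {ξ ∈ normalBundle k f g | g.inner ξ.proj ξ.snd ξ.snd ≤ 1}

/-- The open unit disc bundle of the normal bundle. -/
def openDiscBundle (k : ℕ) [ChartedSpace (EuclideanSpace ℝ (Fin k)) F]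
    (f : F → B) (g : SmoothMetric n B) : Set (TangentBundle (𝓡 n) B) :=
  {ξ ∈ normalBundle k f g | g.inner ξ.proj ξ.snd ξ.snd < 1}

/-- The unit sphere bundle `S(F)` of the normal bundle. -/
def sphereBundle (k : ℕ) [ChartedSpace (EuclideanSpace ℝ (Fin k)) F]
    (f : F → B) (g : SmoothMetric n B) : Set (TangentBundle (𝓡 n) B) :=
  {ξ ∈ normalBundle k f g | g.inner ξ.proj ξ.snd ξ.snd = 1}

/-- The Thom space `TD(F) = D(F)/S(F)` of the normal disc bundle: the quotient of the disjoint
union of `D(F)` and a base point in which every point of `S(F)` is identified with the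
base point. -/
def ThomSpace (k : ℕ) [ChartedSpace (EuclideanSpace ℝ (Fin k)) F]
    (f : F → B) (g : SmoothMetric n B) : Type u :=
  Quot fun a b : discBundle k f g ⊕ Unit =>
    ∃ ξ : discBundle k f g, ξ.1 ∈ sphereBundle k f g ∧ a = Sum.inl ξ ∧ b = Sum.inr ()

instance (k : ℕ) [ChartedSpace (EuclideanSpace ℝ (Fin k)) F]
    (f : F → B) (g : SmoothMetric n B) : TopologicalSpace (ThomSpace k f g) :=
  inferInstanceAs (TopologicalSpace (Quot _))

/-- The image in the Thom space of a point of the disc bundle. -/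
def ThomSpace.ofDisc {f : F → B} {g : SmoothMetric n B} (ξ : discBundle k f g) :
    ThomSpace k f g :=
  Quot.mk _ (Sum.inl ξ)

/-- The base point of the Thom space. -/
def ThomSpace.base {f : F → B} {g : SmoothMetric n B} : ThomSpace k f g :=
  Quot.mk _ (Sum.inr ())

/-- A closed tubular neighbourhood of the submanifold `f : F → B`: a map `t : D(F) → B` which is
a continuous injection (for compact `F` and Hausdorff `B`, hence a homeomorphism onto its image),
restricts to the inclusion of `F` on the zero section, and maps the open disc bundle
diffeomorphically onto an open subset `N(F)` of `B`. The values of `t` outside `D(F)` play no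
role. -/
structure TubularNeighborhood (k : ℕ) [ChartedSpace (EuclideanSpace ℝ (Fin k)) F]
    (f : F → B) (g : SmoothMetric n B) where
  /-- the map `t` -/
  toFun : TangentBundle (𝓡 n) B → B
  continuousOn : ContinuousOn toFun (discBundle k f g)
  injOn : InjOn toFun (discBundle k f g)
  zero_section : ∀ p : F, toFun ⟨f p, 0⟩ = f p
  isOpen_image : IsOpen (toFun '' openDiscBundle k f g)
  contMDiffOn : ContMDiffOn (𝓡 n).tangent (𝓡 n) ∞ toFun (openDiscBundle k f g)
  exists_inverse : ∃ r : B → TangentBundle (𝓡 n) B,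
    ContMDiffOn (𝓡 n) (𝓡 n).tangent ∞ r (toFun '' openDiscBundle k f g) ∧
      ∀ ξ ∈ openDiscBundle k f g, r (toFun ξ) = ξ

open Classical in
/-- The collapse map `λ : Bt → TD(F)` of a space `Bt` containing `B` (through `i : B → Bt`): it is
the inverse of the tubular neighbourhood, followed by `D(F) → TD(F)`, on the image of `D(F)`,
and sends everything outside the tubular neighbourhood to the base point. -/
def TubularNeighborhood.collapse {f : F → B} {g : SmoothMetric n B}
    (T : TubularNeighborhood k f g) {Bt : Type w} (i : B → Bt) (x : Bt) : ThomSpace k f g :=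
  if h : ∃ ξ : discBundle k f g, i (T.toFun ξ.1) = x then ThomSpace.ofDisc h.choose
  else ThomSpace.base

end Normal

/-! ### The map `Hᵐ(B, B - F) → Hᵐ(Bt)` -/

section Canonical

variable {B : Type u} [TopologicalSpace B] {Bt : Type w} [TopologicalSpace Bt]

/-- The restriction `Hᵐ(Bt, Bt - S) → Hᵐ(B, B - S)` for an embedding `i : B → Bt` and a subset `S`
of `B`, which is regarded as a subset of `Bt` through `i`. -/
def excisionMap (m : ℕ) (i : C(B, Bt)) (hi : Function.Injective i) (S : Set B) :
    RelCohomology m Bt (i '' S)ᶜ →+ RelCohomology m B Sᶜ :=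
  RelCohomology.pullback m i fun _ hx hx' => hx (hi.mem_set_image.1 hx')

/-- When restriction is an isomorphism (excision), the map `Hᵐ(B, B - S) → Hᵐ(Bt)`: the inverse
of the excision isomorphism, followed by the map of the long exact sequence of
`(Bt, Bt - S)`. -/
def extensionMap (m : ℕ) (i : C(B, Bt)) (hi : Function.Injective i) (S : Set B)
    (hexc : Function.Bijective (excisionMap m i hi S)) :
    RelCohomology m B Sᶜ →+ Cohomology m Bt :=
  (RelCohomology.toAbsolute m (i '' S)ᶜ).comp
    (AddEquiv.ofBijective (excisionMap m i hi S) hexc).symm.toAddMonoidHom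

end Canonical

end

/-! Cohomology. Write `N` for the open tubular neighbourhood, `Y` for the Thom space, `Bt` for a
compactification and `F'` for the zero section in `Y`. The pair `(N, N - F)` sits in `(B, B - F)`,
in `(Bt, Bt - F)` and in `(Y, Y - F')` by open embeddings. Hence `ψ` can be defined without `Bt`:
restrict from `(B, B - F)` to `(N, N - F)`, go back to `(Y, Y - F')` by excision, then forget the
subspace. The collapse map restricts on `N` to the embedding into `Y`. So the pull-back of a class
of `(Y, Y - F')` and the class of `(Bt, Bt - F)` that it should equal agree on `N`, and excision for
`N` in `Bt` makes them equal; the maps to absolute cohomology are natural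
(`exists_hom_cohomology_thomSpace`). Continuity of the collapse map uses that `D(F)` is compact and
`Bt` Hausdorff (`continuous_collapse`), and naturality in `Bt` holds already for the collapse maps
(`collapse_comp`).

Excision (`bijective_pullback_of_isOpenEmbedding`) is proved on cochains. Extension by zero turns
both injectivity and surjectivity into one claim: the cochains vanishing on every simplex inside one
of two open sets that cover the space form an acyclic complex in positive degrees. If `c` is such a
cocycle, `S` barycentric subdivision and `h` its homotopy to the identity, then `∑ h (S^i c)` is a
primitive. The sum is finite on each simplex, because a fixed simplex becomes small after finitely
many subdivisions. The operators are first built on functions of tuples of points, where coning is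
just adjoining a first entry, and carried over to singular simplices by affine maps.

Tubular neighbourhoods. The Riemannian logarithm is replaced by `bumpLog`, a vector at `x` depending
on `y` that vanishes for `x = y` and whose `y`-derivative there is a multiple of the identity,
nonzero along `F`. By the inverse function theorem, `(x, y) ↦ bumpLog x y` is a diffeomorphism from
a neighbourhood of the diagonal over `F` onto a neighbourhood of the zero section in `TB`; the
second component of its inverse is an endpoint map. On the normal bundle this map has smooth local
inverses, obtained by solving for the foot point `x` in `F` at which `bumpLog x y` is normal
(`isLocalDiffeomorphAt_sliceMap`). It is injective on the zero section, hence near it by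
compactness, and scaling the compact disc bundle into that region yields `t`. The metric itself is
glued from local ones by a partition of unity. -/

noncomputable section

/-! ### The complex of functions on tuples, and its subdivision operator -/

section Tuples

variable {K : Type*} {K' : Type*}

/-- The alternating sum `∑ i, (-1)^i c(v₀, …, v̂ᵢ, …, vₖ)`. -/
def tupleCoboundary {k : ℕ} (c : (Fin k → K) → ℤ) : (Fin (k + 1) → K) → ℤ :=
  fun v => ∑ i : Fin (k + 1), (-1) ^ (i : ℕ) * c (v ∘ i.succAbove)

theorem tupleCoboundary_sub {k : ℕ} (c c' : (Fin k → K) → ℤ) :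
    tupleCoboundary (c - c') = tupleCoboundary c - tupleCoboundary c' := by
  funext v
  simp [tupleCoboundary, mul_sub, Finset.sum_sub_distrib]

@[simp] theorem tupleCoboundary_zero {k : ℕ} :
    tupleCoboundary (0 : (Fin k → K) → ℤ) = 0 := by
  funext v
  simp [tupleCoboundary]

/-- Contraction with a point: `(κ_b c)(w) = c(b, w)`. -/
def tupleCone {k : ℕ} (b : K) (c : (Fin (k + 1) → K) → ℤ) : (Fin k → K) → ℤ :=
  fun w => c (Fin.cons b w : Fin (k + 1) → K)

theorem cons_comp_succAbove_succ {k : ℕ} (b : K) (w : Fin (k + 1) → K) (i : Fin (k + 1)) :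
    (Fin.cons b w : Fin (k + 2) → K) ∘ i.succ.succAbove =
      (Fin.cons b (w ∘ i.succAbove) : Fin (k + 1) → K) := by
  funext j
  refine Fin.cases ?_ (fun j => ?_) j
  · simp
  · simp

theorem cons_comp_succAbove_zero {k : ℕ} (b : K) (w : Fin k → K) :
    (Fin.cons b w : Fin (k + 1) → K) ∘ (0 : Fin (k + 1)).succAbove = w := by
  funext j
  simp

/-- Among the faces of `(b, w)`, the one omitting `b` gives `c w`; the others are cones over the
faces of `w`, with the sign shifted by one. Coning is thus a contracting homotopy. -/
theorem tupleCone_tupleCoboundary {k : ℕ} (b : K) (c : (Fin (k + 1) → K) → ℤ) :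
    tupleCone b (tupleCoboundary c) = c - tupleCoboundary (tupleCone b c) := by
  funext w
  simp only [tupleCone, tupleCoboundary, Pi.sub_apply]
  rw [Fin.sum_univ_succ]
  simp only [cons_comp_succAbove_succ, cons_comp_succAbove_zero]
  simp [pow_succ, sub_eq_add_neg]

theorem tupleCone_tupleCoboundary_zero (b : K) (c : (Fin 0 → K) → ℤ) (w : Fin 0 → K) :
    tupleCone b (tupleCoboundary c) w = c w := by
  simp only [tupleCone, tupleCoboundary]
  rw [Fin.sum_univ_succ, cons_comp_succAbove_zero]
  simp

/-- With `κ` the cone at the first entry and `δ` the coboundary, two uses of the cone formula give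
`κδδc = δc - δκδc = δδκc`, which has lower degree, so induction replaces the usual double sum. The
complex is augmented: it starts with functions of the empty tuple. -/
theorem tupleCoboundary_tupleCoboundary : ∀ {k : ℕ} (c : (Fin k → K) → ℤ),
    tupleCoboundary (tupleCoboundary c) = 0
  | 0, c => by
    funext v
    obtain ⟨b, w, rfl⟩ : ∃ b w, v = (Fin.cons b w : Fin 2 → K) :=
      ⟨v 0, Fin.tail v, (Fin.cons_self_tail v).symm⟩
    change tupleCone b (tupleCoboundary (tupleCoboundary c)) w = 0
    rw [tupleCone_tupleCoboundary]
    have : tupleCone b (tupleCoboundary c) = c :=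
      funext fun w => tupleCone_tupleCoboundary_zero b c w
    rw [this, sub_self, Pi.zero_apply]
  | k + 1, c => by
    funext v
    obtain ⟨b, w, rfl⟩ : ∃ b w, v = (Fin.cons b w : Fin (k + 3) → K) :=
      ⟨v 0, Fin.tail v, (Fin.cons_self_tail v).symm⟩
    change tupleCone b (tupleCoboundary (tupleCoboundary c)) w = 0
    rw [tupleCone_tupleCoboundary, tupleCone_tupleCoboundary, tupleCoboundary_sub,
      tupleCoboundary_tupleCoboundary (tupleCone b c)]
    simp

/-- The chain homotopy between the identity and barycentric subdivision, on cochains. The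
parameter `b` assigns a barycenter to every tuple. -/
def tupleHomotopy (b : ∀ k, (Fin (k + 1) → K) → K) :
    (k : ℕ) → ((Fin (k + 1) → K) → ℤ) → ((Fin k → K) → ℤ)
  | 0, _ => 0
  -- Dual to the chain formula `D v = b_v · (v - D ∂v)`. The cone point is chosen from `v` and stays
  -- fixed while the recursion evaluates on the faces of `v`.
  | k + 1, c => fun v => tupleCone (b k v) c v -
      tupleCoboundary (tupleHomotopy b k (tupleCone (b k v) c)) v

theorem tupleHomotopy_sub (b : ∀ k, (Fin (k + 1) → K) → K) : ∀ (k : ℕ)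
    (c c' : (Fin (k + 1) → K) → ℤ),
    tupleHomotopy b k (c - c') = tupleHomotopy b k c - tupleHomotopy b k c'
  | 0, c, c' => by simp [tupleHomotopy]
  | k + 1, c, c' => by
    funext v
    have h : tupleCone (b k v) (c - c') = tupleCone (b k v) c - tupleCone (b k v) c' := rfl
    simp only [tupleHomotopy, Pi.sub_apply, h, tupleHomotopy_sub b k, tupleCoboundary_sub]
    ring

@[simp] theorem tupleHomotopy_zero (b : ∀ k, (Fin (k + 1) → K) → K) (k : ℕ) :
    tupleHomotopy b k 0 = 0 := by
  have := tupleHomotopy_sub b k 0 0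
  simpa using this

/-- Barycentric subdivision, on cochains. -/
def tupleSubdivision (b : ∀ k, (Fin (k + 1) → K) → K) {k : ℕ}
    (c : (Fin (k + 1) → K) → ℤ) : (Fin (k + 1) → K) → ℤ :=
  c - tupleCoboundary (tupleHomotopy b k c) - tupleHomotopy b (k + 1) (tupleCoboundary c)

@[simp] theorem tupleSubdivision_zero (b : ∀ k, (Fin (k + 1) → K) → K) (k : ℕ) :
    tupleSubdivision b (0 : (Fin (k + 1) → K) → ℤ) = 0 := by
  simp [tupleSubdivision]

theorem tupleSubdivision_one (b : ∀ k, (Fin (k + 1) → K) → K)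
    (c : (Fin 1 → K) → ℤ) (v : Fin 1 → K) :
    tupleSubdivision b c v = c (fun _ => b 0 v) := by
  have h1 : tupleHomotopy b 1 (tupleCoboundary c) v =
      tupleCone (b 0 v) (tupleCoboundary c) v - tupleCoboundary 0 v := rfl
  have h2 : tupleHomotopy b 0 c = 0 := rfl
  rw [tupleSubdivision, Pi.sub_apply, Pi.sub_apply, h1, h2, tupleCone_tupleCoboundary]
  simp only [tupleCoboundary_zero, Pi.sub_apply, Pi.zero_apply, sub_zero, sub_sub_cancel]
  change (∑ i : Fin 1, (-1) ^ (i : ℕ) * tupleCone (b 0 v) c (v ∘ i.succAbove)) = _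
  rw [Fin.sum_univ_one, Fin.val_zero, pow_zero, one_mul]
  refine congrArg c ?_
  funext i
  exact Fin.cases rfl (fun j => j.elim0) i

/-- Subdivision was defined by the homotopy formula; this recovers its geometric recursion: cone
from the barycenter of `v` over the subdivided boundary of `v`. -/
theorem tupleSubdivision_succ (b : ∀ k, (Fin (k + 1) → K) → K) {k : ℕ}
    (c : (Fin (k + 2) → K) → ℤ) (v : Fin (k + 2) → K) :
    tupleSubdivision b c v =
      tupleCoboundary (tupleSubdivision b (tupleCone (b (k + 1) v) c)) v := by
  set κ := tupleCone (b (k + 1) v) c with hκ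
  have h1 : tupleHomotopy b (k + 2) (tupleCoboundary c) v = c v - tupleCoboundary κ v -
      tupleCoboundary (tupleHomotopy b (k + 1) c) v +
        tupleCoboundary (tupleHomotopy b (k + 1) (tupleCoboundary κ)) v := by
    change tupleCone (b (k + 1) v) (tupleCoboundary c) v - tupleCoboundary
      (tupleHomotopy b (k + 1) (tupleCone (b (k + 1) v) (tupleCoboundary c))) v = _
    rw [tupleCone_tupleCoboundary, tupleHomotopy_sub, tupleCoboundary_sub, ← hκ]
    simp only [Pi.sub_apply]
    ring
  rw [tupleSubdivision, Pi.sub_apply, Pi.sub_apply, h1, tupleSubdivision, tupleCoboundary_sub,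
    tupleCoboundary_sub, tupleCoboundary_tupleCoboundary]
  simp only [Pi.sub_apply, Pi.zero_apply]
  ring

theorem tupleCoboundary_comp (φ : K → K') {k : ℕ} (c : (Fin k → K') → ℤ) (v : Fin (k + 1) → K) :
    tupleCoboundary (fun u => c (φ ∘ u)) v = tupleCoboundary c (φ ∘ v) := rfl

/-- Naturality under maps preserving the chosen barycenters. Applied to affine maps, it lets the
operators on tuples define operators on singular cochains. -/
theorem tupleHomotopy_comp (b : ∀ k, (Fin (k + 1) → K) → K) (b' : ∀ k, (Fin (k + 1) → K') → K')
    (φ : K → K') (hφ : ∀ k (v : Fin (k + 1) → K), b' k (φ ∘ v) = φ (b k v)) : ∀ (k : ℕ)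
    (c : (Fin (k + 1) → K') → ℤ) (v : Fin k → K),
    tupleHomotopy b k (fun u => c (φ ∘ u)) v = tupleHomotopy b' k c (φ ∘ v)
  | 0, _, _ => rfl
  | k + 1, c, v => by
    have h : tupleCone (b k v) (fun u => c (φ ∘ u)) =
        fun u => tupleCone (b' k (φ ∘ v)) c (φ ∘ u) := by
      funext u
      simp only [tupleCone, hφ]
      congr 1
      funext i
      refine Fin.cases ?_ (fun j => ?_) i <;> simp
    simp only [tupleHomotopy, h]
    have h2 : tupleHomotopy b k (fun u => tupleCone (b' k (φ ∘ v)) c (φ ∘ u)) =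
        fun u => tupleHomotopy b' k (tupleCone (b' k (φ ∘ v)) c) (φ ∘ u) :=
      funext fun u => tupleHomotopy_comp b b' φ hφ k _ u
    rw [h2, tupleCoboundary_comp]

theorem tupleSubdivision_comp (b : ∀ k, (Fin (k + 1) → K) → K)
    (b' : ∀ k, (Fin (k + 1) → K') → K') (φ : K → K')
    (hφ : ∀ k (v : Fin (k + 1) → K), b' k (φ ∘ v) = φ (b k v)) {k : ℕ}
    (c : (Fin (k + 1) → K') → ℤ) (v : Fin (k + 1) → K) :
    tupleSubdivision b (fun u => c (φ ∘ u)) v = tupleSubdivision b' c (φ ∘ v) := by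
  have h1 : tupleHomotopy b k (fun u => c (φ ∘ u)) = fun u => tupleHomotopy b' k c (φ ∘ u) :=
    funext fun u => tupleHomotopy_comp b b' φ hφ k c u
  have h2 : tupleCoboundary (fun u => c (φ ∘ u)) = fun u : Fin (k + 2) → K =>
      tupleCoboundary c (φ ∘ u) := rfl
  simp only [tupleSubdivision, Pi.sub_apply, h1, h2, tupleHomotopy_comp b b' φ hφ,
    tupleCoboundary_comp]

end Tuples

/-! ### Affine simplices in a standard simplex -/

section Affine

/-- The affine map between standard simplices with given vertices. -/
def affineSimplex {k n : ℕ} (v : Fin (k + 1) → stdSimplex ℝ (Fin (n + 1))) :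
    C(stdSimplex ℝ (Fin (k + 1)), stdSimplex ℝ (Fin (n + 1))) where
  toFun x := ⟨∑ i, x i • (v i : Fin (n + 1) → ℝ),
    (convex_stdSimplex ℝ (Fin (n + 1))).sum_mem (fun i _ => x.2.1 i) x.2.2 fun i _ => (v i).2⟩
  continuous_toFun := by
    refine Continuous.subtype_mk (continuous_finsetSum _ fun i _ => ?_) _
    exact ((continuous_apply i).comp continuous_subtype_val).smul continuous_const

theorem affineSimplex_coe {k n : ℕ} (v : Fin (k + 1) → stdSimplex ℝ (Fin (n + 1)))
    (x : stdSimplex ℝ (Fin (k + 1))) :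
    ((affineSimplex v x : stdSimplex ℝ (Fin (n + 1))) : Fin (n + 1) → ℝ) =
      ∑ i, x i • (v i : Fin (n + 1) → ℝ) := rfl

theorem affineSimplex_comp_affineSimplex {k m n : ℕ}
    (w : Fin (m + 1) → stdSimplex ℝ (Fin (n + 1)))
    (v : Fin (k + 1) → stdSimplex ℝ (Fin (m + 1))) :
    (affineSimplex w).comp (affineSimplex v) = affineSimplex (affineSimplex w ∘ v) := by
  ext x j
  simp only [ContinuousMap.comp_apply, affineSimplex_coe, Function.comp_apply]
  simp only [Finset.sum_apply, Pi.smul_apply, smul_eq_mul, Finset.sum_mul, Finset.mul_sum]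
  rw [Finset.sum_comm]
  simp only [mul_assoc]

theorem affineSimplex_comp_map {k k' n : ℕ} (v : Fin (k + 1) → stdSimplex ℝ (Fin (n + 1)))
    (f : Fin (k' + 1) → Fin (k + 1)) (x : stdSimplex ℝ (Fin (k' + 1))) :
    affineSimplex v (stdSimplex.map f x) = affineSimplex (v ∘ f) x := by
  apply stdSimplex.ext
  simp only [affineSimplex_coe, Function.comp_apply]
  have h : ∀ i, (stdSimplex.map f x) i = ∑ l with f l = i, x l := fun i => by
    have := congrFun (stdSimplex.map_coe (S := ℝ) f x) i
    simp only [this]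
    rw [FunOnFinite.linearMap_apply_apply]
  simp only [h, Finset.sum_smul]
  rw [← Finset.sum_fiberwise (s := Finset.univ) (g := f)]
  refine Finset.sum_congr rfl fun i _ => Finset.sum_congr rfl fun l hl => ?_
  rw [(Finset.mem_filter.1 hl).2]

theorem affineSimplex_vertex {k n : ℕ} (v : Fin (k + 1) → stdSimplex ℝ (Fin (n + 1)))
    (i : Fin (k + 1)) : affineSimplex v (stdSimplex.vertex i) = v i := by
  apply stdSimplex.ext
  rw [affineSimplex_coe]
  have h : ∀ j, (stdSimplex.vertex i : stdSimplex ℝ (Fin (k + 1))) j =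
      (Pi.single i 1 : Fin (k + 1) → ℝ) j := fun j => congrFun (stdSimplex.vertex_coe i) j
  simp [h, Pi.single_apply, ite_smul]

theorem affineSimplex_vertices (n : ℕ) :
    affineSimplex (fun i : Fin (n + 1) => stdSimplex.vertex i) = ContinuousMap.id _ := by
  ext x j
  have h : ∀ i, (stdSimplex.vertex i : stdSimplex ℝ (Fin (n + 1))) j =
      (Pi.single i 1 : Fin (n + 1) → ℝ) j := fun i => congrFun (stdSimplex.vertex_coe i) j
  have h2 := congrFun (affineSimplex_coe (fun i : Fin (n + 1) => stdSimplex.vertex i) x) j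
  simp only [Finset.sum_apply, Pi.smul_apply, smul_eq_mul] at h2
  refine h2.trans ?_
  simp only [h, Pi.single_apply]
  simp

theorem affineSimplex_mem_convexHull {k n : ℕ} (v : Fin (k + 1) → stdSimplex ℝ (Fin (n + 1)))
    (x : stdSimplex ℝ (Fin (k + 1))) :
    (affineSimplex v x : Fin (n + 1) → ℝ) ∈
      convexHull ℝ (range fun i => (v i : Fin (n + 1) → ℝ)) := by
  rw [affineSimplex_coe]
  exact (convex_convexHull ℝ _).sum_mem (fun i _ => x.2.1 i) x.2.2
    fun i _ => subset_convexHull ℝ _ (mem_range_self i)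

/-- The barycenter of a tuple of points of a standard simplex. -/
def tupleBarycenter (n : ℕ) (k : ℕ) (v : Fin (k + 1) → stdSimplex ℝ (Fin (n + 1))) :
    stdSimplex ℝ (Fin (n + 1)) :=
  affineSimplex v stdSimplex.barycenter

theorem tupleBarycenter_comp {m n k : ℕ} (w : Fin (m + 1) → stdSimplex ℝ (Fin (n + 1)))
    (v : Fin (k + 1) → stdSimplex ℝ (Fin (m + 1))) :
    tupleBarycenter n k (affineSimplex w ∘ v) = affineSimplex w (tupleBarycenter m k v) := by
  rw [tupleBarycenter, ← affineSimplex_comp_affineSimplex]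
  rfl

/-- The difference of `v i` and the barycenter is the average of the `k + 1` vectors `v i - v j`,
one of which is zero; this gives the factor `k / (k + 1)`. Convexity of the ball passes from the
vertices to the hull. -/
theorem dist_tupleBarycenter_le {n k : ℕ} (v : Fin (k + 1) → stdSimplex ℝ (Fin (n + 1)))
    {d : ℝ} (hd : ∀ i j, dist (v i) (v j) ≤ d) {p : stdSimplex ℝ (Fin (n + 1))}
    (hp : (p : Fin (n + 1) → ℝ) ∈ convexHull ℝ (range fun i => (v i : Fin (n + 1) → ℝ))) :
    dist p (tupleBarycenter n k v) ≤ k / (k + 1) * d := by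
  have key : convexHull ℝ (range fun i => (v i : Fin (n + 1) → ℝ)) ⊆
      Metric.closedBall (tupleBarycenter n k v : Fin (n + 1) → ℝ) (k / (k + 1) * d) := by
    refine convexHull_min ?_ (convex_closedBall _ _)
    rintro _ ⟨i, rfl⟩
    rw [Metric.mem_closedBall, dist_eq_norm]
    have hk : (0 : ℝ) < k + 1 := by positivity
    have h1 : (v i : Fin (n + 1) → ℝ) - (tupleBarycenter n k v : Fin (n + 1) → ℝ) =
        ∑ j, ((k + 1 : ℝ)⁻¹) • ((v i : Fin (n + 1) → ℝ) - v j) := by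
      have h : ∀ j, (stdSimplex.barycenter : stdSimplex ℝ (Fin (k + 1))) j = (k + 1 : ℝ)⁻¹ :=
        fun j => by
          change ((Fintype.card (Fin (k + 1)) : ℝ))⁻¹ = _
          simp
      rw [tupleBarycenter, affineSimplex_coe]
      simp only [h, smul_sub, Finset.sum_sub_distrib, Finset.sum_const,
        Finset.card_univ, Fintype.card_fin]
      rw [← Nat.cast_smul_eq_nsmul ℝ, smul_smul]
      simp [hk.ne']
    rw [h1]
    have h2 : ∀ j, ‖((k + 1 : ℝ)⁻¹) • ((v i : Fin (n + 1) → ℝ) - v j)‖ ≤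
        if j = i then 0 else (k + 1 : ℝ)⁻¹ * d := by
      intro j
      split_ifs with h
      · simp [h]
      · rw [norm_smul, Real.norm_of_nonneg (by positivity)]
        gcongr
        have := hd i j
        rwa [Subtype.dist_eq, dist_eq_norm] at this
    refine (norm_sum_le_of_le _ fun j _ => h2 j).trans ?_
    rw [← Finset.sum_erase_add _ _ (Finset.mem_univ i)]
    rw [Finset.sum_congr rfl fun j hj => if_neg (Finset.ne_of_mem_erase hj)]
    simp [Finset.card_erase_of_mem, div_eq_mul_inv, mul_assoc]
  exact key hp

/-- The cochain form of the fact that the pieces of a subdivided simplex of diameter at most `d`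
stay in its hull and have diameter at most `k / (k + 1) * d`. The hull condition is carried along
because the distance to the barycenter is controlled only there. -/
theorem tupleSubdivision_eq_zero {n : ℕ} {d : ℝ} : ∀ {k : ℕ}
    (c : (Fin (k + 1) → stdSimplex ℝ (Fin (n + 1))) → ℤ)
    (v : Fin (k + 1) → stdSimplex ℝ (Fin (n + 1))) (_ : ∀ i j, dist (v i) (v j) ≤ d)
    (_ : ∀ w : Fin (k + 1) → stdSimplex ℝ (Fin (n + 1)),
      (∀ i, (w i : Fin (n + 1) → ℝ) ∈ convexHull ℝ (range fun i => (v i : Fin (n + 1) → ℝ))) →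
      (∀ i j, dist (w i) (w j) ≤ k / (k + 1) * d) → c w = 0),
    tupleSubdivision (tupleBarycenter n) c v = 0
  | 0, c, v, hd, hc => by
    rw [tupleSubdivision_one]
    exact hc _ (fun _ => affineSimplex_mem_convexHull v _) fun _ _ => by simp
  | k + 1, c, v, hd, hc => by
    have hd0 : 0 ≤ d := by simpa using hd 0 0
    rw [tupleSubdivision_succ]
    refine Finset.sum_eq_zero fun i _ => ?_
    rw [tupleSubdivision_eq_zero _ (v ∘ i.succAbove) (fun _ _ => hd _ _), mul_zero]
    intro w hw hwd
    have hw' : ∀ j, (w j : Fin (n + 1) → ℝ) ∈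
        convexHull ℝ (range fun i => (v i : Fin (n + 1) → ℝ)) := fun j =>
      convexHull_mono (range_comp_subset_range i.succAbove
        fun i => (v i : Fin (n + 1) → ℝ)) (hw j)
    -- The pieces of the faces shrink by the ratio of the lower dimension, which is smaller.
    have hkk : (k : ℝ) / (k + 1) * d ≤ ((k + 1 : ℕ) : ℝ) / ((k + 1 : ℕ) + 1) * d := by
      gcongr ?_ * d
      rw [div_le_div_iff₀ (by positivity) (by positivity)]
      push_cast
      nlinarith
    refine hc _ (fun j => ?_) fun j l => ?_
    · refine Fin.cases ?_ (fun j => ?_) j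
      · exact affineSimplex_mem_convexHull v _
      · simpa using hw' j
    · refine Fin.cases ?_ (fun j => ?_) j
      · refine Fin.cases ?_ (fun l => ?_) l
        · simp only [dist_self]; positivity
        · rw [dist_comm]
          simpa using dist_tupleBarycenter_le v hd (hw' l)
      · refine Fin.cases ?_ (fun l => ?_) l
        · simpa using dist_tupleBarycenter_le v hd (hw' j)
        · simpa using (hwd j l).trans hkk

theorem iterate_tupleSubdivision_eq_zero {n k : ℕ}
    (c : (Fin (k + 1) → stdSimplex ℝ (Fin (n + 1))) → ℤ) : ∀ (N : ℕ) (d : ℝ)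
    (_ : ∀ w : Fin (k + 1) → stdSimplex ℝ (Fin (n + 1)),
      (∀ i j, dist (w i) (w j) ≤ ((k : ℝ) / (k + 1)) ^ N * d) → c w = 0)
    (v : Fin (k + 1) → stdSimplex ℝ (Fin (n + 1))) (_ : ∀ i j, dist (v i) (v j) ≤ d),
    (tupleSubdivision (tupleBarycenter n))^[N] c v = 0
  | 0, d, hc, v, hd => hc v (by simpa using hd)
  | N + 1, d, hc, v, hd => by
    rw [Function.iterate_succ_apply']
    refine tupleSubdivision_eq_zero _ v hd fun w _ hw => ?_
    refine iterate_tupleSubdivision_eq_zero c N _ (fun w' hw' => hc w' ?_) w hw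
    intro i j
    refine (hw' i j).trans_eq ?_
    ring

end Affine

/-! ### Subdivision of singular cochains -/

section Singular

variable {X : Type*} [TopologicalSpace X]

theorem coboundary_apply {m : ℕ} (c : SingularCochain m X) (σ : SingularSimplex (m + 1) X) :
    coboundary m X c σ = ∑ i : Fin (m + 2), (-1) ^ (i : ℕ) * c (σ.face i) := rfl

/-- The values of a singular cochain on the affine simplices of a singular simplex. -/
def SingularCochain.onTuples {m n : ℕ} (c : SingularCochain m X) (σ : SingularSimplex n X) :
    (Fin (m + 1) → stdSimplex ℝ (Fin (n + 1))) → ℤ :=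
  fun w => c (ContinuousMap.comp σ (affineSimplex w))

/-- The tuple of the vertices of the standard simplex. -/
def vertexTuple (n : ℕ) : Fin (n + 1) → stdSimplex ℝ (Fin (n + 1)) :=
  fun i => stdSimplex.vertex i

theorem onTuples_vertexTuple {m : ℕ} (c : SingularCochain m X) (σ : SingularSimplex m X) :
    c.onTuples σ (vertexTuple m) = c σ := by
  change c (ContinuousMap.comp σ (affineSimplex fun i => stdSimplex.vertex i)) = c σ
  rw [affineSimplex_vertices, ContinuousMap.comp_id]

theorem onTuples_coboundary {m n : ℕ} (c : SingularCochain m X) (σ : SingularSimplex n X) :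
    SingularCochain.onTuples (coboundary m X c) σ = tupleCoboundary (c.onTuples σ) := by
  funext w
  rw [SingularCochain.onTuples, coboundary_apply, tupleCoboundary]
  refine Finset.sum_congr rfl fun i _ => congrArg (fun z => (-1) ^ (i : ℕ) * c z) ?_
  exact ContinuousMap.ext fun x => congrArg σ (affineSimplex_comp_map w i.succAbove x)

theorem onTuples_comp_affineSimplex {m n k : ℕ} (c : SingularCochain m X)
    (σ : SingularSimplex n X) (w : Fin (k + 1) → stdSimplex ℝ (Fin (n + 1))) :
    c.onTuples (ContinuousMap.comp σ (affineSimplex w)) =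
      fun u => c.onTuples σ (affineSimplex w ∘ u) := by
  funext u
  simp only [SingularCochain.onTuples, ContinuousMap.comp_assoc, affineSimplex_comp_affineSimplex]

theorem affineSimplex_comp_vertexTuple {k n : ℕ}
    (w : Fin (k + 1) → stdSimplex ℝ (Fin (n + 1))) :
    affineSimplex w ∘ vertexTuple k = w :=
  funext fun i => affineSimplex_vertex w i

/-- The chain homotopy between the identity and subdivision, on singular cochains. -/
def singularHomotopy {m : ℕ} (c : SingularCochain (m + 1) X) : SingularCochain m X :=
  fun σ => tupleHomotopy (tupleBarycenter m) (m + 1) (c.onTuples σ) (vertexTuple m)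

/-- Barycentric subdivision of singular cochains. -/
def singularSubdivision {m : ℕ} (c : SingularCochain m X) : SingularCochain m X :=
  fun σ => tupleSubdivision (tupleBarycenter m) (c.onTuples σ) (vertexTuple m)

theorem onTuples_singularHomotopy {m n : ℕ} (c : SingularCochain (m + 1) X)
    (σ : SingularSimplex n X) :
    (singularHomotopy c).onTuples σ = tupleHomotopy (tupleBarycenter n) (m + 1) (c.onTuples σ) := by
  funext w
  have := tupleHomotopy_comp (tupleBarycenter m) (tupleBarycenter n) (affineSimplex w)
    (fun k v => tupleBarycenter_comp w v) (m + 1) (c.onTuples σ) (vertexTuple m)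
  rw [affineSimplex_comp_vertexTuple, ← onTuples_comp_affineSimplex] at this
  exact this

theorem onTuples_singularSubdivision {m n : ℕ} (c : SingularCochain m X)
    (σ : SingularSimplex n X) :
    (singularSubdivision c).onTuples σ =
      tupleSubdivision (tupleBarycenter n) (c.onTuples σ) := by
  funext w
  have := tupleSubdivision_comp (tupleBarycenter m) (tupleBarycenter n) (affineSimplex w)
    (fun k v => tupleBarycenter_comp w v) (c.onTuples σ) (vertexTuple m)
  rw [affineSimplex_comp_vertexTuple, ← onTuples_comp_affineSimplex] at this
  exact this

theorem onTuples_iterate_singularSubdivision {m n : ℕ} (c : SingularCochain m X)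
    (σ : SingularSimplex n X) (N : ℕ) :
    SingularCochain.onTuples (singularSubdivision^[N] c) σ =
      (tupleSubdivision (tupleBarycenter n))^[N] (c.onTuples σ) := by
  induction N with
  | zero => rfl
  | succ N ih =>
    rw [Function.iterate_succ_apply', Function.iterate_succ_apply',
      onTuples_singularSubdivision, ih]

theorem singularSubdivision_eq {m : ℕ} (c : SingularCochain (m + 1) X) :
    singularSubdivision c = c - coboundary m X (singularHomotopy c) -
      singularHomotopy (coboundary (m + 1) X c) := by
  funext σ
  rw [Pi.sub_apply, Pi.sub_apply, ← onTuples_vertexTuple c σ,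
    ← onTuples_vertexTuple (coboundary m X (singularHomotopy c)), onTuples_coboundary,
    onTuples_singularHomotopy, singularHomotopy, onTuples_coboundary]
  rfl

theorem coboundary_coboundary {m : ℕ} (c : SingularCochain m X) :
    coboundary (m + 1) X (coboundary m X c) = 0 := by
  funext σ
  rw [← onTuples_vertexTuple (coboundary (m + 1) X (coboundary m X c)), onTuples_coboundary,
    onTuples_coboundary, tupleCoboundary_tupleCoboundary]
  rfl

/-! ### Acyclicity of the complex of cochains vanishing on small simplices. -/

/-- The cochains that vanish on all simplices lying in `U` or in `V`. -/
def VanishesOnSmall (U V : Set X) {m : ℕ} (c : SingularCochain m X) : Prop :=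
  ∀ σ : SingularSimplex m X, (∀ p, σ p ∈ U) ∨ (∀ p, σ p ∈ V) → c σ = 0

theorem VanishesOnSmall.onTuples_eq_zero {U V : Set X} {m n : ℕ} {c : SingularCochain m X}
    (hc : VanishesOnSmall U V c) {σ : SingularSimplex n X}
    (hσ : (∀ p, σ p ∈ U) ∨ (∀ p, σ p ∈ V)) : c.onTuples σ = 0 := by
  funext w
  exact hc _ (hσ.imp (fun h p => h _) fun h p => h _)

theorem VanishesOnSmall.singularHomotopy {U V : Set X} {m : ℕ} {c : SingularCochain (m + 1) X}
    (hc : VanishesOnSmall U V c) : VanishesOnSmall U V (singularHomotopy c) := by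
  intro σ hσ
  rw [_root_.singularHomotopy, hc.onTuples_eq_zero hσ, tupleHomotopy_zero, Pi.zero_apply]

theorem VanishesOnSmall.singularSubdivision {U V : Set X} {m : ℕ} {c : SingularCochain m X}
    (hc : VanishesOnSmall U V c) : VanishesOnSmall U V (singularSubdivision c) := by
  intro σ hσ
  rw [_root_.singularSubdivision, hc.onTuples_eq_zero hσ, tupleSubdivision_zero, Pi.zero_apply]

/-- A Lebesgue number `ε` of the cover of the standard simplex pulled back by `σ` is eventually
larger than the pieces. A piece with vertices in an `ε`-ball lies in that ball by convexity, so `σ`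
maps it into `U` or into `V`. The number of subdivisions depends on `σ`. -/
theorem VanishesOnSmall.eventually_iterate_eq_zero {U V : Set X} (hU : IsOpen U) (hV : IsOpen V)
    (hUV : U ∪ V = univ) {m n : ℕ} {c : SingularCochain m X} (hc : VanishesOnSmall U V c)
    (σ : SingularSimplex n X) :
    ∀ᶠ N in Filter.atTop, (tupleSubdivision (tupleBarycenter n))^[N] (c.onTuples σ) = 0 := by
  obtain ⟨ε, hε, hball⟩ : ∃ ε > 0, ∀ x ∈ (univ : Set (stdSimplex ℝ (Fin (n + 1)))),
      ∃ b : Bool, Metric.ball x ε ⊆ (if b then σ ⁻¹' U else σ ⁻¹' V) := by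
    refine lebesgue_number_lemma_of_metric isCompact_univ (fun b => ?_) fun x _ => ?_
    · cases b
      · exact hV.preimage σ.continuous
      · exact hU.preimage σ.continuous
    · rcases hUV.ge (mem_univ (σ x)) with h | h
      · exact mem_iUnion.2 ⟨true, h⟩
      · exact mem_iUnion.2 ⟨false, h⟩
  have hr : Filter.Tendsto (fun N : ℕ => ((m : ℝ) / (m + 1)) ^ N *
      Metric.diam (univ : Set (stdSimplex ℝ (Fin (n + 1))))) Filter.atTop (𝓝 0) := by
    rw [← zero_mul (Metric.diam (univ : Set (stdSimplex ℝ (Fin (n + 1)))))]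
    refine Filter.Tendsto.mul_const _ (tendsto_pow_atTop_nhds_zero_of_lt_one (by positivity) ?_)
    rw [div_lt_one (by positivity)]
    linarith
  filter_upwards [hr.eventually (gt_mem_nhds hε)] with N hN
  funext v
  refine iterate_tupleSubdivision_eq_zero (c.onTuples σ) N _ (fun w hw => ?_) v
    fun i j => Metric.dist_le_diam_of_mem isCompact_univ.isBounded (mem_univ _) (mem_univ _)
  have hmem : ∀ p, affineSimplex w p ∈ Metric.ball (w 0) ε := by
    intro p
    have h1 : convexHull ℝ (range fun i => (w i : Fin (n + 1) → ℝ)) ⊆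
        Metric.ball (w 0 : Fin (n + 1) → ℝ) ε := by
      refine convexHull_min ?_ (convex_ball _ _)
      rintro _ ⟨i, rfl⟩
      exact (hw i 0).trans_lt hN
    exact h1 (affineSimplex_mem_convexHull w p)
  obtain ⟨b, hb⟩ := hball (w 0) (mem_univ _)
  refine hc _ ?_
  cases b
  · exact Or.inr fun p => hb (hmem p)
  · exact Or.inl fun p => hb (hmem p)

/-- The complex of cochains that vanish on small simplices is acyclic. -/
theorem VanishesOnSmall.exists_coboundary_eq {U V : Set X} (hU : IsOpen U) (hV : IsOpen V)
    (hUV : U ∪ V = univ) {m : ℕ} {c : SingularCochain (m + 1) X} (hc : VanishesOnSmall U V c)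
    (hδ : coboundary (m + 1) X c = 0) :
    ∃ b : SingularCochain m X, VanishesOnSmall U V b ∧ coboundary m X b = c := by
  have hs : ∀ N : ℕ, VanishesOnSmall U V (_root_.singularSubdivision^[N] c) := by
    intro N
    induction N with
    | zero => exact hc
    | succ N ih =>
      rw [Function.iterate_succ_apply']
      exact ih.singularSubdivision
  have hstep : ∀ c' : SingularCochain (m + 1) X, coboundary (m + 1) X c' = 0 →
      _root_.singularSubdivision c' = c' - coboundary m X (_root_.singularHomotopy c') := by
    intro c' h
    rw [singularSubdivision_eq, h]
    have : _root_.singularHomotopy (0 : SingularCochain (m + 2) X) = 0 := by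
      funext σ
      have h0 : SingularCochain.onTuples (0 : SingularCochain (m + 2) X) σ = 0 := rfl
      rw [_root_.singularHomotopy, h0, tupleHomotopy_zero]
      rfl
    rw [this, sub_zero]
  have hcoc : ∀ N : ℕ, coboundary (m + 1) X (_root_.singularSubdivision^[N] c) = 0 := by
    intro N
    induction N with
    | zero => exact hδ
    | succ N ih =>
      rw [Function.iterate_succ_apply', hstep _ ih, map_sub, ih, coboundary_coboundary, sub_zero]
  -- Telescoping: for a cocycle each summand has coboundary `S^i c - S^(i+1) c`.
  set B : ℕ → SingularCochain m X := fun N =>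
    ∑ i ∈ Finset.range N, _root_.singularHomotopy (_root_.singularSubdivision^[i] c) with hB
  have hBc : ∀ N, coboundary m X (B N) = c - _root_.singularSubdivision^[N] c := by
    intro N
    induction N with
    | zero => simp [hB]
    | succ N ih =>
      rw [hB] at ih ⊢
      simp only [] at ih ⊢
      rw [Finset.sum_range_succ, map_add, ih, Function.iterate_succ_apply', hstep _ (hcoc N)]
      abel
  have hBsmall : ∀ N, VanishesOnSmall U V (B N) := by
    intro N σ hσ
    rw [hB]
    simp only [Finset.sum_apply]
    exact Finset.sum_eq_zero fun i _ => (hs i).singularHomotopy σ hσ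
  -- No single `N` works for all simplices, so the primitive is the pointwise limit of `B N`, which
  -- stabilizes at each simplex.
  have hlim : ∀ σ, ∃ z : ℤ, ∀ᶠ N in Filter.atTop, B N σ = z := by
    intro σ
    obtain ⟨N₀, hN₀⟩ :=
      Filter.eventually_atTop.1 (hc.eventually_iterate_eq_zero hU hV hUV σ)
    refine ⟨B N₀ σ, Filter.eventually_atTop.2 ⟨N₀, fun N hN => ?_⟩⟩
    induction N, hN using Nat.le_induction with
    | base => rfl
    | succ N hN ih =>
      rw [← ih, hB]
      simp only [Finset.sum_apply]
      rw [Finset.sum_range_succ, _root_.singularHomotopy,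
        onTuples_iterate_singularSubdivision, hN₀ N hN, tupleHomotopy_zero, Pi.zero_apply,
        add_zero]
  choose b hb using hlim
  refine ⟨b, fun σ hσ => ?_, ?_⟩
  · obtain ⟨N, hN⟩ := (hb σ).exists
    rw [← hN, hBsmall N σ hσ]
  · funext σ
    have h1 : ∀ᶠ N in Filter.atTop, ∀ i, B N (σ.face i) = b (σ.face i) :=
      Filter.eventually_all.2 fun i => hb _
    have h2 : ∀ᶠ N in Filter.atTop, _root_.singularSubdivision^[N] c σ = 0 := by
      filter_upwards [hc.eventually_iterate_eq_zero hU hV hUV σ] with N hN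
      rw [← onTuples_vertexTuple (_root_.singularSubdivision^[N] c) σ,
        onTuples_iterate_singularSubdivision, hN, Pi.zero_apply]
    -- One `N` serves `σ` and its finitely many faces, which is all that the coboundary at `σ` sees.
    obtain ⟨N, hN1, hN2⟩ := (h1.and h2).exists
    have h3 : coboundary m X b σ = coboundary m X (B N) σ := by
      simp only [coboundary_apply, hN1]
    rw [h3, hBc, Pi.sub_apply, hN2, sub_zero]

end Singular

/-! ### Excision for open embeddings -/

section Excision

variable {X : Type*} [TopologicalSpace X] {W : Type*} [TopologicalSpace W]

open Classical in
/-- Extension of cochains by zero along an embedding. -/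
def extendCochain {m : ℕ} (j : C(W, X)) (c : SingularCochain m W) : SingularCochain m X :=
  fun σ => if h : ∃ τ : SingularSimplex m W, j.comp τ = σ then c h.choose else 0

theorem extendCochain_comp {m : ℕ} (j : C(W, X)) (hj : Function.Injective j)
    (c : SingularCochain m W) (τ : SingularSimplex m W) :
    extendCochain j c (j.comp τ) = c τ := by
  have h : ∃ τ' : SingularSimplex m W, j.comp τ' = j.comp τ := ⟨τ, rfl⟩
  rw [extendCochain, dif_pos h]
  congr 1
  ext p
  exact hj (DFunLike.congr_fun h.choose_spec p)

theorem pullback_extendCochain {m : ℕ} (j : C(W, X)) (hj : Function.Injective j)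
    (c : SingularCochain m W) : SingularCochain.pullback j m (extendCochain j c) = c :=
  funext fun τ => extendCochain_comp j hj c τ

theorem exists_comp_eq {m : ℕ} {j : C(W, X)} (hj : IsEmbedding j) {σ : SingularSimplex m X}
    (hσ : ∀ p, σ p ∈ range j) : ∃ τ : SingularSimplex m W, j.comp τ = σ := by
  choose τ hτ using hσ
  refine ⟨⟨τ, hj.continuous_iff.2 ?_⟩, ContinuousMap.ext hτ⟩
  have : j ∘ τ = σ := funext hτ
  rw [this]
  exact σ.continuous

theorem extendCochain_mem_relCochain {m : ℕ} {j : C(W, X)} (hj : Function.Injective j)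
    {A : Set X} {c : SingularCochain m W} (hc : c ∈ relCochain m (j ⁻¹' A)) :
    extendCochain j c ∈ relCochain m A := by
  intro σ hσ
  by_cases h : ∃ τ : SingularSimplex m W, j.comp τ = σ
  · obtain ⟨τ, rfl⟩ := h
    rw [extendCochain_comp j hj]
    exact hc τ hσ
  · rw [extendCochain, dif_neg h]

theorem coboundary_mem_relCochain {m : ℕ} {A : Set X} {c : SingularCochain m X}
    (hc : c ∈ relCochain m A) : coboundary m X c ∈ relCochain (m + 1) A := by
  intro σ hσ
  rw [coboundary_apply]
  refine Finset.sum_eq_zero fun i _ => ?_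
  rw [hc (σ.face i) fun p => hσ _, mul_zero]

theorem VanishesOnSmall.mem_relCochain {U V : Set X} {m : ℕ} {c : SingularCochain m X}
    (hc : VanishesOnSmall U V c) : c ∈ relCochain m V :=
  fun σ hσ => hc σ (Or.inr hσ)

theorem vanishesOnSmall_range {m : ℕ} {j : C(W, X)} (hj : IsEmbedding j) {V : Set X}
    {c : SingularCochain m X} (h : SingularCochain.pullback j m c = 0)
    (h' : c ∈ relCochain m V) : VanishesOnSmall (range j) V c := by
  rintro σ (hσ | hσ)
  · obtain ⟨τ, rfl⟩ := exists_comp_eq hj hσ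
    exact congrFun h τ
  · exact h' σ hσ

theorem VanishesOnSmall.pullback_eq_zero {m : ℕ} {j : C(W, X)} {V : Set X}
    {c : SingularCochain m X} (h : VanishesOnSmall (range j) V c) :
    SingularCochain.pullback j m c = 0 :=
  funext fun _ => h _ (Or.inl fun _ => mem_range_self _)

/-- Excision: if `j` is an open embedding and the open set `V` covers the complement of its
range, then `Hᵐ⁺¹(X, V) → Hᵐ⁺¹(W, j⁻¹ V)` is an isomorphism. -/
theorem bijective_pullback_of_isOpenEmbedding (m : ℕ) {j : C(W, X)} (hj : IsOpenEmbedding j)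
    {V : Set X} (hV : IsOpen V) (hcov : range j ∪ V = univ) {A : Set W} (hA : A = j ⁻¹' V)
    (h : MapsTo j A V) :
    Function.Bijective (RelCohomology.pullback (m + 1) j h) := by
  subst hA
  constructor
  · rw [injective_iff_map_eq_zero]
    intro x hx
    obtain ⟨⟨c, hcV, hcδ⟩, rfl⟩ := QuotientAddGroup.mk_surjective x
    have hcδ' : coboundary (m + 1) X c = 0 := hcδ
    have hx' := (QuotientAddGroup.eq_zero_iff _).1 hx
    obtain ⟨b, hb, hbc⟩ : SingularCochain.pullback j (m + 1) c ∈
      (relCochain m (j ⁻¹' V)).map (coboundary m W) := hx'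
    set b' := extendCochain j b
    have hb' : b' ∈ relCochain m V := extendCochain_mem_relCochain hj.injective hb
    -- After subtracting the coboundary of the extended primitive, the cocycle vanishes on simplices
    -- in the range of `j` as well as on those in `V`, so acyclicity applies.
    have hd : VanishesOnSmall (range j) V (c - coboundary m X b') := by
      refine vanishesOnSmall_range hj.isEmbedding ?_
        (sub_mem hcV (coboundary_mem_relCochain hb'))
      rw [map_sub, pullback_coboundary, pullback_extendCochain j hj.injective, hbc, sub_self]
    obtain ⟨a, ha, hac⟩ := hd.exists_coboundary_eq hj.isOpen_range hV hcov
      (by rw [map_sub, hcδ', coboundary_coboundary, sub_zero])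
    refine (QuotientAddGroup.eq_zero_iff _).2 ?_
    exact ⟨b' + a, add_mem hb' ha.mem_relCochain, by rw [map_add, hac]; simp⟩
  · intro y
    obtain ⟨⟨c, hcV, hcδ⟩, rfl⟩ := QuotientAddGroup.mk_surjective y
    have hcδ' : coboundary (m + 1) W c = 0 := hcδ
    set c' := extendCochain j c
    have hc' : c' ∈ relCochain (m + 1) V := extendCochain_mem_relCochain hj.injective hcV
    -- Extension by zero fails to be closed only on large simplices. Correcting it by `a` repairs
    -- this without changing its restriction along `j`.
    have hd : VanishesOnSmall (range j) V (coboundary (m + 1) X c') := by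
      refine vanishesOnSmall_range hj.isEmbedding ?_ (coboundary_mem_relCochain hc')
      rw [pullback_coboundary, pullback_extendCochain j hj.injective, hcδ']
    obtain ⟨a, ha, hac⟩ := hd.exists_coboundary_eq hj.isOpen_range hV hcov
      (coboundary_coboundary c')
    have hmem : c' - a ∈ relCocycle (m + 1) V :=
      AddSubgroup.mem_inf.2 ⟨sub_mem hc' ha.mem_relCochain, by
        rw [AddMonoidHom.mem_ker, map_sub, hac, sub_self]⟩
    refine ⟨QuotientAddGroup.mk ⟨c' - a, hmem⟩, ?_⟩
    refine congrArg QuotientAddGroup.mk (Subtype.ext ?_)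
    change SingularCochain.pullback j (m + 1) (c' - a) = c
    rw [map_sub, pullback_extendCochain j hj.injective, ha.pullback_eq_zero, sub_zero]

theorem RelCohomology.pullback_comp (n : ℕ) {Y : Type*} [TopologicalSpace Y] (f : C(W, X))
    (g : C(X, Y)) {A : Set W} {A' : Set X} {A'' : Set Y} (hf : MapsTo f A A')
    (hg : MapsTo g A' A'') (hgf : MapsTo (g.comp f) A A'') (x : RelCohomology n Y A'') :
    RelCohomology.pullback n f hf (RelCohomology.pullback n g hg x) =
      RelCohomology.pullback n (g.comp f) hgf x := by
  obtain ⟨c, rfl⟩ := QuotientAddGroup.mk_surjective x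
  rfl

end Excision

/-! ### Existence of Riemannian metrics -/

section Metric

variable (n : ℕ) {B : Type u} [TopologicalSpace B]
  [ChartedSpace (EuclideanSpace ℝ (Fin n)) B] [IsManifold (𝓡 n) ∞ B]

local notation "𝔼" n => EuclideanSpace ℝ (Fin n)

/-- The pull-back of the standard scalar product by the trivialization of `TB` at `x₀`. -/
def localMetric (x₀ y : B) :
    TangentSpace (𝓡 n) y →L[ℝ] TangentSpace (𝓡 n) y →L[ℝ] ℝ :=
  (ContinuousLinearMap.precomp ℝ
      ((trivializationAt (𝔼 n) (TangentSpace (𝓡 n)) x₀).continuousLinearMapAt ℝ y)).comp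
    ((innerSL ℝ).comp ((trivializationAt (𝔼 n) (TangentSpace (𝓡 n)) x₀).continuousLinearMapAt ℝ y))

theorem localMetric_apply (x₀ y : B) (v w : TangentSpace (𝓡 n) y) :
    localMetric n x₀ y v w = inner ℝ
      ((trivializationAt (𝔼 n) (TangentSpace (𝓡 n)) x₀).continuousLinearMapAt ℝ y v)
      ((trivializationAt (𝔼 n) (TangentSpace (𝓡 n)) x₀).continuousLinearMapAt ℝ y w) := rfl

theorem localMetric_comm (x₀ y : B) (v w : TangentSpace (𝓡 n) y) :
    localMetric n x₀ y v w = localMetric n x₀ y w v := by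
  rw [localMetric_apply, localMetric_apply]
  exact real_inner_comm _ _

theorem localMetric_pos (x₀ : B) {y : B}
    (hy : y ∈ (trivializationAt (𝔼 n) (TangentSpace (𝓡 n)) x₀).baseSet)
    (v : TangentSpace (𝓡 n) y) (hv : v ≠ 0) : 0 < localMetric n x₀ y v v := by
  rw [localMetric_apply]
  refine real_inner_self_pos.2 fun h => hv ?_
  rw [← Bundle.Trivialization.symmL_continuousLinearMapAt (R := ℝ) _ hy v, h, map_zero]

set_option synthInstance.maxHeartbeats 400000 in
theorem contMDiffOn_localMetric (x₀ : B) :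
    ContMDiffOn (𝓡 n) ((𝓡 n).prod 𝓘(ℝ, (𝔼 n) →L[ℝ] (𝔼 n) →L[ℝ] ℝ)) ∞
      (fun y => Bundle.TotalSpace.mk' ((𝔼 n) →L[ℝ] (𝔼 n) →L[ℝ] ℝ)
        (E := fun b : B => TangentSpace (𝓡 n) b →L[ℝ] TangentSpace (𝓡 n) b →L[ℝ] ℝ) y
        (localMetric n x₀ y))
      (trivializationAt (𝔼 n) (TangentSpace (𝓡 n)) x₀).baseSet := by
  set e := trivializationAt ((𝔼 n) →L[ℝ] (𝔼 n) →L[ℝ] ℝ)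
    (fun b : B => TangentSpace (𝓡 n) b →L[ℝ] TangentSpace (𝓡 n) b →L[ℝ] ℝ) x₀ with he
  have hbase : (trivializationAt (𝔼 n) (TangentSpace (𝓡 n)) x₀).baseSet ⊆ e.baseSet := by
    intro y hy
    rw [he, hom_trivializationAt_baseSet, hom_trivializationAt_baseSet]
    exact ⟨hy, hy, mem_univ _⟩
  rw [Bundle.Trivialization.contMDiffOn_section_iff e (Bundle.Trivialization.open_baseSet _) hbase]
  let β : (𝔼 n) →L[ℝ] (𝔼 n) →L[ℝ] ℝ := innerSL ℝ
  refine (contMDiffOn_const (c := β)).congr fun y hy => ?_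
  rw [he, hom_trivializationAt_apply]
  ext v w
  have := inCoordinates_apply_eq₂ (𝕜 := ℝ) (F₁ := 𝔼 n) (F₂ := 𝔼 n) (F₃ := ℝ)
    (E₁ := fun b : B => TangentSpace (𝓡 n) b) (E₂ := fun b : B => TangentSpace (𝓡 n) b)
    (E₃ := Bundle.Trivial B ℝ) (x₀ := x₀) (x := y) (ϕ := localMetric n x₀ y) (v := v) (w := w)
    hy hy (mem_univ _)
  refine this.trans ?_
  change (Bundle.Trivialization.linearMapAt ℝ (Bundle.Trivial.trivialization B ℝ) y) _ = _
  rw [Bundle.Trivial.linearMapAt_trivialization]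
  refine (localMetric_apply n x₀ y _ _).trans ?_
  have h : ∀ u : 𝔼 n, (trivializationAt (𝔼 n) (TangentSpace (𝓡 n)) x₀).continuousLinearMapAt ℝ y
      ((trivializationAt (𝔼 n) (TangentSpace (𝓡 n)) x₀).symm y u) = u := fun u => by
    rw [← Bundle.Trivialization.symmL_apply (R := ℝ) _ hy]
    exact Bundle.Trivialization.continuousLinearMapAt_symmL _ hy u
  exact congrArg₂ (fun a b : 𝔼 n => inner ℝ a b) (h v) (h w)

/-- If `m > 0` is the minimum of the form on the unit sphere, then `m * ‖v‖ ^ 2 ≤ b v v`. The empty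
sphere occurs only in dimension zero. -/
theorem isVonNBounded_of_pos (b : (𝔼 n) →L[ℝ] (𝔼 n) →L[ℝ] ℝ) (hb : ∀ v, v ≠ 0 → 0 < b v v) :
    Bornology.IsVonNBounded ℝ {v : 𝔼 n | b v v < 1} := by
  rw [NormedSpace.isVonNBounded_iff]
  rcases (Metric.sphere (0 : 𝔼 n) 1).eq_empty_or_nonempty with hs | hs
  · refine Bornology.isBounded_singleton (x := (0 : 𝔼 n)) |>.subset fun v _ => ?_
    by_contra hv
    have : ‖v‖⁻¹ • v ∈ Metric.sphere (0 : 𝔼 n) 1 := by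
      simp [norm_smul, norm_ne_zero_iff.2 hv]
    rw [hs] at this
    exact this
  have hcont : Continuous fun v : 𝔼 n => b v v := by fun_prop
  obtain ⟨w, hw, hmin⟩ := (isCompact_sphere (0 : 𝔼 n) 1).exists_isMinOn hs hcont.continuousOn
  have hw0 : w ≠ 0 := by
    rintro rfl
    simp at hw
  have hm := hb w hw0
  refine (Metric.isBounded_closedBall (x := (0 : 𝔼 n)) (r := 1 + (b w w)⁻¹)).subset fun v hv => ?_
  rw [mem_closedBall_zero_iff]
  rcases eq_or_ne v 0 with rfl | hv0
  · simp only [norm_zero]; positivity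
  have hvn : 0 < ‖v‖ := norm_pos_iff.2 hv0
  have h1 : b w w ≤ b (‖v‖⁻¹ • v) (‖v‖⁻¹ • v) :=
    hmin (show ‖v‖⁻¹ • v ∈ Metric.sphere (0 : 𝔼 n) 1 by simp [norm_smul, hvn.ne'])
  have h2 : b (‖v‖⁻¹ • v) (‖v‖⁻¹ • v) = (‖v‖⁻¹) ^ 2 * b v v := by
    simp only [map_smul, smul_apply, smul_eq_mul]
    ring
  have h3 : b w w * ‖v‖ ^ 2 < 1 := by
    rw [h2] at h1
    calc b w w * ‖v‖ ^ 2 ≤ ((‖v‖⁻¹) ^ 2 * b v v) * ‖v‖ ^ 2 := by gcongr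
      _ = b v v := by field_simp
      _ < 1 := hv
  have h4 : ‖v‖ ^ 2 < (b w w)⁻¹ := by
    rw [lt_inv_comm₀ (by positivity) hm, inv_eq_one_div, lt_div_iff₀ (by positivity)]
    exact h3
  nlinarith [inv_pos.2 hm]

set_option synthInstance.maxHeartbeats 400000 in
/-- Every smooth manifold carries a smooth Riemannian metric. -/
theorem nonempty_smoothMetric (B : Type u) [TopologicalSpace B] [T2Space B]
    [SecondCountableTopology B] [ChartedSpace (𝔼 n) B] [IsManifold (𝓡 n) ∞ B] :
    Nonempty (SmoothMetric n B) := by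
  have : LocallyCompactSpace B := ChartedSpace.locallyCompactSpace (𝔼 n) B
  -- Symmetric positive definite forms are a convex set, so a partition of unity glues the local
  -- metrics.
  obtain ⟨s, hs⟩ := exists_contMDiffSection_forall_mem_convex_of_local (𝓡 n) (n := ⊤)
    (F_fiber := (𝔼 n) →L[ℝ] (𝔼 n) →L[ℝ] ℝ)
    (fun b : B => TangentSpace (𝓡 n) b →L[ℝ] TangentSpace (𝓡 n) b →L[ℝ] ℝ)
    (fun b => {φ | (∀ v w, φ v w = φ w v) ∧ ∀ v, v ≠ 0 → 0 < φ v v})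
    (by
      rintro b φ ⟨h1, h2⟩ ψ ⟨h3, h4⟩ s t hs ht hst
      refine ⟨fun v w => ?_, fun v hv => ?_⟩
      · change s * φ v w + t * ψ v w = s * φ w v + t * ψ w v
        rw [h1 v w, h3 v w]
      · change 0 < s * φ v v + t * ψ v v
        have := h2 v hv
        have := h4 v hv
        rcases hs.eq_or_lt with rfl | hs
        · obtain rfl : t = 1 := by linarith
          linarith
        · positivity)
    (fun x₀ => ⟨_, (Bundle.Trivialization.open_baseSet _).mem_nhds
      (FiberBundle.mem_baseSet_trivializationAt (𝔼 n) (TangentSpace (𝓡 n)) x₀),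
      localMetric n x₀, contMDiffOn_localMetric n x₀, fun y hy => ⟨localMetric_comm n x₀ y,
        localMetric_pos n x₀ hy⟩⟩)
  exact ⟨{
    inner := s
    symm := fun b => (hs b).1
    pos := fun b => (hs b).2
    isVonNBounded := fun b => isVonNBounded_of_pos n (s b) (hs b).2
    contMDiff := s.contMDiff }⟩

end Metric

/-! ### The inverse function theorem on manifolds -/

section InverseFunction

variable {E : Type*} [NormedAddCommGroup E] [NormedSpace ℝ E]
  {E' : Type*} [NormedAddCommGroup E'] [NormedSpace ℝ E']
  {H : Type*} [TopologicalSpace H] (I : ModelWithCorners ℝ E H) [I.Boundaryless]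
  {H' : Type*} [TopologicalSpace H'] (J : ModelWithCorners ℝ E' H') [J.Boundaryless]
  {M : Type*} [TopologicalSpace M] [ChartedSpace H M] [IsManifold I ∞ M]
  {N : Type*} [TopologicalSpace N] [ChartedSpace H' N] [IsManifold J ∞ N]

/-- The preferred chart at a point of a manifold without boundary, as a diffeomorphism onto an
open subset of the model vector space. -/
def extChartPartialDiffeomorph (x : M) : PartialDiffeomorph I 𝓘(ℝ, E) M E ∞ where
  toPartialEquiv := extChartAt I x
  open_source := isOpen_extChartAt_source x
  open_target := isOpen_extChartAt_target x
  contMDiffOn_toFun := by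
    rw [extChartAt_source]
    exact contMDiffOn_extChartAt
  contMDiffOn_invFun := contMDiffOn_extChartAt_symm x

variable {I J}

/-- Smoothness of the inverse at a point requires an invertible derivative at its preimage. Hence
the inverse function theorem at `a` is followed by a restriction to the open set `V'` where the
derivative is invertible. -/
theorem isLocalDiffeomorphAt_of_hasFDerivAt_equiv [CompleteSpace E] {f : E → E'} {V : Set E}
    (hV : IsOpen V) (hf : ContDiffOn ℝ ∞ f V) {a : E} (ha : a ∈ V) (f' : E ≃L[ℝ] E')
    (hf' : HasFDerivAt f (f' : E →L[ℝ] E') a) :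
    IsLocalDiffeomorphAt 𝓘(ℝ, E) 𝓘(ℝ, E') ∞ f a := by
  have hat : ∀ y ∈ V, ContDiffAt ℝ ∞ f y := fun y hy => (hf y hy).contDiffAt (hV.mem_nhds hy)
  set Φ := (hat a ha).toOpenPartialHomeomorph f hf' (by simp) with hΦ
  have hcoe : (Φ : E → E') = f := (hat a ha).toOpenPartialHomeomorph_coe hf' (by simp)
  have haΦ : a ∈ Φ.source := (hat a ha).mem_toOpenPartialHomeomorph_source hf' (by simp)
  have hcont : ContinuousOn (fderiv ℝ f) V := hf.continuousOn_fderiv_of_isOpen hV (by simp)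
  have hopen : IsOpen (V ∩ fderiv ℝ f ⁻¹' range ((↑) : (E ≃L[ℝ] E') → E →L[ℝ] E')) :=
    hcont.isOpen_inter_preimage hV (ContinuousLinearEquiv.isOpen)
  set V' := V ∩ fderiv ℝ f ⁻¹' range ((↑) : (E ≃L[ℝ] E') → E →L[ℝ] E')
  set Ψ := Φ.restrOpen V' hopen
  refine ⟨⟨Ψ.toPartialEquiv, Ψ.open_source, Ψ.open_target, ?_, ?_⟩, ?_, ?_⟩
  · rw [contMDiffOn_iff_contDiffOn]
    intro y hy
    change ContDiffWithinAt ℝ ∞ Φ _ y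
    rw [hcoe]
    exact (hat y hy.2.1).contDiffWithinAt
  · rw [contMDiffOn_iff_contDiffOn]
    intro z hz
    obtain ⟨hzt, hzV⟩ : z ∈ Φ.target ∧ Φ.symm z ∈ V' := hz
    obtain ⟨e, he⟩ := hzV.2
    refine (Φ.contDiffAt_symm (f₀' := e) hzt ?_ ?_).contDiffWithinAt
    · rw [hcoe, he]
      exact ((hat _ hzV.1).differentiableAt (by simp)).hasFDerivAt
    · rw [hcoe]
      exact hat _ hzV.1
  · exact ⟨haΦ, ha, f', hf'.fderiv.symm⟩
  · intro y _
    exact (congrFun hcoe y).symm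

/-- A smooth map whose differential at `x` is injective is a local diffeomorphism at `x` if the
dimensions agree. -/
theorem isLocalDiffeomorphAt_of_injective_mfderiv [FiniteDimensional ℝ E]
    [FiniteDimensional ℝ E'] (hdim : Module.finrank ℝ E = Module.finrank ℝ E')
    {f : M → N} {U : Set M} (hU : IsOpen U) (hf : ContMDiffOn I J ∞ f U) {x : M} (hx : x ∈ U)
    (hinj : Function.Injective (mfderiv I J f x)) :
    IsLocalDiffeomorphAt I J ∞ f x := by
  have : CompleteSpace E := FiniteDimensional.complete ℝ E
  set e := extChartAt I x
  set e' := extChartAt J (f x)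
  -- On `U'` both charts cancel, so `f` agrees there with the composite of charts and coordinate
  -- expression.
  set U' := U ∩ e.source ∩ (U ∩ f ⁻¹' e'.source) with hU'
  have hU'o : IsOpen U' := (hU.inter (isOpen_extChartAt_source x)).inter
    (hf.continuousOn.isOpen_inter_preimage hU (isOpen_extChartAt_source (f x)))
  set F : E → E' := e' ∘ f ∘ e.symm with hF
  set V := e.target ∩ e.symm ⁻¹' U' with hV
  have hVo : IsOpen V := (continuousOn_extChartAt_symm x).isOpen_inter_preimage
    (isOpen_extChartAt_target x) hU'o
  have hFV : ContDiffOn ℝ ∞ F V := by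
    rw [← contMDiffOn_iff_contDiffOn]
    refine (contMDiffOn_extChartAt (I := J) (x := f x)).comp
      (hf.comp ((contMDiffOn_extChartAt_symm (I := I) x).mono inter_subset_left) ?_) ?_
    · exact fun y hy => hy.2.1.1
    · intro y hy
      rw [← extChartAt_source J]
      exact hy.2.2.2
  have hxs : x ∈ e.source := mem_extChartAt_source x
  have hxU' : x ∈ U' := ⟨⟨hx, hxs⟩, hx, mem_extChartAt_source (f x)⟩
  have hxV : e x ∈ V := ⟨e.map_source hxs, by
    change e.symm (e x) ∈ U'
    rwa [e.left_inv hxs]⟩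
  have hmd : MDifferentiableAt I J f x :=
    ((hf x hx).contMDiffAt (hU.mem_nhds hx)).mdifferentiableAt (by simp)
  have hder : fderiv ℝ F (e x) = mfderiv I J f x := by
    rw [hmd.mfderiv, I.range_eq_univ, fderivWithin_univ]
    rfl
  set L : E →L[ℝ] E' := fderiv ℝ F (e x) with hL
  have hLinj : Function.Injective L := by rw [hder]; exact hinj
  have hF' : HasFDerivAt F L (e x) :=
    (((hFV _ hxV).contDiffAt (hVo.mem_nhds hxV)).differentiableAt (by simp)).hasFDerivAt
  set L' : E ≃L[ℝ] E' :=
    (LinearEquiv.ofInjectiveOfFinrankEq (L : E →ₗ[ℝ] E') hLinj hdim).toContinuousLinearEquiv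
  have hLL : (L' : E →L[ℝ] E') = L := by
    ext v
    rfl
  have h1 : IsLocalDiffeomorphAt I 𝓘(ℝ, E) ∞ e x :=
    ⟨extChartPartialDiffeomorph I x, hxs, fun _ _ => rfl⟩
  have h2 : IsLocalDiffeomorphAt 𝓘(ℝ, E) 𝓘(ℝ, E') ∞ F (e x) :=
    isLocalDiffeomorphAt_of_hasFDerivAt_equiv hVo hFV hxV L' (hLL ▸ hF')
  have h3 : IsLocalDiffeomorphAt 𝓘(ℝ, E') J ∞ e'.symm (F (e x)) := by
    refine ⟨(extChartPartialDiffeomorph J (f x)).symm, ?_, fun _ _ => rfl⟩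
    change e' (f (e.symm (e x))) ∈ e'.target
    rw [e.left_inv hxs]
    exact e'.map_source (mem_extChartAt_source (f x))
  obtain ⟨Φ, hΦx, hΦ⟩ :=
    (h1.comp 𝓘(ℝ, E') E' h2).comp J N h3
  refine ⟨⟨(Φ.toOpenPartialHomeomorph.restrOpen U' hU'o).toPartialEquiv,
    (Φ.toOpenPartialHomeomorph.restrOpen U' hU'o).open_source,
    (Φ.toOpenPartialHomeomorph.restrOpen U' hU'o).open_target,
    Φ.contMDiffOn_toFun.mono fun y hy => hy.1, Φ.contMDiffOn_invFun.mono fun y hy => hy.1⟩,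
    ⟨hΦx, hxU'⟩, fun y hy => ?_⟩
  have := hΦ hy.1
  refine Eq.trans ?_ this
  change f y = e'.symm (e' (f (e.symm (e y))))
  have hy' : y ∈ U' := hy.2
  rw [e.left_inv hy'.1.2, e'.left_inv hy'.2.2]

end InverseFunction

/-! ### A local substitute for the Riemannian logarithm -/

section Log

variable {n : ℕ} {B : Type u} [TopologicalSpace B]
  [ChartedSpace (EuclideanSpace ℝ (Fin n)) B] [IsManifold (𝓡 n) ∞ B]

local notation "𝔼" n => EuclideanSpace ℝ (Fin n)

theorem contMDiffAt_totalSpace_sum {EM : Type*} [NormedAddCommGroup EM] [NormedSpace ℝ EM]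
    {HM : Type*} [TopologicalSpace HM] {IM : ModelWithCorners ℝ EM HM} {M : Type*}
    [TopologicalSpace M] [ChartedSpace HM M] {ι : Type*} (s : Finset ι) {b : M → B}
    {v : ι → ∀ m, TangentSpace (𝓡 n) (b m)} {m₀ : M} (hb : ContMDiffAt IM (𝓡 n) ∞ b m₀)
    (hv : ∀ i ∈ s, ContMDiffAt IM (𝓡 n).tangent ∞
      (fun m => (⟨b m, v i m⟩ : TangentBundle (𝓡 n) B)) m₀) :
    ContMDiffAt IM (𝓡 n).tangent ∞
      (fun m => (⟨b m, ∑ i ∈ s, v i m⟩ : TangentBundle (𝓡 n) B)) m₀ := by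
  rw [Bundle.contMDiffAt_totalSpace]
  refine ⟨hb, ?_⟩
  have hv' : ∀ i ∈ s, ContMDiffAt IM 𝓘(ℝ, 𝔼 n) ∞ (fun m =>
      (trivializationAt (𝔼 n) (TangentSpace (𝓡 n)) (b m₀) ⟨b m, v i m⟩).2) m₀ :=
    fun i hi => (Bundle.contMDiffAt_totalSpace.1 (hv i hi)).2
  refine (ContMDiffAt.sum hv').congr_of_eventuallyEq ?_
  have hbase : ∀ᶠ m in 𝓝 m₀, b m ∈
      (trivializationAt (𝔼 n) (TangentSpace (𝓡 n)) (b m₀)).baseSet :=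
    hb.continuousAt.eventually ((Bundle.Trivialization.open_baseSet _).mem_nhds
      (FiberBundle.mem_baseSet_trivializationAt (𝔼 n) (TangentSpace (𝓡 n)) (b m₀)))
  filter_upwards [hbase] with m hm
  have h : ∀ w : TangentSpace (𝓡 n) (b m),
      (trivializationAt (𝔼 n) (TangentSpace (𝓡 n)) (b m₀) ⟨b m, w⟩).2 =
      (trivializationAt (𝔼 n) (TangentSpace (𝓡 n)) (b m₀)).continuousLinearMapAt ℝ (b m) w :=
    fun w => by
      rw [Bundle.Trivialization.continuousLinearMapAt_apply,
        Bundle.Trivialization.coe_linearMapAt_of_mem _ hm]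
  simp only [h, map_sum]

/-- A weighted sum of the coordinate differences `φ_c y - φ_c x`, as a tangent vector at `x`. -/
def bumpLog (t : Finset B) (χ : ∀ c : B, SmoothBumpFunction (𝓡 n) c) (x y : B) :
    TangentSpace (𝓡 n) x :=
  ∑ c ∈ t, χ c x • (trivializationAt (𝔼 n) (TangentSpace (𝓡 n)) c).symmL ℝ x
    (extChartAt (𝓡 n) c y - extChartAt (𝓡 n) c x)

variable (t : Finset B) (χ : ∀ c : B, SmoothBumpFunction (𝓡 n) c)

theorem bumpLog_self (x : B) : bumpLog t χ x x = 0 := by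
  simp [bumpLog]

/-- The map `(x, y) ↦ bumpLog x y ∈ T_x B`. -/
def bumpLogMap (p : B × B) : TangentBundle (𝓡 n) B := ⟨p.1, bumpLog t χ p.1 p.2⟩

/-- An open neighbourhood of the diagonal on which `bumpLogMap` is smooth. -/
def bumpLogDomain : Set (B × B) :=
  {p | ∀ c ∈ t, p.1 ∈ tsupport (χ c) → p.2 ∈ (chartAt (𝔼 n) c).source}

omit [IsManifold (𝓡 n) ∞ B] in
theorem isOpen_bumpLogDomain : IsOpen (bumpLogDomain t χ) := by
  have : bumpLogDomain t χ = ⋂ c ∈ t,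
      ((Prod.fst ⁻¹' (tsupport (χ c))ᶜ) ∪ (Prod.snd ⁻¹' (chartAt (𝔼 n) c).source)) := by
    ext p
    simp [bumpLogDomain, imp_iff_not_or]
  rw [this]
  refine isOpen_biInter_finset fun c _ => ?_
  exact ((isClosed_tsupport _).isOpen_compl.preimage continuous_fst).union
    ((chartAt (𝔼 n) c).open_source.preimage continuous_snd)

omit [IsManifold (𝓡 n) ∞ B] in
theorem diag_mem_bumpLogDomain [T2Space B] (x : B) : (x, x) ∈ bumpLogDomain t χ :=
  fun c _ hx => (χ c).tsupport_subset_chartAt_source hx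

/-- For each `c`, either `p.1` lies in the support of the bump and then both points are in the chart
at `c`, or the term vanishes near `p`. -/
theorem contMDiffOn_bumpLogMap [T2Space B] :
    ContMDiffOn ((𝓡 n).prod (𝓡 n)) (𝓡 n).tangent ∞ (bumpLogMap t χ) (bumpLogDomain t χ) := by
  intro p hp
  refine ContMDiffAt.contMDiffWithinAt ?_
  refine contMDiffAt_totalSpace_sum t (b := Prod.fst)
    (v := fun c q => χ c q.1 • (trivializationAt (𝔼 n) (TangentSpace (𝓡 n)) c).symmL ℝ q.1
      (extChartAt (𝓡 n) c q.2 - extChartAt (𝓡 n) c q.1)) contMDiffAt_fst fun c hc => ?_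
  by_cases hpc : p.1 ∈ tsupport (χ c)
  · have h1 : p.1 ∈ (chartAt (𝔼 n) c).source := (χ c).tsupport_subset_chartAt_source hpc
    have h2 : p.2 ∈ (chartAt (𝔼 n) c).source := hp c hc hpc
    have h3 : ContMDiffAt ((𝓡 n).prod (𝓡 n)) 𝓘(ℝ, 𝔼 n) ∞
        (fun q : B × B => χ c q.1 • (extChartAt (𝓡 n) c q.2 - extChartAt (𝓡 n) c q.1)) p :=
      ((χ c).contMDiffAt.comp p contMDiffAt_fst).smul
        (((contMDiffAt_extChartAt' h2).comp p contMDiffAt_snd).sub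
          ((contMDiffAt_extChartAt' h1).comp p contMDiffAt_fst))
    have h4 := ((trivializationAt (𝔼 n) (TangentSpace (𝓡 n)) c).contMDiffAt_symmL (n := ∞)
      (IB := 𝓡 n) (x := p.1) h1).comp p (contMDiffAt_fst (I := 𝓡 n) (J := 𝓡 n))
    have h5 := ContMDiffAt.clm_bundle_apply (F₁ := 𝔼 n) (E₁ := Bundle.Trivial B (𝔼 n))
      (F₂ := 𝔼 n) (E₂ := fun b : B => TangentSpace (𝓡 n) b) (b := Prod.fst)
      (v := fun q : B × B => χ c q.1 • (extChartAt (𝓡 n) c q.2 - extChartAt (𝓡 n) c q.1))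
      h4 (Bundle.contMDiffAt_totalSpace.2 ⟨contMDiffAt_fst, h3⟩)
    refine h5.congr_of_eventuallyEq (Filter.Eventually.of_forall fun q => ?_)
    simp only [Bundle.TotalSpace.mk', map_smul]
  · have hz : ContMDiffAt ((𝓡 n).prod (𝓡 n)) (𝓡 n).tangent ∞
        (fun q : B × B => (⟨q.1, 0⟩ : TangentBundle (𝓡 n) B)) p :=
      (Bundle.contMDiff_zeroSection ℝ (TangentSpace (𝓡 n))).contMDiffAt.comp p contMDiffAt_fst
    refine hz.congr_of_eventuallyEq ?_
    have : ∀ᶠ q : B × B in 𝓝 p, q.1 ∈ (tsupport (χ c))ᶜ :=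
      continuousAt_fst.eventually ((isClosed_tsupport _).isOpen_compl.mem_nhds hpc)
    filter_upwards [this] with q hq
    rw [image_eq_zero_of_notMem_tsupport hq, zero_smul]

/-- The tangent trivialization at `j` is the differential of the chart at `j`, so its inverse
cancels that differential and each term contributes `χ j c` times the identity, whatever the chart.
-/
theorem hasMFDerivAt_bumpLog (c : B) :
    HasMFDerivAt (M' := 𝔼 n) (𝓡 n) 𝓘(ℝ, 𝔼 n) (fun y => bumpLog t χ c y) c
      ((∑ j ∈ t, χ j c) • ContinuousLinearMap.id ℝ (𝔼 n)) := by
  let S : B → (𝔼 n) →L[ℝ] (𝔼 n) := fun j =>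
    (trivializationAt (𝔼 n) (TangentSpace (𝓡 n)) j).symmL ℝ c
  let G : B → B → 𝔼 n := fun j y =>
    χ j c • S j (extChartAt (𝓡 n) j y - extChartAt (𝓡 n) j c)
  have hterm : ∀ j ∈ t, HasMFDerivAt (𝓡 n) 𝓘(ℝ, 𝔼 n) (G j) c
      (χ j c • ContinuousLinearMap.id ℝ (𝔼 n) : (𝔼 n) →L[ℝ] (𝔼 n)) := by
    intro j hj
    -- The cancellation needs `c` in the chart domain; where the bump vanishes, so does the whole
    -- term.
    by_cases hjc : χ j c = 0
    · have hG : G j = fun _ => (0 : 𝔼 n) := by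
        funext y
        simp only [G, hjc, zero_smul]
      have hz : (χ j c • ContinuousLinearMap.id ℝ (𝔼 n) : (𝔼 n) →L[ℝ] (𝔼 n)) = 0 := by
        ext v : 1
        simp [hjc]
      rw [hG, hz]
      exact hasMFDerivAt_const (I := 𝓡 n) (I' := 𝓘(ℝ, 𝔼 n)) (0 : 𝔼 n) c
    · have hc : c ∈ (chartAt (𝔼 n) j).source := (χ j).support_subset_source hjc
      have h0 : HasMFDerivAt (𝓡 n) 𝓘(ℝ, 𝔼 n) (extChartAt (𝓡 n) j) c
          (mfderiv (𝓡 n) 𝓘(ℝ, 𝔼 n) (extChartAt (𝓡 n) j) c) :=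
        (mdifferentiableAt_extChartAt (I := 𝓡 n) hc).hasMFDerivAt
      let L : (𝔼 n) →L[ℝ] (𝔼 n) := χ j c • S j
      have hL : HasMFDerivAt 𝓘(ℝ, 𝔼 n) 𝓘(ℝ, 𝔼 n)
          (fun v => L (v - extChartAt (𝓡 n) j c)) (extChartAt (𝓡 n) j c) L := by
        refine HasFDerivAt.hasMFDerivAt ?_
        exact L.hasFDerivAt.comp (extChartAt (𝓡 n) j c)
          ((hasFDerivAt_id (extChartAt (𝓡 n) j c)).sub_const (extChartAt (𝓡 n) j c))
      have h2 := hL.comp c h0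
      have key : (χ j c • ContinuousLinearMap.id ℝ (𝔼 n) : (𝔼 n) →L[ℝ] (𝔼 n)) =
          L.comp (mfderiv (𝓡 n) 𝓘(ℝ, 𝔼 n) (extChartAt (𝓡 n) j) c) := by
        refine ContinuousLinearMap.ext fun v => ?_
        have := (trivializationAt (𝔼 n) (TangentSpace (𝓡 n)) j).symmL_continuousLinearMapAt
          (R := ℝ) (b := c) hc v
        rw [TangentBundle.continuousLinearMapAt_trivializationAt hc] at this
        exact congrArg (fun w : 𝔼 n => χ j c • w) this.symm
      rw [key]
      exact h2
  have hsum : ∀ s : Finset B, s ⊆ t → HasMFDerivAt (𝓡 n) 𝓘(ℝ, 𝔼 n) (∑ j ∈ s, G j) c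
      ((∑ j ∈ s, χ j c) • ContinuousLinearMap.id ℝ (𝔼 n) : (𝔼 n) →L[ℝ] (𝔼 n)) := by
    classical
    intro s
    induction s using Finset.induction_on with
    | empty =>
      intro _
      have hz : ((∑ j ∈ (∅ : Finset B), χ j c) • ContinuousLinearMap.id ℝ (𝔼 n) :
          (𝔼 n) →L[ℝ] (𝔼 n)) = 0 := by
        ext v : 1
        simp
      rw [hz, Finset.sum_empty]
      exact hasMFDerivAt_const (I := 𝓡 n) (I' := 𝓘(ℝ, 𝔼 n)) (0 : 𝔼 n) c
    | insert i s hi IH =>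
      intro hs
      have hz : ((∑ j ∈ insert i s, χ j c) • ContinuousLinearMap.id ℝ (𝔼 n) :
          (𝔼 n) →L[ℝ] (𝔼 n)) = χ i c • ContinuousLinearMap.id ℝ (𝔼 n) +
            (∑ j ∈ s, χ j c) • ContinuousLinearMap.id ℝ (𝔼 n) := by
        ext v : 1
        simp [Finset.sum_insert hi, add_smul]
      rw [hz, Finset.sum_insert hi]
      exact (hterm i (hs (Finset.mem_insert_self i s))).add
        (IH ((Finset.subset_insert i s).trans hs))
  have hfun : (∑ j ∈ t, G j) = fun y => (bumpLog t χ c y : 𝔼 n) := by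
    funext y
    rw [Finset.sum_apply]
    rfl
  have := hsum t subset_rfl
  rw [hfun] at this
  exact this

end Log

/-! ### Local diffeomorphisms that are injective on a compact set -/

section Compact

variable {E : Type*} [NormedAddCommGroup E] [NormedSpace ℝ E]
  {E' : Type*} [NormedAddCommGroup E'] [NormedSpace ℝ E']
  {H : Type*} [TopologicalSpace H] {I : ModelWithCorners ℝ E H}
  {H' : Type*} [TopologicalSpace H'] {J : ModelWithCorners ℝ E' H'}
  {M : Type*} [TopologicalSpace M] [ChartedSpace H M]
  {N : Type*} [TopologicalSpace N] [ChartedSpace H' N]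

theorem isOpen_setOf_isLocalDiffeomorphAt {m : WithTop ℕ∞} (f : M → N) :
    IsOpen {x | IsLocalDiffeomorphAt I J m f x} := by
  refine isOpen_iff_mem_nhds.2 fun x hx => ?_
  obtain ⟨Φ, hxΦ, hΦ⟩ := hx
  exact Filter.mem_of_superset (Φ.open_source.mem_nhds hxΦ) fun y hy => ⟨Φ, hy, hΦ⟩

/-- A map that is injective on a compact set `K` and a local diffeomorphism at the points of `K`
restricts to a diffeomorphism from a neighbourhood of `K` onto an open set. -/
theorem exists_partialDiffeomorph_of_injOn [Nonempty M] [T2Space N] {m : WithTop ℕ∞} {f : M → N}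
    {K : Set M} (hK : IsCompact K) (hinj : InjOn f K)
    (hloc : ∀ x ∈ K, IsLocalDiffeomorphAt I J m f x) :
    ∃ Φ : PartialDiffeomorph I J M N m, K ⊆ Φ.source ∧ EqOn f Φ Φ.source := by
  -- Injectivity on the compact set, together with local injectivity at its points, spreads to an
  -- open neighbourhood.
  obtain ⟨t, hto, hKt, hti⟩ := hinj.exists_isOpen_superset hK
    (fun x hx => (hloc x hx).contMDiffAt.continuousAt) (fun x hx => by
      obtain ⟨Φ, hxΦ, hΦ⟩ := hloc x hx
      exact ⟨Φ.source, Φ.open_source.mem_nhds hxΦ, fun a ha b hb hab =>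
        Φ.injOn ha hb (by rw [← hΦ ha, ← hΦ hb]; exact hab)⟩)
  set W := t ∩ {x | IsLocalDiffeomorphAt I J m f x} with hW
  have hWo : IsOpen W := hto.inter (isOpen_setOf_isLocalDiffeomorphAt f)
  have hWi : InjOn f W := hti.mono inter_subset_left
  have himg : ∀ Φ : PartialDiffeomorph I J M N m, EqOn f Φ Φ.source →
      IsOpen (f '' (Φ.source ∩ W)) := by
    intro Φ hΦ
    have h1 : f '' (Φ.source ∩ W) = Φ '' (Φ.source ∩ W) :=
      (hΦ.mono inter_subset_left).image_eq
    rw [h1]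
    exact Φ.toOpenPartialHomeomorph.isOpen_image_of_subset_source (Φ.open_source.inter hWo)
      inter_subset_left
  let e : PartialEquiv M N := (hWi.bijOn_image).toPartialEquiv
  have hsrc : e.source = W := rfl
  have htgt : e.target = f '' W := rfl
  have hcoe : ⇑e = f := rfl
  refine ⟨⟨e, hWo, ?_, ?_, ?_⟩, fun x hx => ⟨hKt hx, hloc x hx⟩, fun x _ => rfl⟩
  · rw [htgt]
    refine isOpen_iff_mem_nhds.2 ?_
    rintro _ ⟨x, hx, rfl⟩
    obtain ⟨Φ, hxΦ, hΦ⟩ := hx.2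
    exact Filter.mem_of_superset ((himg Φ hΦ).mem_nhds ⟨x, ⟨hxΦ, hx⟩, rfl⟩)
      (image_mono inter_subset_right)
  · intro x hx
    exact (IsLocalDiffeomorphAt.contMDiffAt hx.2).contMDiffWithinAt
  · rintro _ ⟨x, hx, rfl⟩
    obtain ⟨Φ, hxΦ, hΦ⟩ := hx.2
    have hfx : f x ∈ Φ.target := by
      rw [hΦ hxΦ]
      exact Φ.map_source hxΦ
    have h1 : ContMDiffAt J I m Φ.symm (f x) :=
      (Φ.contMDiffOn_invFun _ hfx).contMDiffAt (Φ.open_target.mem_nhds hfx)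
    refine (h1.congr_of_eventuallyEq ?_).contMDiffWithinAt
    filter_upwards [(himg Φ hΦ).mem_nhds ⟨x, ⟨hxΦ, hx⟩, rfl⟩]
    rintro _ ⟨z, hz, rfl⟩
    have h2 : e.symm (f z) = z := e.left_inv (x := z) hz.2
    have h3 : Φ.symm (f z) = z := by
      rw [hΦ hz.1]
      exact Φ.left_inv hz.1
    exact h2.trans h3.symm

end Compact

/-! ### The differential of an immersion -/

/-- In immersion charts `f` is the inclusion of a factor. Projecting back gives a differentiable
local left inverse `r`, and the chain rule makes the differential of `r` a left inverse of that of
`f`. -/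
theorem injective_mfderiv_of_isImmersionAt {n k : ℕ}
    {B : Type*} [TopologicalSpace B] [ChartedSpace (EuclideanSpace ℝ (Fin n)) B]
    [IsManifold (𝓡 n) ∞ B]
    {F : Type*} [TopologicalSpace F] [ChartedSpace (EuclideanSpace ℝ (Fin k)) F]
    [IsManifold (𝓡 k) ∞ F] {f : F → B} {p : F} (h : IsImmersionAt (𝓡 k) (𝓡 n) ∞ f p) :
    Function.Injective (mfderiv (𝓡 k) (𝓡 n) f p) := by
  have hf : MDifferentiableAt (𝓡 k) (𝓡 n) f p := h.contMDiffAt.mdifferentiableAt (by simp)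
  set P : EuclideanSpace ℝ (Fin n) → EuclideanSpace ℝ (Fin k) :=
    fun z => (h.equiv.symm z).1 with hP
  set r : B → F := h.domChart.symm ∘ P ∘ h.codChart with hr
  have hrf : ∀ q ∈ h.domChart.source, P (h.codChart (f q)) = h.domChart q := by
    intro q hq
    have hq' : h.domChart q ∈ (h.domChart.extend (𝓡 k)).target := by
      have := (h.domChart.extend (𝓡 k)).map_source (x := q) (by rwa [h.domChart.extend_source])
      exact this
    have h1 := h.writtenInCharts hq'
    simp only [Function.comp_apply, OpenPartialHomeomorph.extend_coe,
      OpenPartialHomeomorph.extend_coe_symm, modelWithCornersSelf_coe,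
      modelWithCornersSelf_coe_symm, id_eq, h.domChart.left_inv hq] at h1
    simp [P, h1]
  have hev : r ∘ f =ᶠ[𝓝 p] id := by
    filter_upwards [h.domChart.open_source.mem_nhds h.mem_domChart_source] with q hq
    simp only [r, Function.comp_apply, hrf q hq, h.domChart.left_inv hq, id]
  have hrd : MDifferentiableAt (𝓡 n) (𝓡 k) r (f p) := by
    have h1 : MDifferentiableAt (𝓡 n) (𝓡 n) h.codChart (f p) :=
      ((contMDiffOn_of_mem_maximalAtlas h.codChart_mem_maximalAtlas _
        h.mem_codChart_source).contMDiffAt (h.codChart.open_source.mem_nhds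
          h.mem_codChart_source)).mdifferentiableAt (by simp)
    have h2 : MDifferentiableAt (𝓡 n) (𝓡 k) P (h.codChart (f p)) := by
      have : ContDiff ℝ ∞ P := contDiff_fst.comp h.equiv.symm.contDiff
      exact (this.contMDiff.mdifferentiable (by simp)) _
    have h3 : MDifferentiableAt (𝓡 k) (𝓡 k) h.domChart.symm (P (h.codChart (f p))) := by
      have hm : P (h.codChart (f p)) ∈ h.domChart.target := by
        rw [hrf p h.mem_domChart_source]
        exact h.domChart.map_source h.mem_domChart_source
      exact ((contMDiffOn_symm_of_mem_maximalAtlas h.domChart_mem_maximalAtlas _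
        hm).contMDiffAt (h.domChart.open_target.mem_nhds hm)).mdifferentiableAt (by simp)
    exact MDifferentiableAt.comp (f p) h3 (MDifferentiableAt.comp (f p) h2 h1)
  have hcomp : (mfderiv (𝓡 n) (𝓡 k) r (f p)).comp (mfderiv (𝓡 k) (𝓡 n) f p) =
      mfderiv (𝓡 k) (𝓡 k) (r ∘ f) p := (mfderiv_comp p hrd hf).symm
  have hid : ∀ v, mfderiv (𝓡 n) (𝓡 k) r (f p) (mfderiv (𝓡 k) (𝓡 n) f p v) = v := by
    intro v
    have h1 : mfderiv (𝓡 k) (𝓡 k) (r ∘ f) p = mfderiv (𝓡 k) (𝓡 k) id p := hev.mfderiv_eq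
    have h2 := congrArg (fun L => L v) (hcomp.trans (h1.trans mfderiv_id))
    exact h2
  exact Function.LeftInverse.injective (g := mfderiv (𝓡 n) (𝓡 k) r (f p)) hid

/-! ### The differential of `bumpLogMap` on the diagonal -/

section LogDiffeo

variable {n : ℕ} {B : Type u} [TopologicalSpace B] [T2Space B]
  [ChartedSpace (EuclideanSpace ℝ (Fin n)) B] [IsManifold (𝓡 n) ∞ B]

local notation "𝔼" n => EuclideanSpace ℝ (Fin n)

omit [T2Space B] [IsManifold (𝓡 n) ∞ B] in
theorem hasMFDerivAt_prodMk_left (b c : B) :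
    HasMFDerivAt (𝓡 n) ((𝓡 n).prod (𝓡 n)) (Prod.mk b) c
      (ContinuousLinearMap.inr ℝ (𝔼 n) (𝔼 n)) :=
  (hasMFDerivAt_const (I := 𝓡 n) (I' := 𝓡 n) b c).prodMk (hasMFDerivAt_id (I := 𝓡 n) c)

omit [T2Space B] in
theorem contMDiffAt_trivializationAt_snd (ξ : TangentBundle (𝓡 n) B) :
    ContMDiffAt (𝓡 n).tangent 𝓘(ℝ, 𝔼 n) ∞
      (fun η : TangentBundle (𝓡 n) B =>
        (trivializationAt (𝔼 n) (TangentSpace (𝓡 n)) ξ.proj η).2) ξ :=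
  ((Bundle.contMDiffAt_totalSpace (n := ∞) (IB := 𝓡 n)
    (f := (id : TangentBundle (𝓡 n) B → TangentBundle (𝓡 n) B))).1 contMDiffAt_id).2

variable (t : Finset B) (χ : ∀ c : B, SmoothBumpFunction (𝓡 n) c)

/-- The differential is block triangular: the base point of the image is the first argument, and
along the second argument the fibre component moves by the nonzero scalar `∑ j ∈ t, χ j c`. -/
theorem isLocalDiffeomorphAt_bumpLogMap {c : B} (hc : ∑ j ∈ t, χ j c ≠ 0) :
    IsLocalDiffeomorphAt ((𝓡 n).prod (𝓡 n)) (𝓡 n).tangent ∞ (bumpLogMap t χ) (c, c) := by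
  have hΘ : ContMDiffAt ((𝓡 n).prod (𝓡 n)) (𝓡 n).tangent ∞ (bumpLogMap t χ) (c, c) :=
    (contMDiffOn_bumpLogMap t χ _ (diag_mem_bumpLogDomain t χ c)).contMDiffAt
      ((isOpen_bumpLogDomain t χ).mem_nhds (diag_mem_bumpLogDomain t χ c))
  have hΘd := hΘ.mdifferentiableAt (by simp)
  refine isLocalDiffeomorphAt_of_injective_mfderiv rfl (isOpen_bumpLogDomain t χ)
    (contMDiffOn_bumpLogMap t χ) (diag_mem_bumpLogDomain t χ c) ?_
  set L := mfderiv ((𝓡 n).prod (𝓡 n)) (𝓡 n).tangent (bumpLogMap t χ) (c, c) with hL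
  refine (injective_iff_map_eq_zero L).2 ?_
  intro w hw
  obtain ⟨a, v⟩ := w
  -- the base component
  have hπ : MDifferentiableAt (𝓡 n).tangent (𝓡 n)
      (Bundle.TotalSpace.proj : TangentBundle (𝓡 n) B → B) (bumpLogMap t χ (c, c)) :=
    ((Bundle.contMDiff_proj (n := ∞) (TangentSpace (𝓡 n) (M := B)) (IB := 𝓡 n)
      (F := 𝔼 n)).mdifferentiable (by simp)) _
  have ha : a = 0 := by
    have h1 : mfderiv ((𝓡 n).prod (𝓡 n)) (𝓡 n)
        ((Bundle.TotalSpace.proj : TangentBundle (𝓡 n) B → B) ∘ bumpLogMap t χ) (c, c) =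
        (mfderiv (𝓡 n).tangent (𝓡 n) Bundle.TotalSpace.proj (bumpLogMap t χ (c, c))).comp L :=
      mfderiv_comp (c, c) hπ hΘd
    have h2 : ((Bundle.TotalSpace.proj : TangentBundle (𝓡 n) B → B) ∘ bumpLogMap t χ) =
        Prod.fst := rfl
    rw [h2, mfderiv_fst] at h1
    have h3 := congrArg (fun T => T (a, v)) h1
    simp only at h3
    change a = (mfderiv (𝓡 n).tangent (𝓡 n) Bundle.TotalSpace.proj
      (bumpLogMap t χ (c, c))) (L (a, v)) at h3
    rw [hw, map_zero] at h3
    exact h3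
  have hv : v = 0 := by
    let e := trivializationAt (𝔼 n) (TangentSpace (𝓡 n)) c
    have hce : c ∈ e.baseSet := FiberBundle.mem_baseSet_trivializationAt (𝔼 n) _ c
    let A : (𝔼 n) →L[ℝ] (𝔼 n) := e.continuousLinearMapAt ℝ c
    have hG : MDifferentiableAt (𝓡 n).tangent 𝓘(ℝ, 𝔼 n) (fun ξ : TangentBundle (𝓡 n) B => (e ξ).2)
        (bumpLogMap t χ (c, c)) :=
      (contMDiffAt_trivializationAt_snd (bumpLogMap t χ (c, c))).mdifferentiableAt (by simp)
    have h0 : HasMFDerivAt (𝓡 n) (𝓡 n).tangent (bumpLogMap t χ ∘ Prod.mk c) c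
        (L.comp (ContinuousLinearMap.inr ℝ (𝔼 n) (𝔼 n))) :=
      HasMFDerivAt.comp c hΘd.hasMFDerivAt (hasMFDerivAt_prodMk_left c c)
    have h1 := HasMFDerivAt.comp c hG.hasMFDerivAt h0
    have h2 : HasMFDerivAt (𝓡 n) 𝓘(ℝ, 𝔼 n) (fun y => A (bumpLog t χ c y)) c
        (A.comp ((∑ j ∈ t, χ j c) • ContinuousLinearMap.id ℝ (𝔼 n))) :=
      HasMFDerivAt.comp (M' := 𝔼 n) (I' := 𝓘(ℝ, 𝔼 n)) c A.hasMFDerivAt (hasMFDerivAt_bumpLog t χ c)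
    have h3 : (fun ξ : TangentBundle (𝓡 n) B => (e ξ).2) ∘ bumpLogMap t χ ∘ Prod.mk c =
        fun y => A (bumpLog t χ c y) := by
      funext y
      change (e ⟨c, bumpLog t χ c y⟩).2 = e.continuousLinearMapAt ℝ c (bumpLog t χ c y)
      rw [Bundle.Trivialization.continuousLinearMapAt_apply,
        Bundle.Trivialization.coe_linearMapAt_of_mem _ hce]
    rw [h3] at h1
    have h4 := congrArg (fun T : (𝔼 n) →L[ℝ] (𝔼 n) => T v) (hasMFDerivAt_unique h2 h1)
    have h5 : A ((∑ j ∈ t, χ j c) • v) =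
        mfderiv (𝓡 n).tangent 𝓘(ℝ, 𝔼 n) (fun ξ : TangentBundle (𝓡 n) B => (e ξ).2)
          (bumpLogMap t χ (c, c)) (L (0, v)) := h4
    have h6 : L (0, v) = 0 := by
      rw [← hw, ha]
    rw [h6, map_zero] at h5
    have h7 : e.symmL ℝ c (A ((∑ j ∈ t, χ j c) • v)) = (∑ j ∈ t, χ j c) • v :=
      e.symmL_continuousLinearMapAt (R := ℝ) hce _
    have h8 : (∑ j ∈ t, χ j c) • v = 0 :=
      h7.symm.trans ((congrArg (e.symmL ℝ c) h5).trans (map_zero (e.symmL ℝ c)))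
    exact (smul_eq_zero.1 h8).resolve_left hc
  rw [ha, hv]
  rfl

end LogDiffeo

/-! ### Smoothness of fibrewise operations on the tangent bundle -/

section Fibrewise

variable {n : ℕ} {B : Type u} [TopologicalSpace B]
  [ChartedSpace (EuclideanSpace ℝ (Fin n)) B] [IsManifold (𝓡 n) ∞ B]

local notation "𝔼" n => EuclideanSpace ℝ (Fin n)

theorem ContMDiffAt.metric_inner {EM : Type*} [NormedAddCommGroup EM] [NormedSpace ℝ EM]
    {HM : Type*} [TopologicalSpace HM] {IM : ModelWithCorners ℝ EM HM} {M : Type*}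
    [TopologicalSpace M] [ChartedSpace HM M] (g : SmoothMetric n B) {b : M → B}
    {v w : ∀ m, TangentSpace (𝓡 n) (b m)} {m₀ : M}
    (hv : ContMDiffAt IM (𝓡 n).tangent ∞
      (fun m => (⟨b m, v m⟩ : TangentBundle (𝓡 n) B)) m₀)
    (hw : ContMDiffAt IM (𝓡 n).tangent ∞
      (fun m => (⟨b m, w m⟩ : TangentBundle (𝓡 n) B)) m₀) :
    ContMDiffAt IM 𝓘(ℝ, ℝ) ∞ (fun m => g.inner (b m) (v m) (w m)) m₀ := by
  have hb : ContMDiffAt IM (𝓡 n) ∞ b m₀ := (Bundle.contMDiffAt_totalSpace.1 hv).1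
  have h := ContMDiffAt.clm_bundle_apply₂ (F₁ := 𝔼 n) (F₂ := 𝔼 n) (F₃ := ℝ)
    (E₃ := Bundle.Trivial B ℝ) ((g.contMDiff.contMDiffAt (x := b m₀)).comp m₀ hb) hv hw
  exact (Bundle.contMDiffAt_totalSpace.1 h).2

theorem contMDiff_fibre_smul :
    ContMDiff (𝓘(ℝ, ℝ).prod (𝓡 n).tangent) (𝓡 n).tangent ∞
      (fun p : ℝ × TangentBundle (𝓡 n) B =>
        (⟨p.2.proj, p.1 • p.2.snd⟩ : TangentBundle (𝓡 n) B)) := by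
  intro p
  have hid : ContMDiffAt (𝓘(ℝ, ℝ).prod (𝓡 n).tangent) (𝓡 n).tangent ∞
      (fun p : ℝ × TangentBundle (𝓡 n) B => (⟨p.2.proj, p.2.snd⟩ : TangentBundle (𝓡 n) B)) p :=
    contMDiffAt_snd
  rw [Bundle.contMDiffAt_totalSpace] at hid ⊢
  refine ⟨hid.1, ?_⟩
  have h1 : ContMDiffAt (𝓘(ℝ, ℝ).prod (𝓡 n).tangent) 𝓘(ℝ, ℝ) ∞
      (fun p : ℝ × TangentBundle (𝓡 n) B => p.1) p := contMDiffAt_fst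
  refine (h1.smul hid.2).congr_of_eventuallyEq ?_
  have hbase : ∀ᶠ q : ℝ × TangentBundle (𝓡 n) B in 𝓝 p, q.2.proj ∈
      (trivializationAt (𝔼 n) (TangentSpace (𝓡 n)) p.2.proj).baseSet :=
    hid.1.continuousAt.eventually ((Bundle.Trivialization.open_baseSet _).mem_nhds
      (FiberBundle.mem_baseSet_trivializationAt (𝔼 n) (TangentSpace (𝓡 n)) p.2.proj))
  filter_upwards [hbase] with q hq
  have h : ∀ w : TangentSpace (𝓡 n) q.2.proj,
      (trivializationAt (𝔼 n) (TangentSpace (𝓡 n)) p.2.proj ⟨q.2.proj, w⟩).2 =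
      (trivializationAt (𝔼 n) (TangentSpace (𝓡 n)) p.2.proj).continuousLinearMapAt ℝ
        q.2.proj w := fun w => by
    rw [Bundle.Trivialization.continuousLinearMapAt_apply,
      Bundle.Trivialization.coe_linearMapAt_of_mem _ hq]
  exact (h _).trans ((map_smul _ q.1 q.2.snd).trans (congrArg (q.1 • ·) (h q.2.snd).symm))

/-- Multiplication by a real number in the fibres of the tangent bundle. -/
def fibreSmul (s : ℝ) (ξ : TangentBundle (𝓡 n) B) : TangentBundle (𝓡 n) B :=
  ⟨ξ.proj, s • ξ.snd⟩

theorem contMDiff_fibreSmul (s : ℝ) :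
    ContMDiff (𝓡 n).tangent (𝓡 n).tangent ∞ (fibreSmul s : TangentBundle (𝓡 n) B → _) :=
  contMDiff_fibre_smul.comp (contMDiff_const.prodMk contMDiff_id)

theorem continuous_metric_self (g : SmoothMetric n B) :
    Continuous (fun ξ : TangentBundle (𝓡 n) B => g.inner ξ.proj ξ.snd ξ.snd) := by
  refine continuous_iff_continuousAt.2 fun ξ => ?_
  have h : ContMDiffAt (𝓡 n).tangent (𝓡 n).tangent ∞
      (fun ξ : TangentBundle (𝓡 n) B => (⟨ξ.proj, ξ.snd⟩ : TangentBundle (𝓡 n) B)) ξ :=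
    contMDiffAt_id
  exact (h.metric_inner g h).continuousAt

end Fibrewise

/-! ### Local frames of a submanifold -/

section Frame

variable {n k : ℕ} {B : Type u} [TopologicalSpace B]
  [ChartedSpace (EuclideanSpace ℝ (Fin n)) B] [IsManifold (𝓡 n) ∞ B]
  {F : Type v} [TopologicalSpace F] [ChartedSpace (EuclideanSpace ℝ (Fin k)) F]
  [IsManifold (𝓡 k) ∞ F]

local notation "𝔼" n => EuclideanSpace ℝ (Fin n)

/-- The image in `TB` of the `j`-th vector of the frame of `TF` given by the chart at `p`. -/
def submanifoldFrame (f : F → B) (p x : F) (j : Fin k) : TangentSpace (𝓡 n) (f x) :=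
  mfderiv (𝓡 k) (𝓡 n) f x ((trivializationAt (𝔼 k) (TangentSpace (𝓡 k)) p).symmL ℝ x
    (EuclideanSpace.single j 1))

theorem contMDiffAt_submanifoldFrame {f : F → B} (hf : ContMDiff (𝓡 k) (𝓡 n) ∞ f) {p x : F}
    (hx : x ∈ (chartAt (𝔼 k) p).source) (j : Fin k) :
    ContMDiffAt (𝓡 k) (𝓡 n).tangent ∞
      (fun x => (⟨f x, submanifoldFrame f p x j⟩ : TangentBundle (𝓡 n) B)) x := by
  have h1 := (trivializationAt (𝔼 k) (TangentSpace (𝓡 k)) p).contMDiffAt_symmL (n := ∞)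
    (IB := 𝓡 k) (x := x) hx
  have h2 : ContMDiffAt (𝓡 k) (𝓡 k).tangent ∞ (fun x => (⟨x,
      (trivializationAt (𝔼 k) (TangentSpace (𝓡 k)) p).symmL ℝ x (EuclideanSpace.single j 1)⟩ :
        TangentBundle (𝓡 k) F)) x :=
    ContMDiffAt.clm_bundle_apply (F₁ := 𝔼 k) (E₁ := Bundle.Trivial F (𝔼 k))
      (F₂ := 𝔼 k) (E₂ := fun b : F => TangentSpace (𝓡 k) b) (b := id)
      (v := fun _ => EuclideanSpace.single j 1) h1
      (Bundle.contMDiffAt_totalSpace.2 ⟨contMDiffAt_id, contMDiffAt_const⟩)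
  have h3 : ContMDiff (𝓡 k).tangent (𝓡 n).tangent ∞ (tangentMap (𝓡 k) (𝓡 n) f) :=
    hf.contMDiff_tangentMap (by simp)
  exact h3.contMDiffAt.comp x h2

omit [IsManifold (𝓡 n) ∞ B] in
/-- A linear functional on `T_x B` kills `T_x F` if it kills the frame vectors. -/
theorem apply_mfderiv_eq_zero_of_frame {f : F → B} {p x : F} (hx : x ∈ (chartAt (𝔼 k) p).source)
    (φ : TangentSpace (𝓡 n) (f x) →L[ℝ] ℝ) (h : ∀ j : Fin k, φ (submanifoldFrame f p x j) = 0)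
    (τ : TangentSpace (𝓡 k) x) : φ (mfderiv (𝓡 k) (𝓡 n) f x τ) = 0 := by
  let e := trivializationAt (𝔼 k) (TangentSpace (𝓡 k)) p
  let L : (𝔼 k) →ₗ[ℝ] ℝ :=
    (φ.comp ((mfderiv (𝓡 k) (𝓡 n) f x).comp (e.symmL ℝ x))).toLinearMap
  have hL : L = 0 := by
    refine (EuclideanSpace.basisFun (Fin k) ℝ).toBasis.ext fun j => ?_
    simpa using! h j
  have h1 : e.symmL ℝ x (e.continuousLinearMapAt ℝ x τ) = τ :=
    e.symmL_continuousLinearMapAt (R := ℝ) hx τ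
  rw [← h1]
  exact congrArg (fun T => T (e.continuousLinearMapAt ℝ x τ)) hL

theorem mk_mem_normalBundle_of_frame {f : F → B} {g : SmoothMetric n B} {p x : F}
    (hx : x ∈ (chartAt (𝔼 k) p).source) {ν : TangentSpace (𝓡 n) (f x)}
    (h : ∀ j : Fin k, g.inner (f x) (submanifoldFrame f p x j) ν = 0) :
    (⟨f x, ν⟩ : TangentBundle (𝓡 n) B) ∈ normalBundle k f g := by
  refine ⟨x, ν, rfl, fun τ => ?_⟩
  rw [g.symm]
  refine apply_mfderiv_eq_zero_of_frame hx (g.inner (f x) ν) (fun j => ?_) τ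
  rw [g.symm]
  exact h j

omit [IsManifold (𝓡 k) ∞ F] in
theorem inner_frame_eq_zero_of_mem_normalBundle {f : F → B} (hf : Function.Injective f)
    {g : SmoothMetric n B} {x : F} {ν : TangentSpace (𝓡 n) (f x)}
    (h : (⟨f x, ν⟩ : TangentBundle (𝓡 n) B) ∈ normalBundle k f g) (τ : TangentSpace (𝓡 k) x) :
    g.inner (f x) (mfderiv (𝓡 k) (𝓡 n) f x τ) ν = 0 := by
  obtain ⟨x', ν', hξ, h'⟩ := h
  obtain rfl : x = x' := hf (congrArg Bundle.TotalSpace.proj hξ)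
  obtain rfl : ν = ν' := by simpa using hξ
  exact h' τ

end Frame

/-! ### Points near a submanifold as endpoints of normal vectors -/

section Slice

variable {n k : ℕ} {B : Type u} [TopologicalSpace B]
  [ChartedSpace (EuclideanSpace ℝ (Fin n)) B] [IsManifold (𝓡 n) ∞ B]
  {F : Type v} [TopologicalSpace F] [ChartedSpace (EuclideanSpace ℝ (Fin k)) F]

local notation "𝔼" n => EuclideanSpace ℝ (Fin n)

variable (f : F → B) (g : SmoothMetric n B) (t : Finset B)
  (χ : ∀ c : B, SmoothBumpFunction (𝓡 n) c)

section

variable [IsManifold (𝓡 k) ∞ F]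

/-- The pairings of `bumpLog (f x) y` with the frame vectors of `F` at `x`. -/
def framePairing (k : ℕ) [ChartedSpace (EuclideanSpace ℝ (Fin k)) F] [IsManifold (𝓡 k) ∞ F]
    (f : F → B) (g : SmoothMetric n B) (t : Finset B)
    (χ : ∀ c : B, SmoothBumpFunction (𝓡 n) c) (p : F) (q : F × B) (j : Fin k) : ℝ :=
  g.inner (f q.1) (submanifoldFrame f p q.1 j) (bumpLog t χ (f q.1) q.2)

/-- The map `(x, y) ↦ (y, framePairing (x, y))`: over `y × 0` lie the points `x` of `F` at which
`bumpLog (f x) y` is normal to `F`. -/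
def sliceMap (k : ℕ) [ChartedSpace (EuclideanSpace ℝ (Fin k)) F] [IsManifold (𝓡 k) ∞ F]
    (f : F → B) (g : SmoothMetric n B) (t : Finset B)
    (χ : ∀ c : B, SmoothBumpFunction (𝓡 n) c) (p : F) (q : F × B) : B × (Fin k → ℝ) :=
  (q.2, framePairing k f g t χ p q)

def sliceDomain (k : ℕ) [ChartedSpace (EuclideanSpace ℝ (Fin k)) F] (f : F → B) (t : Finset B)
    (χ : ∀ c : B, SmoothBumpFunction (𝓡 n) c) (p : F) : Set (F × B) :=
  {q | q.1 ∈ (chartAt (𝔼 k) p).source ∧ (f q.1, q.2) ∈ bumpLogDomain t χ}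

end

omit [IsManifold (𝓡 n) ∞ B] in
theorem isOpen_sliceDomain (hf : Continuous f) (p : F) : IsOpen (sliceDomain k f t χ p) :=
  ((chartAt (𝔼 k) p).open_source.preimage continuous_fst).inter
    ((isOpen_bumpLogDomain t χ).preimage ((hf.comp continuous_fst).prodMk continuous_snd))

omit [IsManifold (𝓡 n) ∞ B] in
theorem mem_sliceDomain [T2Space B] (p : F) : (p, f p) ∈ sliceDomain k f t χ p :=
  ⟨mem_chart_source (𝔼 k) p, diag_mem_bumpLogDomain t χ (f p)⟩

variable [T2Space B] [IsManifold (𝓡 k) ∞ F]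

variable {f} in
theorem contMDiffAt_framePairing (hf : ContMDiff (𝓡 k) (𝓡 n) ∞ f) (p : F) {q : F × B}
    (hq : q ∈ sliceDomain k f t χ p) :
    ContMDiffAt ((𝓡 k).prod (𝓡 n)) 𝓘(ℝ, Fin k → ℝ) ∞ (framePairing k f g t χ p) q := by
  refine contMDiffAt_pi_space.2 fun j => ?_
  refine ContMDiffAt.metric_inner g (b := fun q : F × B => f q.1) ?_ ?_
  · exact ContMDiffAt.comp q (contMDiffAt_submanifoldFrame hf hq.1 j) contMDiffAt_fst
  · have h1 : ContMDiffAt ((𝓡 n).prod (𝓡 n)) (𝓡 n).tangent ∞ (bumpLogMap t χ) (f q.1, q.2) :=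
      (contMDiffOn_bumpLogMap t χ _ hq.2).contMDiffAt
        ((isOpen_bumpLogDomain t χ).mem_nhds hq.2)
    exact h1.comp q ((hf.contMDiffAt.comp q contMDiffAt_fst).prodMk contMDiffAt_snd)

variable {f} in
theorem contMDiffOn_sliceMap (hf : ContMDiff (𝓡 k) (𝓡 n) ∞ f) (p : F) :
    ContMDiffOn ((𝓡 k).prod (𝓡 n)) ((𝓡 n).prod 𝓘(ℝ, Fin k → ℝ)) ∞ (sliceMap k f g t χ p)
      (sliceDomain k f t χ p) := fun _ hq =>
  (contMDiffAt_snd.prodMk (contMDiffAt_framePairing g t χ hf p hq)).contMDiffWithinAt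

omit [T2Space B] in
theorem framePairing_self (p x : F) : framePairing k f g t χ p (x, f x) = 0 := by
  funext j
  simp [framePairing, bumpLog_self]

omit [T2Space B] [IsManifold (𝓡 n) ∞ B] [IsManifold (𝓡 k) ∞ F] in
theorem hasMFDerivAt_prodMk_left' (p : F) (c : B) :
    HasMFDerivAt (𝓡 n) ((𝓡 k).prod (𝓡 n)) (Prod.mk p) c
      (ContinuousLinearMap.inr ℝ (𝔼 k) (𝔼 n)) :=
  (hasMFDerivAt_const (I := 𝓡 n) (I' := 𝓡 k) p c).prodMk (hasMFDerivAt_id (I := 𝓡 n) c)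

variable {f} in
theorem mfderiv_framePairing_inr (hf : ContMDiff (𝓡 k) (𝓡 n) ∞ f) (p : F) (v : 𝔼 n)
    (j : Fin k) :
    (mfderiv ((𝓡 k).prod (𝓡 n)) 𝓘(ℝ, Fin k → ℝ) (framePairing k f g t χ p) (p, f p)
      ((0, v) : (𝔼 k) × (𝔼 n)) : Fin k → ℝ) j =
    g.inner (f p) (submanifoldFrame f p p j) ((∑ c ∈ t, χ c (f p)) • v : 𝔼 n) := by
  let φ : (𝔼 n) →L[ℝ] ℝ := g.inner (f p) (submanifoldFrame f p p j)
  have hH : HasMFDerivAt ((𝓡 k).prod (𝓡 n)) 𝓘(ℝ, Fin k → ℝ) (framePairing k f g t χ p) (p, f p)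
      (mfderiv ((𝓡 k).prod (𝓡 n)) 𝓘(ℝ, Fin k → ℝ) (framePairing k f g t χ p) (p, f p)) :=
    ((contMDiffAt_framePairing g t χ hf p (mem_sliceDomain f t χ p)).mdifferentiableAt
      (by simp)).hasMFDerivAt
  have h1 := HasMFDerivAt.comp (f p) hH (hasMFDerivAt_prodMk_left' p (f p))
  have h2 := HasMFDerivAt.comp (f p)
    (ContinuousLinearMap.proj (R := ℝ) (φ := fun _ : Fin k => ℝ) j).hasMFDerivAt h1
  have h3 : HasMFDerivAt (𝓡 n) 𝓘(ℝ, ℝ) (fun y => φ (bumpLog t χ (f p) y)) (f p)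
      (φ.comp ((∑ c ∈ t, χ c (f p)) • ContinuousLinearMap.id ℝ (𝔼 n))) :=
    HasMFDerivAt.comp (M' := 𝔼 n) (I' := 𝓘(ℝ, 𝔼 n)) (f p) φ.hasMFDerivAt
      (hasMFDerivAt_bumpLog t χ (f p))
  exact congrArg (fun T : (𝔼 n) →L[ℝ] ℝ => T v) (hasMFDerivAt_unique h2 h3)

variable {f} in
-- The pairing is identically zero along the graph `x ↦ (x, f x)`, so its differential kills the
-- tangent vectors of the graph.
theorem mfderiv_framePairing_tangent (hf : ContMDiff (𝓡 k) (𝓡 n) ∞ f) (p : F) (a : 𝔼 k) :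
    (mfderiv ((𝓡 k).prod (𝓡 n)) 𝓘(ℝ, Fin k → ℝ) (framePairing k f g t χ p) (p, f p)
      ((a, mfderiv (𝓡 k) (𝓡 n) f p a) : (𝔼 k) × (𝔼 n)) : Fin k → ℝ) = 0 := by
  have hH : HasMFDerivAt ((𝓡 k).prod (𝓡 n)) 𝓘(ℝ, Fin k → ℝ) (framePairing k f g t χ p) (p, f p)
      (mfderiv ((𝓡 k).prod (𝓡 n)) 𝓘(ℝ, Fin k → ℝ) (framePairing k f g t χ p) (p, f p)) :=
    ((contMDiffAt_framePairing g t χ hf p (mem_sliceDomain f t χ p)).mdifferentiableAt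
      (by simp)).hasMFDerivAt
  have hfd : HasMFDerivAt (𝓡 k) (𝓡 n) f p (mfderiv (𝓡 k) (𝓡 n) f p) :=
    (hf.mdifferentiable (by simp) p).hasMFDerivAt
  have hd := (hasMFDerivAt_id (I := 𝓡 k) p).prodMk hfd
  have h1 := HasMFDerivAt.comp p hH hd
  have h2 : HasMFDerivAt (𝓡 k) 𝓘(ℝ, Fin k → ℝ) (framePairing k f g t χ p ∘ fun x => (id x, f x)) p
      (0 : (𝔼 k) →L[ℝ] (Fin k → ℝ)) := by
    have : (framePairing k f g t χ p ∘ fun x => (id x, f x)) = fun _ => (0 : Fin k → ℝ) := by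
      funext x
      exact framePairing_self f g t χ p x
    rw [this]
    exact hasMFDerivAt_const (I := 𝓡 k) (I' := 𝓘(ℝ, Fin k → ℝ)) (0 : Fin k → ℝ) p
  exact congrArg (fun T : (𝔼 k) →L[ℝ] (Fin k → ℝ) => T a) (hasMFDerivAt_unique h1 h2)

variable {f} in
-- A kernel vector has the form `(a, 0)`. Subtracting it from the graph tangent `(a, df a)` shows
-- that `(0, df a)` is killed by the differential of the pairing, that is, `df a` is normal to `F`.
-- It is also tangent, hence zero, and `a = 0` because `f` is an immersion.
theorem isLocalDiffeomorphAt_sliceMap (hf : IsSmoothEmbedding (𝓡 k) (𝓡 n) ∞ f) (p : F)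
    (hc : ∑ c ∈ t, χ c (f p) ≠ 0) :
    IsLocalDiffeomorphAt ((𝓡 k).prod (𝓡 n)) ((𝓡 n).prod 𝓘(ℝ, Fin k → ℝ)) ∞
      (sliceMap k f g t χ p) (p, f p) := by
  have hfs : ContMDiff (𝓡 k) (𝓡 n) ∞ f := hf.contMDiff
  refine isLocalDiffeomorphAt_of_injective_mfderiv (by simp [add_comm])
    (isOpen_sliceDomain f t χ hfs.continuous p) (contMDiffOn_sliceMap g t χ hfs p)
    (mem_sliceDomain f t χ p) ?_
  let DH : (𝔼 k) × (𝔼 n) →L[ℝ] (Fin k → ℝ) :=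
    mfderiv ((𝓡 k).prod (𝓡 n)) 𝓘(ℝ, Fin k → ℝ) (framePairing k f g t χ p) (p, f p)
  have hH : HasMFDerivAt ((𝓡 k).prod (𝓡 n)) 𝓘(ℝ, Fin k → ℝ) (framePairing k f g t χ p) (p, f p)
      DH :=
    ((contMDiffAt_framePairing g t χ hfs p (mem_sliceDomain f t χ p)).mdifferentiableAt
      (by simp)).hasMFDerivAt
  have hΩ : HasMFDerivAt ((𝓡 k).prod (𝓡 n)) ((𝓡 n).prod 𝓘(ℝ, Fin k → ℝ))
      (sliceMap k f g t χ p) (p, f p) ((ContinuousLinearMap.snd ℝ (𝔼 k) (𝔼 n)).prod DH) :=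
    (hasMFDerivAt_snd (I := 𝓡 k) (I' := 𝓡 n) (p, f p)).prodMk hH
  rw [hΩ.mfderiv]
  refine (injective_iff_map_eq_zero
    ((ContinuousLinearMap.snd ℝ (𝔼 k) (𝔼 n)).prod DH)).2 ?_
  rintro ⟨a, v⟩ hav
  have hv : v = 0 := congrArg Prod.fst hav
  have hD : DH (a, v) = 0 := congrArg Prod.snd hav
  subst hv
  let w : 𝔼 n := mfderiv (𝓡 k) (𝓡 n) f p a
  have h1 : DH (a, w) = 0 := mfderiv_framePairing_tangent g t χ hfs p a
  have h2 : DH (0, w) = 0 := by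
    have : ((0, w) : (𝔼 k) × (𝔼 n)) = (a, w) - (a, 0) := by simp
    rw [this, map_sub, h1, hD, sub_zero]
  have h3 : ∀ j : Fin k, g.inner (f p) (submanifoldFrame f p p j)
      ((∑ c ∈ t, χ c (f p)) • w : 𝔼 n) = 0 := fun j =>
    (mfderiv_framePairing_inr g t χ hfs p w j).symm.trans (congrFun h2 j)
  have h4 : ∀ j : Fin k, g.inner (f p) w (submanifoldFrame f p p j) = 0 := by
    intro j
    rw [g.symm]
    have h5 : (g.inner (f p) (submanifoldFrame f p p j)) ((∑ c ∈ t, χ c (f p)) • w : 𝔼 n) =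
      (∑ c ∈ t, χ c (f p)) • g.inner (f p) (submanifoldFrame f p p j) w := map_smul _ _ _
    exact (smul_eq_zero.1 (h5.symm.trans (h3 j))).resolve_left hc
  have h5 : g.inner (f p) w w = 0 :=
    apply_mfderiv_eq_zero_of_frame (mem_chart_source (𝔼 k) p) (g.inner (f p) w) h4 a
  have hw : w = 0 := by
    by_contra hne
    exact (g.pos (f p) w hne).ne' h5
  have ha : a = 0 :=
    injective_mfderiv_of_isImmersionAt (hf.isImmersion.isImmersionAt p)
      (hw.trans (map_zero (mfderiv (𝓡 k) (𝓡 n) f p)).symm)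
  rw [ha]
  rfl

end Slice

/-! ### Compactness of the disc bundle -/

section DiscCompact

variable {n k : ℕ} {B : Type u} [TopologicalSpace B]
  [ChartedSpace (EuclideanSpace ℝ (Fin n)) B] [IsManifold (𝓡 n) ∞ B]
  {F : Type v} [TopologicalSpace F] [ChartedSpace (EuclideanSpace ℝ (Fin k)) F]

local notation "𝔼" n => EuclideanSpace ℝ (Fin n)

theorem t2Space_tangentBundle [T2Space B] : T2Space (TangentBundle (𝓡 n) B) := by
  have hπ : Continuous (Bundle.TotalSpace.proj : TangentBundle (𝓡 n) B → B) :=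
    FiberBundle.continuous_proj (𝔼 n) (TangentSpace (𝓡 n))
  refine ⟨fun ξ η hne => ?_⟩
  by_cases hb : ξ.proj = η.proj
  · let e := trivializationAt (𝔼 n) (TangentSpace (𝓡 n)) ξ.proj
    have hξ : ξ ∈ e.source := FiberBundle.mem_trivializationAt_proj_source
    have hη : η ∈ e.source := by
      rw [e.mem_source, ← hb]
      exact FiberBundle.mem_baseSet_trivializationAt (𝔼 n) (TangentSpace (𝓡 n)) ξ.proj
    obtain ⟨U, V, hU, hV, hUξ, hVη, hUV⟩ :=
      t2_separation (fun h => hne (e.injOn hξ hη h) : e ξ ≠ e η)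
    refine ⟨e.source ∩ e ⁻¹' U, e.source ∩ e ⁻¹' V,
      e.continuousOn.isOpen_inter_preimage e.open_source hU,
      e.continuousOn.isOpen_inter_preimage e.open_source hV, ⟨hξ, hUξ⟩, ⟨hη, hVη⟩, ?_⟩
    exact (hUV.preimage e).mono inter_subset_right inter_subset_right
  · obtain ⟨U, V, hU, hV, hUξ, hVη, hUV⟩ := t2_separation hb
    exact ⟨_, _, hU.preimage hπ, hV.preimage hπ, hUξ, hVη, hUV.preimage _⟩

/-- The parametrization of `TB|_F` given by the tangent coordinates of `B` at `f p`. -/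
def pullbackCoord (n : ℕ) [ChartedSpace (EuclideanSpace ℝ (Fin n)) B] [IsManifold (𝓡 n) ∞ B]
    (f : F → B) (p : F) (q : F × 𝔼 n) : TangentSpace (𝓡 n) (f q.1) :=
  (trivializationAt (𝔼 n) (TangentSpace (𝓡 n)) (f p)).symmL ℝ (f q.1) q.2

theorem contMDiffAt_pullbackCoord {f : F → B} (hf : ContMDiff (𝓡 k) (𝓡 n) ∞ f) (p : F)
    {q : F × 𝔼 n} (hq : f q.1 ∈ (chartAt (𝔼 n) (f p)).source) :
    ContMDiffAt ((𝓡 k).prod (𝓡 n)) (𝓡 n).tangent ∞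
      (fun q => (⟨f q.1, pullbackCoord n f p q⟩ : TangentBundle (𝓡 n) B)) q := by
  have hb : ContMDiffAt ((𝓡 k).prod (𝓡 n)) (𝓡 n) ∞ (fun q : F × 𝔼 n => f q.1) q :=
    hf.contMDiffAt.comp q contMDiffAt_fst
  have h1 := ((trivializationAt (𝔼 n) (TangentSpace (𝓡 n)) (f p)).contMDiffAt_symmL (n := ∞)
    (IB := 𝓡 n) (x := f q.1) hq).comp q hb
  have h2 : ContMDiffAt ((𝓡 k).prod (𝓡 n)) 𝓘(ℝ, 𝔼 n) ∞ (fun q : F × 𝔼 n => q.2) q :=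
    contMDiffAt_snd
  exact ContMDiffAt.clm_bundle_apply (F₁ := 𝔼 n) (E₁ := Bundle.Trivial B (𝔼 n))
    (F₂ := 𝔼 n) (E₂ := fun b : B => TangentSpace (𝓡 n) b) (b := fun q : F × 𝔼 n => f q.1)
    (v := fun q => q.2) h1 (Bundle.contMDiffAt_totalSpace.2 ⟨hb, h2⟩)

theorem exists_pos_forall_le_of_isCompact {X : Type*} [TopologicalSpace X] {C : Set X}
    (hC : IsCompact C) {h : X → ℝ} (hh : ContinuousOn h C) (hpos : ∀ x ∈ C, 0 < h x) :
    ∃ m > 0, ∀ x ∈ C, m ≤ h x := by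
  rcases C.eq_empty_or_nonempty with rfl | hne
  · exact ⟨1, one_pos, fun x hx => hx.elim⟩
  · obtain ⟨x, hx, hmin⟩ := hC.exists_isMinOn hne hh
    exact ⟨h x, hpos x hx, fun y hy => hmin hy⟩

variable [T2Space B] [IsManifold (𝓡 k) ∞ F]

/-- Near every point of `F`, the normal disc bundle over some neighbourhood is compact. -/
theorem exists_nhds_discBundle_compact {f : F → B} (hf : IsSmoothEmbedding (𝓡 k) (𝓡 n) ∞ f)
    (g : SmoothMetric n B) (p : F) :
    ∃ K ∈ 𝓝 p, ∃ Z : Set (TangentBundle (𝓡 n) B), IsCompact Z ∧ Z ⊆ discBundle k f g ∧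
      ∀ ξ ∈ discBundle k f g, ∀ x ∈ K, ξ.proj = f x → ξ ∈ Z := by
  have hfs : ContMDiff (𝓡 k) (𝓡 n) ∞ f := hf.contMDiff
  have hfc : Continuous f := hfs.continuous
  have : T2Space F := hf.isEmbedding.t2Space
  have : LocallyCompactSpace F := ChartedSpace.locallyCompactSpace (𝔼 k) F
  have hU : (chartAt (𝔼 k) p).source ∩ f ⁻¹' (chartAt (𝔼 n) (f p)).source ∈ 𝓝 p :=
    Filter.inter_mem ((chartAt (𝔼 k) p).open_source.mem_nhds (mem_chart_source (𝔼 k) p))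
      (((chartAt (𝔼 n) (f p)).open_source.preimage hfc).mem_nhds (mem_chart_source (𝔼 n) (f p)))
  obtain ⟨K, hKp, hKU, hK⟩ := local_compact_nhds hU
  let σ : F × (𝔼 n) → TangentBundle (𝓡 n) B := fun q => ⟨f q.1, pullbackCoord n f p q⟩
  have hσ : ∀ q : F × 𝔼 n, q.1 ∈ K → ContMDiffAt ((𝓡 k).prod (𝓡 n)) (𝓡 n).tangent ∞ σ q :=
    fun q hq => contMDiffAt_pullbackCoord hfs p (hKU hq).2
  let N : F × (𝔼 n) → ℝ := fun q =>
    g.inner (f q.1) (pullbackCoord n f p q) (pullbackCoord n f p q)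
  have hN : ∀ q : F × 𝔼 n, q.1 ∈ K → ContinuousAt N q := fun q hq =>
    ((hσ q hq).metric_inner g (hσ q hq)).continuousAt
  let P : Fin k → F × (𝔼 n) → ℝ := fun j q =>
    g.inner (f q.1) (submanifoldFrame f p q.1 j) (pullbackCoord n f p q)
  have hP : ∀ j (q : F × 𝔼 n), q.1 ∈ K → ContinuousAt (P j) q := fun j q hq =>
    (ContMDiffAt.metric_inner g (b := fun q : F × 𝔼 n => f q.1)
      (ContMDiffAt.comp q (contMDiffAt_submanifoldFrame hfs (hKU hq).1 j) contMDiffAt_fst)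
      (hσ q hq)).continuousAt
  have hsymm : ∀ x ∈ K, ∀ v : TangentSpace (𝓡 n) (f x), ∃ w : 𝔼 n, pullbackCoord n f p (x, w) = v :=
    fun x hx v => ⟨_, (trivializationAt (𝔼 n) (TangentSpace (𝓡 n)) (f p)).symmL_continuousLinearMapAt
      (R := ℝ) (hKU hx).2 v⟩
  have hinj : ∀ x ∈ K, ∀ w : 𝔼 n, pullbackCoord n f p (x, w) = 0 → w = 0 := by
    intro x hx w hw
    have h1 : (trivializationAt (𝔼 n) (TangentSpace (𝓡 n)) (f p)).continuousLinearMapAt ℝ (f x)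
        (pullbackCoord n f p (x, w)) = w :=
      (trivializationAt (𝔼 n) (TangentSpace (𝓡 n)) (f p)).continuousLinearMapAt_symmL
        (R := ℝ) (hKU hx).2 w
    rw [hw] at h1
    exact h1.symm.trans (map_zero _)
  have hhom : ∀ (x : F) (s : ℝ) (w : 𝔼 n), N (x, s • w) = s ^ 2 * N (x, w) := by
    intro x s w
    have h1 : pullbackCoord n f p (x, s • w) = s • pullbackCoord n f p (x, w) := map_smul _ _ _
    simp only [N, h1, map_smul, smul_apply, smul_eq_mul]
    ring
  -- A uniform lower bound of the metric on coordinate unit vectors over `K`; by homogeneity, metric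
  -- discs lie in the coordinate ball of radius `√(1 / m)`.
  obtain ⟨m, hm, hmN⟩ := exists_pos_forall_le_of_isCompact
    (hK.prod (isCompact_sphere (0 : 𝔼 n) 1)) (h := N)
    (fun q hq => (hN q hq.1).continuousWithinAt) (by
      rintro ⟨x, w⟩ ⟨hx, hw⟩
      refine g.pos _ _ fun h0 => ?_
      rw [hinj x hx w h0] at hw
      simp at hw)
  have hbound : ∀ x ∈ K, ∀ w : 𝔼 n, N (x, w) ≤ 1 → w ∈ Metric.closedBall (0 : 𝔼 n) (√(1 / m)) := by
    intro x hx w hw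
    rw [mem_closedBall_zero_iff]
    by_cases hw0 : w = 0
    · rw [hw0, norm_zero]
      positivity
    · have hn : ‖w‖ ≠ 0 := norm_ne_zero_iff.2 hw0
      have h1 : N (x, w) = ‖w‖ ^ 2 * N (x, ‖w‖⁻¹ • w) := by
        rw [← hhom, smul_smul, mul_inv_cancel₀ hn, one_smul]
      have h2 : m ≤ N (x, ‖w‖⁻¹ • w) := by
        refine hmN _ ⟨hx, ?_⟩
        simp [norm_smul, hn]
      refine Real.le_sqrt_of_sq_le ?_
      rw [le_div_iff₀ hm]
      calc ‖w‖ ^ 2 * m ≤ ‖w‖ ^ 2 * N (x, ‖w‖⁻¹ • w) := by gcongr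
        _ ≤ 1 := h1 ▸ hw
  let C : Set (F × 𝔼 n) := K ×ˢ Metric.closedBall (0 : 𝔼 n) (√(1 / m))
  have hC : IsCompact C := hK.prod (isCompact_closedBall _ _)
  -- The disc bundle over `K` in coordinates: length at most one, and orthogonality to the finitely
  -- many frame vectors.
  let A : Set (F × 𝔼 n) := (C ∩ N ⁻¹' Iic 1) ∩ ⋂ j, (C ∩ P j ⁻¹' {0})
  have hA : IsCompact A := by
    refine (hC.of_isClosed_subset (ContinuousOn.preimage_isClosed_of_isClosed
      (fun q hq => (hN q hq.1).continuousWithinAt) hC.isClosed isClosed_Iic)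
      inter_subset_left).inter_right (isClosed_iInter fun j => ?_)
    exact ContinuousOn.preimage_isClosed_of_isClosed
      (fun q hq => (hP j q hq.1).continuousWithinAt) hC.isClosed isClosed_singleton
  refine ⟨K, hKp, σ '' A, hA.image_of_continuousOn fun q hq =>
    (hσ q hq.1.1.1).continuousAt.continuousWithinAt, ?_, ?_⟩
  · rintro _ ⟨q, ⟨⟨hqC, hqN⟩, hqP⟩, rfl⟩
    exact ⟨mk_mem_normalBundle_of_frame (hKU hqC.1).1 fun j => (mem_iInter.1 hqP j).2, hqN⟩
  · rintro ⟨_, v⟩ ⟨hξ, hξ1⟩ x hx rfl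
    obtain ⟨w, rfl⟩ := hsymm x hx v
    have hwC : (x, w) ∈ C := ⟨hx, hbound x hx w hξ1⟩
    refine ⟨(x, w), ⟨⟨hwC, hξ1⟩, mem_iInter.2 fun j => ⟨hwC, ?_⟩⟩, rfl⟩
    exact inner_frame_eq_zero_of_mem_normalBundle hf.isEmbedding.injective hξ _

theorem isCompact_discBundle [CompactSpace F] {f : F → B}
    (hf : IsSmoothEmbedding (𝓡 k) (𝓡 n) ∞ f) (g : SmoothMetric n B) :
    IsCompact (discBundle k f g) := by
  choose K hK Z hZ hZD hDZ using exists_nhds_discBundle_compact hf g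
  obtain ⟨s, hs⟩ := CompactSpace.elim_nhds_subcover K hK
  have : discBundle k f g = ⋃ p ∈ s, Z p := by
    refine Subset.antisymm (fun ξ hξ => ?_) (iUnion₂_subset fun p _ => hZD p)
    obtain ⟨x, ν, hx, -⟩ := hξ.1
    have hxs : x ∈ ⋃ p ∈ s, K p := hs ▸ mem_univ x
    simp only [mem_iUnion] at hxs ⊢
    obtain ⟨p, hp, hxp⟩ := hxs
    exact ⟨p, hp, hDZ p ξ hξ x hxp (congrArg Bundle.TotalSpace.proj hx)⟩
  rw [this]
  exact s.isCompact_biUnion fun p _ => hZ p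

end DiscCompact

/-! ### Existence of tubular neighbourhoods -/

section Tubular

variable {n k : ℕ} {B : Type u} [TopologicalSpace B] [T2Space B]
  [ChartedSpace (EuclideanSpace ℝ (Fin n)) B] [IsManifold (𝓡 n) ∞ B]
  {F : Type v} [TopologicalSpace F] [ChartedSpace (EuclideanSpace ℝ (Fin k)) F]

local notation "𝔼" n => EuclideanSpace ℝ (Fin n)

omit [T2Space B] [IsManifold (𝓡 n) ∞ B] in
theorem exists_bump_sum_ne_zero {C : Set B} (hC : IsCompact C) :
    ∃ (t : Finset B) (χ : ∀ c : B, SmoothBumpFunction (𝓡 n) c), ∀ x ∈ C, ∑ c ∈ t, χ c x ≠ 0 := by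
  let χ : ∀ c : B, SmoothBumpFunction (𝓡 n) c := fun c => Classical.arbitrary _
  obtain ⟨t, -, ht⟩ := hC.elim_nhds_subcover (fun c => {x | χ c x = 1})
    (fun c _ => (χ c).eventuallyEq_one)
  refine ⟨t, χ, fun x hx => ?_⟩
  have hx' := ht hx
  simp only [mem_iUnion] at hx'
  obtain ⟨c, hc, hxc⟩ := hx'
  refine (Finset.sum_pos' (fun c _ => (χ c).nonneg) ⟨c, hc, ?_⟩).ne'
  rw [show χ c x = 1 from hxc]
  exact one_pos

theorem exists_bumpLog_partialDiffeomorph [Nonempty B] {C : Set B} (hC : IsCompact C)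
    {t : Finset B} {χ : ∀ c : B, SmoothBumpFunction (𝓡 n) c}
    (ht : ∀ x ∈ C, ∑ c ∈ t, χ c x ≠ 0) :
    ∃ Φ : PartialDiffeomorph ((𝓡 n).prod (𝓡 n)) (𝓡 n).tangent (B × B) (TangentBundle (𝓡 n) B) ∞,
      (∀ x ∈ C, (x, x) ∈ Φ.source) ∧ EqOn (bumpLogMap t χ) Φ Φ.source := by
  have := t2Space_tangentBundle (n := n) (B := B)
  obtain ⟨Φ, hΦ, hΦ'⟩ := exists_partialDiffeomorph_of_injOn (m := ∞)
    (I := (𝓡 n).prod (𝓡 n)) (J := (𝓡 n).tangent) (f := bumpLogMap t χ)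
    (K := (fun x : B => (x, x)) '' C) (hC.image (by fun_prop))
    (by
      rintro _ ⟨x, hx, rfl⟩ _ ⟨y, hy, rfl⟩ h
      have : x = y := congrArg Bundle.TotalSpace.proj h
      rw [this])
    (by
      rintro _ ⟨x, hx, rfl⟩
      exact isLocalDiffeomorphAt_bumpLogMap t χ (ht x hx))
  exact ⟨Φ, fun x hx => hΦ ⟨x, hx, rfl⟩, hΦ'⟩

variable [IsManifold (𝓡 k) ∞ F]

/-- Near a point of `F`, the endpoint map of normal vectors has a smooth inverse. -/
theorem exists_local_inverse_normalBundle {f : F → B} (hf : IsSmoothEmbedding (𝓡 k) (𝓡 n) ∞ f)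
    (g : SmoothMetric n B) {t : Finset B} {χ : ∀ c : B, SmoothBumpFunction (𝓡 n) c}
    {Φ : PartialDiffeomorph ((𝓡 n).prod (𝓡 n)) (𝓡 n).tangent (B × B) (TangentBundle (𝓡 n) B) ∞}
    (hΦ : EqOn (bumpLogMap t χ) Φ Φ.source) {p : F} (hp : (f p, f p) ∈ Φ.source)
    (ht : ∑ c ∈ t, χ c (f p) ≠ 0) :
    ∃ (ρ : B → TangentBundle (𝓡 n) B) (V : Set B) (W : Set (TangentBundle (𝓡 n) B)),
      IsOpen V ∧ IsOpen W ∧ (⟨f p, 0⟩ : TangentBundle (𝓡 n) B) ∈ W ∧ W ⊆ Φ.target ∧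
      ContMDiffOn (𝓡 n) (𝓡 n).tangent ∞ ρ V ∧
      (∀ ξ ∈ W, ξ ∈ normalBundle k f g → (Φ.symm ξ).2 ∈ V ∧ ρ (Φ.symm ξ).2 = ξ) ∧
      ∀ y ∈ V, ρ y ∈ normalBundle k f g ∧ (Φ.symm (ρ y)).2 = y := by
  have hfs : ContMDiff (𝓡 k) (𝓡 n) ∞ f := hf.contMDiff
  have hfc : Continuous f := hfs.continuous
  obtain ⟨Ψ, hpΨ, hΨ⟩ := isLocalDiffeomorphAt_sliceMap g t χ hf p ht
  let O : Set (F × B) := sliceDomain k f t χ p ∩ {q | (f q.1, q.2) ∈ Φ.source}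
  have hO : IsOpen O := (isOpen_sliceDomain f t χ hfc p).inter
    (Φ.open_source.preimage ((hfc.comp continuous_fst).prodMk continuous_snd))
  have hpO : (p, f p) ∈ O := ⟨mem_sliceDomain f t χ p, hp⟩
  -- The first component is the foot point on `F` from which `y` is reached by a normal vector; the
  -- second is `y` itself.
  let h : B → F × B := fun y => Ψ.symm (y, 0)
  let V₁ : Set B := {y | (y, (0 : Fin k → ℝ)) ∈ Ψ.target}
  have hV₁ : IsOpen V₁ := Ψ.open_target.preimage (by fun_prop)
  have hh : ContMDiffOn (𝓡 n) ((𝓡 k).prod (𝓡 n)) ∞ h V₁ :=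
    ContMDiffOn.comp (g := Ψ.symm) Ψ.contMDiffOn_invFun
      (contMDiff_id.prodMk contMDiff_const).contMDiffOn fun y hy => hy
  have hslice : ∀ y ∈ V₁, sliceMap k f g t χ p (h y) = (y, 0) := by
    intro y hy
    have h1 : h y ∈ Ψ.source := Ψ.map_target hy
    rw [hΨ h1]
    exact Ψ.right_inv hy
  have hzero : Φ (f p, f p) = ⟨f p, 0⟩ := by
    rw [← hΦ hp]
    exact congrArg (Bundle.TotalSpace.mk (f p)) (bumpLog_self t χ (f p))
  obtain ⟨U₁, hU₁, V₂, hV₂, hUV⟩ := mem_nhds_prod_iff.1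
    ((Ψ.open_source.inter hO).mem_nhds ⟨hpΨ, hpO⟩)
  obtain ⟨V₃, hV₃, hV₃o, hpV₃⟩ := mem_nhds_iff.1 hV₂
  -- A vector in `W` controls only the image `f x` of its foot point. As `f` is an embedding,
  -- closeness of `f x` to `f p` forces `x` into the given neighbourhood of `p`.
  rw [hf.isEmbedding.isInducing.nhds_eq_comap] at hU₁
  obtain ⟨U₂, hU₂, hU₂₁⟩ := hU₁
  obtain ⟨U₃, hU₃, hU₃o, hpU₃⟩ := mem_nhds_iff.1 hU₂
  refine ⟨fun y => Φ (f (h y).1, (h y).2), V₁ ∩ h ⁻¹' O, Φ.target ∩ Φ.symm ⁻¹' (U₃ ×ˢ V₃),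
    hh.continuousOn.isOpen_inter_preimage hV₁ hO,
    Φ.contMDiffOn_invFun.continuousOn.isOpen_inter_preimage Φ.open_target (hU₃o.prod hV₃o),
    ?_, inter_subset_left, ?_, ?_, ?_⟩
  · rw [← hzero]
    refine ⟨Φ.map_source hp, ?_⟩
    have : Φ.symm (Φ (f p, f p)) = (f p, f p) := Φ.left_inv hp
    rw [mem_preimage, this]
    exact ⟨hpU₃, hpV₃⟩
  · have h1 : ContMDiffOn (𝓡 n) ((𝓡 n).prod (𝓡 n)) ∞ (fun y => (f (h y).1, (h y).2))
        (V₁ ∩ h ⁻¹' O) := by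
      have h2 : ContMDiff ((𝓡 k).prod (𝓡 n)) ((𝓡 n).prod (𝓡 n)) ∞
          (fun q : F × B => (f q.1, q.2)) :=
        (hfs.comp contMDiff_fst).prodMk contMDiff_snd
      exact h2.comp_contMDiffOn (hh.mono inter_subset_left)
    exact ContMDiffOn.comp (g := Φ) Φ.contMDiffOn_toFun h1 fun y hy => hy.2.2
  · rintro ξ ⟨hξ, hξUV⟩ hξν
    obtain ⟨x, ν, hξx, -⟩ := id hξν
    obtain ⟨⟨b, y⟩, hby⟩ : ∃ q, Φ.symm ξ = q := ⟨_, rfl⟩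
    rw [mem_preimage, hby] at hξUV
    have hbyΦ : (b, y) ∈ Φ.source := hby ▸ Φ.map_target hξ
    have hΦby : bumpLogMap t χ (b, y) = ξ := by
      rw [hΦ hbyΦ, ← hby]
      exact Φ.right_inv hξ
    obtain rfl : b = f x := (congrArg Bundle.TotalSpace.proj hΦby).trans
      (congrArg Bundle.TotalSpace.proj hξx)
    have hxy : (x, y) ∈ Ψ.source ∩ O := hUV ⟨hU₂₁ (hU₃ hξUV.1), hV₃ hξUV.2⟩
    have hpair : framePairing k f g t χ p (x, y) = 0 := by
      funext j
      rw [← hΦby] at hξν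
      exact inner_frame_eq_zero_of_mem_normalBundle hf.isEmbedding.injective hξν _
    have hΨxy : Ψ (x, y) = (y, 0) := by
      rw [← hΨ hxy.1]
      exact Prod.ext rfl hpair
    have hy₁ : y ∈ V₁ := by
      change (y, (0 : Fin k → ℝ)) ∈ Ψ.target
      rw [← hΨxy]
      exact Ψ.map_source hxy.1
    have hhy : h y = (x, y) := by
      change Ψ.symm (y, 0) = (x, y)
      rw [← hΨxy]
      exact Ψ.left_inv hxy.1
    rw [hby]
    change y ∈ V₁ ∩ h ⁻¹' O ∧ Φ (f (h y).1, (h y).2) = ξ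
    refine ⟨⟨hy₁, ?_⟩, ?_⟩
    · rw [mem_preimage, hhy]
      exact hxy.2
    · rw [hhy]
      rw [← hΦ hbyΦ, hΦby]
  · rintro y ⟨hy₁, hyO⟩
    have h1 := hslice y hy₁
    have h2 : (h y).2 = y := congrArg Prod.fst h1
    have h3 : framePairing k f g t χ p (h y) = 0 := congrArg Prod.snd h1
    refine ⟨?_, ?_⟩
    · change Φ (f (h y).1, (h y).2) ∈ _
      rw [← hΦ hyO.2]
      exact mk_mem_normalBundle_of_frame hyO.1.1 fun j => congrFun h3 j
    · have : Φ.symm (Φ (f (h y).1, (h y).2)) = (f (h y).1, (h y).2) := Φ.left_inv hyO.2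
      exact (congrArg Prod.snd this).trans h2

omit [T2Space B] [IsManifold (𝓡 k) ∞ F] in
theorem fibreSmul_mem_normalBundle {f : F → B} {g : SmoothMetric n B} (s : ℝ)
    {ξ : TangentBundle (𝓡 n) B} (hξ : ξ ∈ normalBundle k f g) :
    fibreSmul s ξ ∈ normalBundle k f g := by
  obtain ⟨p, ν, rfl, h⟩ := hξ
  refine ⟨p, s • ν, rfl, fun τ => ?_⟩
  rw [map_smul, h τ, smul_zero]

omit [T2Space B] [IsManifold (𝓡 n) ∞ B] in
theorem fibreSmul_fibreSmul_inv {s : ℝ} (hs : s ≠ 0) (ξ : TangentBundle (𝓡 n) B) :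
    fibreSmul s (fibreSmul s⁻¹ ξ) = ξ :=
  congrArg (Bundle.TotalSpace.mk ξ.proj) (smul_inv_smul₀ hs ξ.snd)

omit [T2Space B] [IsManifold (𝓡 n) ∞ B] in
theorem fibreSmul_inv_fibreSmul {s : ℝ} (hs : s ≠ 0) (ξ : TangentBundle (𝓡 n) B) :
    fibreSmul s⁻¹ (fibreSmul s ξ) = ξ :=
  congrArg (Bundle.TotalSpace.mk ξ.proj) (inv_smul_smul₀ hs ξ.snd)

omit [T2Space B] [IsManifold (𝓡 k) ∞ F] in
theorem zero_mem_normalBundle (f : F → B) (g : SmoothMetric n B) (p : F) :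
    (⟨f p, 0⟩ : TangentBundle (𝓡 n) B) ∈ normalBundle k f g :=
  ⟨p, 0, rfl, fun _ => map_zero _⟩

omit [T2Space B] [IsManifold (𝓡 k) ∞ F] in
/-- For a neighbourhood `O` of the zero section, the disc bundle can be scaled into `O`. -/
theorem exists_fibreSmul_discBundle_subset {f : F → B} {g : SmoothMetric n B}
    (hD : IsCompact (discBundle k f g)) {O : Set (TangentBundle (𝓡 n) B)} (hO : IsOpen O)
    (h : ∀ p, (⟨f p, 0⟩ : TangentBundle (𝓡 n) B) ∈ O) :
    ∃ ε : ℝ, 0 < ε ∧ ∀ ξ ∈ discBundle k f g, fibreSmul ε ξ ∈ O := by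
  have hc : Continuous (fun p : ℝ × TangentBundle (𝓡 n) B => fibreSmul p.1 p.2) :=
    contMDiff_fibre_smul.continuous
  -- Scaling by `0` sends the compact disc bundle to the zero section inside `O`; the tube lemma
  -- extends this to all small scalars.
  obtain ⟨u, v, hu, hv, h0u, hDv, huv⟩ := generalized_tube_lemma (isCompact_singleton (x := (0 : ℝ)))
    hD (hO.preimage hc) (by
      rintro ⟨s, ξ⟩ ⟨rfl, hξ⟩
      obtain ⟨p, ν, rfl, -⟩ := hξ.1
      simpa [fibreSmul] using h p)
  obtain ⟨δ, hδ, hδu⟩ := Metric.isOpen_iff.1 hu 0 (h0u rfl)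
  refine ⟨δ / 2, half_pos hδ, fun ξ hξ => huv (a := (δ / 2, ξ)) ⟨hδu ?_, hDv hξ⟩⟩
  rw [mem_ball_zero_iff, Real.norm_of_nonneg (half_pos hδ).le]
  exact half_lt_self hδ

omit [T2Space B] [IsManifold (𝓡 k) ∞ F] in
-- Treated apart because the general construction uses a point of `B`, which may be empty when `F`
-- is.
theorem nonempty_tubularNeighborhood_of_isEmpty [IsEmpty F] (f : F → B) (g : SmoothMetric n B) :
    Nonempty (TubularNeighborhood k f g) := by
  have hN : normalBundle k f g = ∅ :=
    eq_empty_of_forall_notMem fun ξ ⟨p, _⟩ => isEmptyElim p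
  have hD : discBundle k f g = ∅ := by simp [discBundle, hN]
  have hO : openDiscBundle k f g = ∅ := by simp [openDiscBundle, hN]
  refine ⟨⟨Bundle.TotalSpace.proj, ?_, ?_, fun p => isEmptyElim p, ?_, ?_, ?_⟩⟩
  · rw [hD]; exact continuousOn_empty _
  · rw [hD]; exact injOn_empty _
  · rw [hO, image_empty]; exact isOpen_empty
  · rw [hO]; exact fun _ h => h.elim
  · refine ⟨fun y => ⟨y, 0⟩, ?_, ?_⟩
    · rw [hO, image_empty]; exact fun _ h => h.elim
    · rw [hO]; exact fun _ h => h.elim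

theorem nonempty_tubularNeighborhood [CompactSpace F] {f : F → B}
    (hf : IsSmoothEmbedding (𝓡 k) (𝓡 n) ∞ f) (g : SmoothMetric n B) :
    Nonempty (TubularNeighborhood k f g) := by
  rcases isEmpty_or_nonempty F with hF | ⟨⟨p₀⟩⟩
  · exact nonempty_tubularNeighborhood_of_isEmpty f g
  have : Nonempty B := ⟨f p₀⟩
  have : Nonempty (TangentBundle (𝓡 n) B) := ⟨⟨f p₀, 0⟩⟩
  have hfc : Continuous f := hf.contMDiff.continuous
  have hC : IsCompact (range f) := isCompact_range hfc
  obtain ⟨t, χ, ht⟩ := exists_bump_sum_ne_zero (n := n) hC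
  obtain ⟨Φ, hΦs, hΦ⟩ := exists_bumpLog_partialDiffeomorph hC ht
  choose ρ V W hV hW h0W hWΦ hρ hWV hVρ using fun p : F =>
    exists_local_inverse_normalBundle hf g hΦ (hΦs (f p) ⟨p, rfl⟩) (ht (f p) ⟨p, rfl⟩)
  let E : TangentBundle (𝓡 n) B → B := fun ξ => (Φ.symm ξ).2
  have hE : ContMDiffOn (𝓡 n).tangent (𝓡 n) ∞ E Φ.target :=
    contMDiff_snd.comp_contMDiffOn Φ.contMDiffOn_invFun
  have hE0 : ∀ p, E ⟨f p, 0⟩ = f p := by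
    intro p
    have h1 : Φ (f p, f p) = ⟨f p, 0⟩ := by
      rw [← hΦ (hΦs (f p) ⟨p, rfl⟩)]
      exact congrArg (Bundle.TotalSpace.mk (f p)) (bumpLog_self t χ (f p))
    have h2 : Φ.symm (Φ (f p, f p)) = (f p, f p) := Φ.left_inv (hΦs (f p) ⟨p, rfl⟩)
    rw [h1] at h2
    exact congrArg Prod.snd h2
  -- injectivity near the zero section
  obtain ⟨O, hO, h0O, hOE⟩ : ∃ O : Set (TangentBundle (𝓡 n) B), IsOpen O ∧
      (∀ p, (⟨f p, 0⟩ : TangentBundle (𝓡 n) B) ∈ O) ∧ InjOn E (O ∩ normalBundle k f g) := by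
    -- The endpoint map is shown injective only on normal vectors, so the compactness argument runs
    -- in the normal bundle as a topological subspace. Local injectivity comes from the left
    -- inverses `ρ p`.
    let ζ : F → normalBundle k f g := fun p => ⟨⟨f p, 0⟩, zero_mem_normalBundle f g p⟩
    have hζ : Continuous ζ := Continuous.subtype_mk
      ((Bundle.contMDiff_zeroSection (n := ∞) ℝ (IB := 𝓡 n)
        (TangentSpace (𝓡 n) (M := B))).continuous.comp hfc) _
    obtain ⟨O', hO', hζO', hinj⟩ := Set.InjOn.exists_isOpen_superset
      (f := fun ξ : normalBundle k f g => E ξ.1) (s := range ζ)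
      (by
        rintro _ ⟨p, rfl⟩ _ ⟨q, rfl⟩ h
        have : f p = f q := (hE0 p).symm.trans (h.trans (hE0 q))
        rw [hf.isEmbedding.injective this])
      (isCompact_range hζ)
      (by
        rintro _ ⟨p, rfl⟩
        have h1 : ContinuousAt E (ζ p).1 :=
          (hE.continuousOn _ (hWΦ p (h0W p))).continuousAt (Φ.open_target.mem_nhds
            (hWΦ p (h0W p)))
        exact ContinuousAt.comp (f := Subtype.val) h1 continuous_subtype_val.continuousAt)
      (by
        rintro _ ⟨p, rfl⟩
        refine ⟨Subtype.val ⁻¹' W p, ((hW p).preimage continuous_subtype_val).mem_nhds (h0W p), ?_⟩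
        intro ξ hξ η hη h
        refine Subtype.ext ?_
        rw [← (hWV p ξ.1 hξ ξ.2).2, ← (hWV p η.1 hη η.2).2]
        exact congrArg (ρ p) h)
    obtain ⟨O, hO, rfl⟩ := isOpen_induced_iff.1 hO'
    refine ⟨O, hO, fun p => hζO' ⟨p, rfl⟩, fun ξ hξ η hη h => ?_⟩
    exact congrArg Subtype.val (hinj (x₁ := ⟨ξ, hξ.2⟩) hξ.1 (x₂ := ⟨η, hη.2⟩) hη.1 h)
  obtain ⟨ε, hε, hεD⟩ := exists_fibreSmul_discBundle_subset (isCompact_discBundle hf g)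
    (hO.inter (isOpen_iUnion hW)) fun p => ⟨h0O p, mem_iUnion.2 ⟨p, h0W p⟩⟩
  have hsub : openDiscBundle k f g ⊆ discBundle k f g := fun ξ hξ => ⟨hξ.1, le_of_lt hξ.2⟩
  let T : TangentBundle (𝓡 n) B → B := fun ξ => E (fibreSmul ε ξ)
  have hT : ContMDiffOn (𝓡 n).tangent (𝓡 n) ∞ T (discBundle k f g) := by
    refine hE.comp (contMDiff_fibreSmul ε).contMDiffOn fun ξ hξ => ?_
    obtain ⟨p, hp⟩ := mem_iUnion.1 (hεD ξ hξ).2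
    exact hWΦ p hp
  have hTinj : InjOn T (discBundle k f g) := by
    intro ξ hξ η hη h
    have h1 := hOE ⟨(hεD ξ hξ).1, fibreSmul_mem_normalBundle ε hξ.1⟩
      ⟨(hεD η hη).1, fibreSmul_mem_normalBundle ε hη.1⟩ h
    rw [← fibreSmul_inv_fibreSmul hε.ne' ξ, h1, fibreSmul_inv_fibreSmul hε.ne']
  -- local inverses of `T`
  have hloc : ∀ ξ ∈ openDiscBundle k f g, ∃ (p : F) (V' : Set B), IsOpen V' ∧ T ξ ∈ V' ∧
      V' ⊆ V p ∧ ∀ y ∈ V', fibreSmul ε⁻¹ (ρ p y) ∈ openDiscBundle k f g ∧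
        T (fibreSmul ε⁻¹ (ρ p y)) = y := by
    intro ξ hξ
    obtain ⟨p, hp⟩ := mem_iUnion.1 (hεD ξ (hsub hξ)).2
    obtain ⟨h1, h2⟩ := hWV p _ hp (fibreSmul_mem_normalBundle ε hξ.1)
    let Q : TangentBundle (𝓡 n) B → ℝ := fun η =>
      g.inner (fibreSmul ε⁻¹ η).proj (fibreSmul ε⁻¹ η).snd (fibreSmul ε⁻¹ η).snd
    have hQ : Continuous Q := (continuous_metric_self g).comp (contMDiff_fibreSmul ε⁻¹).continuous
    refine ⟨p, V p ∩ ρ p ⁻¹' (Q ⁻¹' Iio 1),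
      (hρ p).continuousOn.isOpen_inter_preimage (hV p) (isOpen_Iio.preimage hQ),
      ⟨h1, ?_⟩, inter_subset_left, ?_⟩
    · rw [mem_preimage]
      have h3 : ρ p (T ξ) = fibreSmul ε ξ := h2
      rw [h3]
      change g.inner (fibreSmul ε⁻¹ (fibreSmul ε ξ)).proj (fibreSmul ε⁻¹ (fibreSmul ε ξ)).snd
        (fibreSmul ε⁻¹ (fibreSmul ε ξ)).snd < 1
      rw [fibreSmul_inv_fibreSmul hε.ne']
      exact hξ.2
    · rintro y ⟨hy, hyQ⟩
      obtain ⟨h3, h4⟩ := hVρ p y hy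
      refine ⟨⟨fibreSmul_mem_normalBundle _ h3, hyQ⟩, ?_⟩
      change E (fibreSmul ε (fibreSmul ε⁻¹ (ρ p y))) = y
      rw [fibreSmul_fibreSmul_inv hε.ne']
      exact h4
  have hr : ∀ ξ ∈ openDiscBundle k f g, Function.invFunOn T (openDiscBundle k f g) (T ξ) = ξ :=
    fun ξ hξ => (hTinj.mono hsub).leftInvOn_invFunOn hξ
  refine ⟨⟨T, hT.continuousOn, hTinj, fun p => ?_, ?_, hT.mono hsub,
    Function.invFunOn T (openDiscBundle k f g), ?_, hr⟩⟩
  · change E ⟨f p, ε • (0 : TangentSpace (𝓡 n) (f p))⟩ = f p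
    rw [smul_zero]
    exact hE0 p
  · refine isOpen_iff_mem_nhds.2 ?_
    rintro _ ⟨ξ, hξ, rfl⟩
    obtain ⟨p, V', hV', hξV', -, h⟩ := hloc ξ hξ
    exact Filter.mem_of_superset (hV'.mem_nhds hξV') fun y hy => ⟨_, (h y hy).1, (h y hy).2⟩
  · rintro _ ⟨ξ, hξ, rfl⟩
    obtain ⟨p, V', hV', hξV', hVV', h⟩ := hloc ξ hξ
    have h1 : ContMDiffAt (𝓡 n) (𝓡 n).tangent ∞ (fun y => fibreSmul ε⁻¹ (ρ p y)) (T ξ) :=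
      ((contMDiff_fibreSmul ε⁻¹).comp_contMDiffOn (hρ p)).contMDiffAt
        ((hV p).mem_nhds (hVV' hξV'))
    -- Injectivity of `T` forces the global set-theoretic inverse to agree near `T ξ` with the
    -- rescaled smooth local inverse `ρ p`.
    refine (h1.congr_of_eventuallyEq ?_).contMDiffWithinAt
    filter_upwards [hV'.mem_nhds hξV'] with y hy
    obtain ⟨h2, h3⟩ := h y hy
    have h4 := hr _ h2
    rwa [h3] at h4

end Tubular

/-! ### The collapse map -/

section Collapse

variable {n k : ℕ} {B : Type u} [TopologicalSpace B]
  [ChartedSpace (EuclideanSpace ℝ (Fin n)) B] [IsManifold (𝓡 n) ∞ B]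
  {F : Type v} [TopologicalSpace F] [ChartedSpace (EuclideanSpace ℝ (Fin k)) F]
  {f : F → B} {g : SmoothMetric n B}

theorem openDiscBundle_subset : openDiscBundle k f g ⊆ discBundle k f g :=
  fun _ hξ => ⟨hξ.1, le_of_lt hξ.2⟩

theorem mem_openDiscBundle_of_notMem {ξ : TangentBundle (𝓡 n) B} (hξ : ξ ∈ discBundle k f g)
    (h : ξ ∉ sphereBundle k f g) : ξ ∈ openDiscBundle k f g :=
  ⟨hξ.1, lt_of_le_of_ne hξ.2 fun h' => h ⟨hξ.1, h'⟩⟩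

theorem notMem_sphereBundle {ξ : TangentBundle (𝓡 n) B} (hξ : ξ ∈ openDiscBundle k f g) :
    ξ ∉ sphereBundle k f g :=
  fun h => hξ.2.ne h.2

theorem zero_mem_openDiscBundle (p : F) :
    (⟨f p, 0⟩ : TangentBundle (𝓡 n) B) ∈ openDiscBundle k f g :=
  ⟨zero_mem_normalBundle f g p, by simp⟩

/-! ### Points and topology of the Thom space. -/

namespace ThomSpace

theorem ofDisc_eq_base {ξ : discBundle k f g} (hξ : ξ.1 ∈ sphereBundle k f g) :
    (ofDisc ξ : ThomSpace k f g) = base :=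
  Quot.sound ⟨ξ, hξ, rfl, rfl⟩

open Classical in
/-- The point of the open disc bundle over a point of the Thom space, if there is one. -/
def interior : ThomSpace k f g → Option (discBundle k f g) :=
  Quot.lift (Sum.elim (fun ξ => if ξ.1 ∈ sphereBundle k f g then none else some ξ)
    (fun _ => none)) (by
      rintro a b ⟨ξ, hξ, rfl, rfl⟩
      simp [hξ])

theorem interior_base : interior (base : ThomSpace k f g) = none := rfl

theorem interior_ofDisc {ξ : discBundle k f g} (hξ : ξ.1 ∈ openDiscBundle k f g) :
    interior (ofDisc ξ) = some ξ :=
  if_neg (notMem_sphereBundle hξ)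

theorem ofDisc_ne_base {ξ : discBundle k f g} (hξ : ξ.1 ∈ openDiscBundle k f g) :
    (ofDisc ξ : ThomSpace k f g) ≠ base := by
  intro h
  have := congrArg interior h
  rw [interior_ofDisc hξ, interior_base] at this
  exact Option.some_ne_none _ this

theorem ofDisc_inj {ξ η : discBundle k f g} (hη : η.1 ∈ openDiscBundle k f g)
    (h : (ofDisc ξ : ThomSpace k f g) = ofDisc η) : ξ = η := by
  by_cases hξ : ξ.1 ∈ sphereBundle k f g
  · rw [ofDisc_eq_base hξ] at h
    exact absurd h.symm (ofDisc_ne_base hη)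
  · have h1 := congrArg interior h
    rw [interior_ofDisc (mem_openDiscBundle_of_notMem ξ.2 hξ), interior_ofDisc hη] at h1
    exact Option.some_injective _ h1

theorem continuous_ofDisc : Continuous (ofDisc : discBundle k f g → ThomSpace k f g) :=
  continuous_quot_mk.comp continuous_inl

/-- In the disjoint union before the quotient the added point is isolated, so openness is decided on
the disc bundle alone, here and in the companion for sets containing the base point. -/
theorem isOpen_iff_of_base_notMem {U : Set (ThomSpace k f g)} (hU : base ∉ U) :
    IsOpen U ↔ IsOpen ((ofDisc : discBundle k f g → ThomSpace k f g) ⁻¹' U) := by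
  refine ⟨fun h => h.preimage continuous_ofDisc, fun h => ?_⟩
  refine isQuotientMap_quot_mk.isOpen_preimage.1 (isOpen_sum_iff.2 ⟨h, ?_⟩)
  have : Sum.inr ⁻¹' (Quot.mk _ ⁻¹' U) = (∅ : Set Unit) :=
    eq_empty_of_forall_notMem fun _ h => hU h
  rw [this]
  exact isOpen_empty

theorem isOpen_iff_of_base_mem {U : Set (ThomSpace k f g)} (hU : base ∈ U) :
    IsOpen U ↔ IsOpen ((ofDisc : discBundle k f g → ThomSpace k f g) ⁻¹' U) := by
  refine ⟨fun h => h.preimage continuous_ofDisc, fun h => ?_⟩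
  refine isQuotientMap_quot_mk.isOpen_preimage.1 (isOpen_sum_iff.2 ⟨h, ?_⟩)
  have : Sum.inr ⁻¹' (Quot.mk _ ⁻¹' U) = (univ : Set Unit) := eq_univ_of_forall fun _ => hU
  rw [this]
  exact isOpen_univ

end ThomSpace

/-! ### Continuity and compatibility of the collapse maps. -/

namespace TubularNeighborhood

variable (T : TubularNeighborhood k f g) {Bt : Type w} {i : B → Bt}

theorem collapse_apply (hi : Function.Injective i) (ξ : discBundle k f g) :
    T.collapse i (i (T.toFun ξ.1)) = ThomSpace.ofDisc ξ := by
  have h : ∃ η : discBundle k f g, i (T.toFun η.1) = i (T.toFun ξ.1) := ⟨ξ, rfl⟩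
  rw [collapse, dif_pos h]
  exact congrArg _ (Subtype.ext (T.injOn h.choose.2 ξ.2 (hi h.choose_spec)))

theorem collapse_of_forall_ne {x : Bt} (hx : ∀ ξ : discBundle k f g, i (T.toFun ξ.1) ≠ x) :
    T.collapse i x = ThomSpace.base :=
  dif_neg fun ⟨ξ, h⟩ => hx ξ h

theorem collapse_zero_section (hi : Function.Injective i) (p : F) :
    T.collapse i (i (f p)) =
      ThomSpace.ofDisc ⟨⟨f p, 0⟩, openDiscBundle_subset (zero_mem_openDiscBundle p)⟩ := by
  rw [← T.collapse_apply hi, T.zero_section]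

/-- A point of `Bt` that collapses to an interior point of the disc bundle. -/
theorem eq_of_collapse_eq_ofDisc (hi : Function.Injective i) {x : Bt} {ξ : discBundle k f g}
    (hξ : ξ.1 ∈ openDiscBundle k f g) (h : T.collapse i x = ThomSpace.ofDisc ξ) :
    x = i (T.toFun ξ.1) := by
  by_cases hx : ∃ η : discBundle k f g, i (T.toFun η.1) = x
  · obtain ⟨η, rfl⟩ := hx
    rw [T.collapse_apply hi] at h
    rw [ThomSpace.ofDisc_inj hξ h]
  · rw [T.collapse_of_forall_ne fun η hη => hx ⟨η, hη⟩] at h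
    exact absurd h.symm (ThomSpace.ofDisc_ne_base hξ)

/-- The preimage of a closed set is the image in `Bt` of a compact part of the disc bundle, enlarged
by the closed complement of `N(F)` when the base point belongs to the set. Compact images are closed
since `Bt` is Hausdorff. -/
theorem continuous_collapse [TopologicalSpace Bt] [T2Space Bt] (hD : IsCompact (discBundle k f g))
    (hi : IsOpenEmbedding i) : Continuous (T.collapse i) := by
  have hcomp : CompactSpace (discBundle k f g) := isCompact_iff_compactSpace.1 hD
  let τ : discBundle k f g → Bt := fun ξ => i (T.toFun ξ.1)
  have hτ : Continuous τ := hi.continuous.comp (continuousOn_iff_continuous_domRestrict.1 T.continuousOn)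
  have hopen : IsOpen (i '' (T.toFun '' openDiscBundle k f g)) := hi.isOpenMap _ T.isOpen_image
  have hbase : ∀ x ∉ i '' (T.toFun '' openDiscBundle k f g), T.collapse i x = ThomSpace.base := by
    intro x hx
    by_cases h : ∃ ξ : discBundle k f g, i (T.toFun ξ.1) = x
    · obtain ⟨ξ, rfl⟩ := h
      rw [T.collapse_apply hi.injective]
      refine ThomSpace.ofDisc_eq_base (by_contra fun hξ => hx ?_)
      exact ⟨_, ⟨ξ.1, mem_openDiscBundle_of_notMem ξ.2 hξ, rfl⟩, rfl⟩
    · exact T.collapse_of_forall_ne fun ξ hξ => h ⟨ξ, hξ⟩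
  refine continuous_iff_isClosed.2 fun C hC => ?_
  have h1 : IsClosed (τ '' (ThomSpace.ofDisc ⁻¹' C)) :=
    ((hC.preimage ThomSpace.continuous_ofDisc).isCompact.image hτ).isClosed
  have h2 : τ '' (ThomSpace.ofDisc ⁻¹' C) ⊆ T.collapse i ⁻¹' C := by
    rintro _ ⟨ξ, hξ, rfl⟩
    rw [mem_preimage, T.collapse_apply hi.injective]
    exact hξ
  by_cases hb : ThomSpace.base ∈ C
  · have : T.collapse i ⁻¹' C =
        τ '' (ThomSpace.ofDisc ⁻¹' C) ∪ (i '' (T.toFun '' openDiscBundle k f g))ᶜ := by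
      refine Subset.antisymm (fun x hx => ?_) (union_subset h2 fun x hx => ?_)
      · by_cases hx' : x ∈ i '' (T.toFun '' openDiscBundle k f g)
        · obtain ⟨_, ⟨ξ, hξ, rfl⟩, rfl⟩ := hx'
          refine Or.inl ⟨⟨ξ, openDiscBundle_subset hξ⟩, ?_, rfl⟩
          rw [mem_preimage, ← T.collapse_apply hi.injective]
          exact hx
        · exact Or.inr hx'
      · rw [mem_preimage, hbase x hx]
        exact hb
    rw [this]
    exact h1.union hopen.isClosed_compl
  · have : T.collapse i ⁻¹' C = τ '' (ThomSpace.ofDisc ⁻¹' C) := by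
      refine Subset.antisymm (fun x hx => ?_) h2
      by_cases hx' : x ∈ i '' (T.toFun '' openDiscBundle k f g)
      · obtain ⟨_, ⟨ξ, hξ, rfl⟩, rfl⟩ := hx'
        refine ⟨⟨ξ, openDiscBundle_subset hξ⟩, ?_, rfl⟩
        rw [mem_preimage, ← T.collapse_apply hi.injective]
        exact hx
      · rw [mem_preimage, hbase x hx'] at hx
        exact absurd hx hb
    rw [this]
    exact h1

/-- The collapse maps of two compactifications are compatible. -/
theorem collapse_comp {Bt' : Type*} {i' : B → Bt'} (hi : Function.Injective i)
    (hi' : Function.Injective i') {h : Bt → Bt'} (hh : ∀ b, h (i b) = i' b)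
    (hout : ∀ x, x ∉ range i → h x ∉ range i') (x : Bt) :
    T.collapse i' (h x) = T.collapse i x := by
  by_cases hx : x ∈ range i
  · obtain ⟨b, rfl⟩ := hx
    rw [hh]
    by_cases hb : ∃ ξ : discBundle k f g, T.toFun ξ.1 = b
    · obtain ⟨ξ, rfl⟩ := hb
      rw [T.collapse_apply hi, T.collapse_apply hi']
    · rw [T.collapse_of_forall_ne fun ξ hξ => hb ⟨ξ, hi hξ⟩,
        T.collapse_of_forall_ne fun ξ hξ => hb ⟨ξ, hi' hξ⟩]
  · rw [T.collapse_of_forall_ne fun ξ hξ => hx ⟨_, hξ⟩,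
      T.collapse_of_forall_ne fun ξ hξ => hout x hx ⟨_, hξ⟩]

/-! ### The open tubular neighbourhood as an open subset of the Thom space. -/

/-- The open tubular neighbourhood `N(F)`. -/
def openNbhd : Set B := T.toFun '' openDiscBundle k f g

theorem range_subset_openNbhd : range f ⊆ T.openNbhd := by
  rintro _ ⟨p, rfl⟩
  exact ⟨_, zero_mem_openDiscBundle p, T.zero_section p⟩

theorem injOn_collapse_id : InjOn (T.collapse id) T.openNbhd := by
  rintro _ ⟨ξ, hξ, rfl⟩ _ ⟨η, hη, rfl⟩ h
  have h1 := T.collapse_apply Function.injective_id ⟨η, openDiscBundle_subset hη⟩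
  exact T.eq_of_collapse_eq_ofDisc Function.injective_id hη (h.trans h1)

theorem base_notMem_image_collapse_id {U : Set B} (hU : U ⊆ T.openNbhd) :
    ThomSpace.base ∉ T.collapse id '' U := by
  rintro ⟨x, hx, h⟩
  obtain ⟨ξ, hξ, rfl⟩ := hU hx
  have h1 := T.collapse_apply Function.injective_id ⟨ξ, openDiscBundle_subset hξ⟩
  exact ThomSpace.ofDisc_ne_base (ξ := ⟨ξ, openDiscBundle_subset hξ⟩) hξ (h1.symm.trans h)

theorem ofDisc_preimage_image_collapse_id {U : Set B} (hU : U ⊆ T.openNbhd) :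
    ThomSpace.ofDisc ⁻¹' (T.collapse id '' U) = {ξ : discBundle k f g | T.toFun ξ.1 ∈ U} := by
  ext ξ
  constructor
  · rintro ⟨x, hx, h⟩
    obtain ⟨η, hη, rfl⟩ := hU hx
    have h1 := T.collapse_apply Function.injective_id ⟨η, openDiscBundle_subset hη⟩
    have h2 := ThomSpace.ofDisc_inj (ξ := ξ) (η := ⟨η, openDiscBundle_subset hη⟩) hη
      (h.symm.trans h1)
    rw [h2]
    exact hx
  · intro h
    exact ⟨_, h, T.collapse_apply Function.injective_id ξ⟩

theorem continuous_restrict : Continuous (fun ξ : discBundle k f g => T.toFun ξ.1) :=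
  continuousOn_iff_continuous_domRestrict.1 T.continuousOn

theorem isOpen_image_collapse_id {U : Set B} (hU : U ⊆ T.openNbhd) (hUo : IsOpen U) :
    IsOpen (T.collapse id '' U) := by
  rw [ThomSpace.isOpen_iff_of_base_notMem (T.base_notMem_image_collapse_id hU),
    T.ofDisc_preimage_image_collapse_id hU]
  exact hUo.preimage T.continuous_restrict

/-- Makes the complement of the zero section open in the Thom space, as excision requires, without
invoking a Hausdorff property there. -/
theorem isClosed_image_collapse_id {C : Set B} (hC : C ⊆ T.openNbhd) (hCc : IsClosed C) :
    IsClosed (T.collapse id '' C) := by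
  rw [← isOpen_compl_iff, ThomSpace.isOpen_iff_of_base_mem (T.base_notMem_image_collapse_id hC),
    preimage_compl, T.ofDisc_preimage_image_collapse_id hC]
  exact (hCc.preimage T.continuous_restrict).isOpen_compl

theorem isOpenEmbedding_collapse_id [T2Space B] (hD : IsCompact (discBundle k f g)) :
    IsOpenEmbedding (fun x : T.openNbhd => T.collapse id x.1) := by
  refine .of_continuous_injective_isOpenMap
    ((T.continuous_collapse hD IsOpenEmbedding.id).comp continuous_subtype_val)
    (fun x y h => Subtype.ext (T.injOn_collapse_id x.2 y.2 h)) fun U hU => ?_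
  have h1 : (fun x : T.openNbhd => T.collapse id x.1) '' U =
      T.collapse id '' (Subtype.val '' U) := (image_image _ _ _).symm
  rw [h1]
  exact T.isOpen_image_collapse_id (by rintro _ ⟨x, _, rfl⟩; exact x.2)
    (T.isOpen_image.isOpenMap_subtype_val _ hU)

theorem range_collapse_id_union (S : Set B) (hS : S ⊆ T.openNbhd) :
    range (fun x : T.openNbhd => T.collapse id x.1) ∪ (T.collapse id '' S)ᶜ = univ := by
  refine eq_univ_of_forall fun y => ?_
  by_cases hy : y ∈ T.collapse id '' S
  · obtain ⟨x, hx, rfl⟩ := hy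
    exact Or.inl ⟨⟨x, hS hx⟩, rfl⟩
  · exact Or.inr hy

/-- Each point of the open disc bundle has exactly one preimage under the collapse map, so only `F`
collapses to the zero section. -/
theorem mapsTo_collapse_compl (hi : Function.Injective i) :
    MapsTo (T.collapse i) (i '' range f)ᶜ (T.collapse id '' range f)ᶜ := by
  rintro x hx ⟨_, ⟨p, rfl⟩, h⟩
  refine hx ⟨f p, ⟨p, rfl⟩, ?_⟩
  have h1 := T.collapse_zero_section Function.injective_id p
  have h2 := T.eq_of_collapse_eq_ofDisc hi (zero_mem_openDiscBundle p) (h.symm.trans h1)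
  rw [h2, T.zero_section]

end TubularNeighborhood

end Collapse

/-! ### The homomorphism to the cohomology of the Thom space -/

section Psi

theorem bijective_excisionMap (m : ℕ) {B : Type u} [TopologicalSpace B] {Bt : Type w}
    [TopologicalSpace Bt] [T2Space Bt] (i : C(B, Bt)) (hi : IsOpenEmbedding i) {S : Set B}
    (hS : IsCompact S) : Function.Bijective (excisionMap (m + 1) i hi.injective S) := by
  refine bijective_pullback_of_isOpenEmbedding m hi (hS.image i.continuous).isClosed.isOpen_compl
    ?_ ?_ _
  · refine eq_univ_of_forall fun x => ?_
    by_cases hx : x ∈ i '' S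
    · exact Or.inl (image_subset_range _ _ hx)
    · exact Or.inr hx
  · rw [preimage_compl, preimage_image_eq S hi.injective]

variable {n k : ℕ} {B : Type u} [TopologicalSpace B] [T2Space B]
  [ChartedSpace (EuclideanSpace ℝ (Fin n)) B] [IsManifold (𝓡 n) ∞ B]
  {F : Type v} [TopologicalSpace F] [CompactSpace F] [ChartedSpace (EuclideanSpace ℝ (Fin k)) F]
  {f : F → B} {g : SmoothMetric n B}

/-- All comparisons take place on the open tubular neighbourhood, which is excisive in both `Bt` and
the Thom space. -/
theorem exists_hom_cohomology_thomSpace (m : ℕ) (hf : Continuous f)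
    (T : TubularNeighborhood k f g) (hD : IsCompact (discBundle k f g)) :
    ∃ ψ : RelCohomology (m + 1) B (range f)ᶜ →+ Cohomology (m + 1) (ThomSpace k f g),
      ∀ (Bt : Type w) [TopologicalSpace Bt] [T2Space Bt] (i : C(B, Bt)) (hi : IsOpenEmbedding i)
        (hexc : Function.Bijective (excisionMap (m + 1) i hi.injective (range f)))
        (hcont : Continuous (T.collapse i)),
        extensionMap (m + 1) i hi.injective (range f) hexc =
          (Cohomology.pullback (m + 1) ⟨T.collapse i, hcont⟩).comp ψ := by
  have hC : IsCompact (range f) := isCompact_range hf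
  have hFN := T.range_subset_openNbhd
  let F' : Set (ThomSpace k f g) := T.collapse id '' range f
  have hF' : IsClosed F' := T.isClosed_image_collapse_id hFN hC.isClosed
  let A : Set T.openNbhd := Subtype.val ⁻¹' (range f)ᶜ
  let j₁ : C(T.openNbhd, B) := ⟨Subtype.val, continuous_subtype_val⟩
  let j₂ : C(T.openNbhd, ThomSpace k f g) :=
    ⟨fun x => T.collapse id x.1, (T.isOpenEmbedding_collapse_id hD).continuous⟩
  have hj₁ : MapsTo j₁ A (range f)ᶜ := fun x hx => hx
  have hA : A = j₂ ⁻¹' F'ᶜ := by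
    ext x
    refine not_congr ⟨fun hx => ⟨x.1, hx, rfl⟩, ?_⟩
    rintro ⟨y, hy, hyx⟩
    have : y = x.1 := T.injOn_collapse_id (hFN hy) x.2 hyx
    exact this ▸ hy
  have hj₂ : MapsTo j₂ A F'ᶜ := fun x hx => by rw [hA] at hx; exact hx
  have hexc₂ : Function.Bijective (RelCohomology.pullback (m + 1) j₂ hj₂) :=
    bijective_pullback_of_isOpenEmbedding m (T.isOpenEmbedding_collapse_id hD) hF'.isOpen_compl
      (T.range_collapse_id_union _ hFN) hA hj₂
  let e₂ := AddEquiv.ofBijective (RelCohomology.pullback (m + 1) j₂ hj₂) hexc₂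
  refine ⟨((RelCohomology.toAbsolute (m + 1) F'ᶜ).comp e₂.symm.toAddMonoidHom).comp
    (RelCohomology.pullback (m + 1) j₁ hj₁), ?_⟩
  intro Bt _ _ i hi hexc hcont
  let V : Set Bt := (i '' range f)ᶜ
  let lam : C(Bt, ThomSpace k f g) := ⟨T.collapse i, hcont⟩
  have hlam : MapsTo lam V F'ᶜ := T.mapsTo_collapse_compl hi.injective
  have hi' : MapsTo i (range f)ᶜ V := fun _ hx hx' => hx (hi.injective.mem_set_image.1 hx')
  -- excision for the composite inclusion of the tubular neighbourhood
  have hij : MapsTo (i.comp j₁) A V := hi'.comp hj₁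
  have hNo : IsOpenEmbedding j₁ := T.isOpen_image.isOpenEmbedding_subtypeVal
  have hijo : IsOpenEmbedding (i.comp j₁) := by
    rw [ContinuousMap.coe_comp]
    exact IsOpenEmbedding.comp hi hNo
  have hexc₁ : Function.Bijective (RelCohomology.pullback (m + 1) (i.comp j₁) hij) := by
    refine bijective_pullback_of_isOpenEmbedding m hijo
      (hC.image i.continuous).isClosed.isOpen_compl ?_ ?_ hij
    · refine eq_univ_of_forall fun x => ?_
      by_cases hx : x ∈ i '' range f
      · obtain ⟨b, hb, rfl⟩ := hx
        exact Or.inl ⟨⟨b, hFN hb⟩, rfl⟩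
      · exact Or.inr hx
    · ext x
      exact not_congr (hi.injective.mem_set_image (s := range f) (a := x.1)).symm
  have hcomp : (lam.comp (i.comp j₁)) = j₂ := by
    refine ContinuousMap.ext fun x => ?_
    exact T.collapse_comp (i := id) (i' := i) Function.injective_id hi.injective
      (h := i) (fun _ => rfl) (fun x hx => absurd ⟨x, rfl⟩ hx) x.1
  refine AddMonoidHom.ext fun x => ?_
  obtain ⟨z, rfl⟩ := hexc.2 x
  have hz : (AddEquiv.ofBijective (excisionMap (m + 1) i hi.injective (range f)) hexc).symm
      (excisionMap (m + 1) i hi.injective (range f) z) = z :=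
    (AddEquiv.ofBijective (excisionMap (m + 1) i hi.injective (range f)) hexc).symm_apply_apply z
  set y := e₂.symm (RelCohomology.pullback (m + 1) j₁ hj₁
    (excisionMap (m + 1) i hi.injective (range f) z)) with hy
  have hy' : RelCohomology.pullback (m + 1) j₂ hj₂ y = RelCohomology.pullback (m + 1) j₁ hj₁
      (RelCohomology.pullback (m + 1) i hi' z) := e₂.apply_symm_apply _
  -- Excision reduces the equality to the tubular neighbourhood, where the collapse map is `j₂` and
  -- `y` was chosen to restrict to the same class as `z`.
  have hkey : RelCohomology.pullback (m + 1) lam hlam y = z := by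
    refine hexc₁.1 ?_
    have hm : MapsTo (lam.comp (i.comp j₁)) A F'ᶜ := hlam.comp hij
    rw [RelCohomology.pullback_comp (m + 1) (i.comp j₁) lam hij hlam hm,
      ← RelCohomology.pullback_comp (m + 1) j₁ i hj₁ hi' hij, ← hy']
    congr 1
    simp only [hcomp]
  change RelCohomology.toAbsolute (m + 1) V
      ((AddEquiv.ofBijective (excisionMap (m + 1) i hi.injective (range f)) hexc).symm
        (excisionMap (m + 1) i hi.injective (range f) z)) =
    Cohomology.pullback (m + 1) lam (RelCohomology.toAbsolute (m + 1) F'ᶜ y)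
  -- What remains is that forgetting the subspace commutes with pull-back along the collapse map.
  rw [hz, ← hkey]
  have hmV : MapsTo (lam.comp (ContinuousMap.id Bt)) (∅ : Set Bt) F'ᶜ := mapsTo_empty _ _
  exact (RelCohomology.pullback_comp (m + 1) (ContinuousMap.id Bt) lam (mapsTo_empty _ _) hlam hmV
    y).trans (RelCohomology.pullback_comp (m + 1) lam (ContinuousMap.id _) (mapsTo_empty _ _)
      (mapsTo_empty _ _) (mapsTo_empty _ _) y).symm

end Psi

end

/-! ### Assembly of the statements. -/

theorem lemma4p4 {n k : ℕ}
    {B : Type u} [TopologicalSpace B] [T2Space B] [SecondCountableTopology B]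
    [ChartedSpace (EuclideanSpace ℝ (Fin n)) B] [IsManifold (𝓡 n) ∞ B]
    {F : Type v} [TopologicalSpace F] [CompactSpace F]
    [ChartedSpace (EuclideanSpace ℝ (Fin k)) F] [IsManifold (𝓡 k) ∞ F]
    (f : F → B) (hf : IsSmoothEmbedding (𝓡 k) (𝓡 n) ∞ f) :
    Nonempty (SmoothMetric n B) ∧
    ∀ g : SmoothMetric n B,
      Nonempty (TubularNeighborhood k f g) ∧
      ∀ T : TubularNeighborhood k f g,
        -- the collapse map is continuous for every compactification
        ∃ hcont : ∀ (Bt : Type w) [TopologicalSpace Bt] [CompactSpace Bt] [T2Space Bt]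
            (i : C(B, Bt)) (_ : IsOpenEmbedding i), Continuous (T.collapse i),
          -- one map to the cohomology of the Thom space, for all compactifications
          (∃ ψ : RelCohomology 3 B (range f)ᶜ →+ Cohomology 3 (ThomSpace k f g),
            ∀ (Bt : Type w) [TopologicalSpace Bt] [CompactSpace Bt] [T2Space Bt]
              (i : C(B, Bt)) (hi : IsOpenEmbedding i),
              ∃ hexc : Function.Bijective (excisionMap 3 i hi.injective (range f)),
                extensionMap 3 i hi.injective (range f) hexc =
                  (Cohomology.pullback 3 ⟨T.collapse i, hcont Bt i hi⟩).comp ψ) ∧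
          -- naturality in the compactification
          ∀ (Bt Bt' : Type w) [TopologicalSpace Bt] [CompactSpace Bt] [T2Space Bt]
            [TopologicalSpace Bt'] [CompactSpace Bt'] [T2Space Bt']
            (i : C(B, Bt)) (hi : IsOpenEmbedding i) (i' : C(B, Bt')) (hi' : IsOpenEmbedding i')
            (h : C(Bt, Bt')), h.comp i = i' → (∀ x, x ∉ range i → h x ∉ range i') →
              Cohomology.pullback 3 ⟨T.collapse i, hcont Bt i hi⟩ =
                (Cohomology.pullback 3 h).comp
                  (Cohomology.pullback 3 ⟨T.collapse i', hcont Bt' i' hi'⟩) := by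
  refine ⟨nonempty_smoothMetric n B, fun g => ⟨nonempty_tubularNeighborhood hf g, fun T => ?_⟩⟩
  have hD := isCompact_discBundle hf g
  have hfc : Continuous f := hf.contMDiff.continuous
  refine ⟨fun Bt _ _ _ i hi => T.continuous_collapse hD hi, ?_, ?_⟩
  -- Excision is stated in degree `m + 1`, because primitives live one degree lower; degree three is
  -- `m = 2`.
  · obtain ⟨ψ, hψ⟩ := exists_hom_cohomology_thomSpace 2 hfc T hD
    exact ⟨ψ, fun Bt _ _ _ i hi =>
      ⟨bijective_excisionMap 2 i hi (isCompact_range hfc), hψ Bt i hi _ _⟩⟩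
  · intro Bt Bt' _ _ _ _ _ _ i hi i' hi' h hh hout
    have hcomp : (⟨T.collapse i', T.continuous_collapse hD hi'⟩ : C(Bt', ThomSpace k f g)).comp h =
        ⟨T.collapse i, T.continuous_collapse hD hi⟩ :=
      ContinuousMap.ext fun x => T.collapse_comp hi.injective hi'.injective
        (fun b => congrArg (fun φ : C(B, Bt') => φ b) hh) hout x
    rw [← hcomp]
    refine AddMonoidHom.ext fun x => ?_
    exact (RelCohomology.pullback_comp 3 h _ (mapsTo_empty _ _) (mapsTo_empty _ _)
      (mapsTo_empty _ _) x).symm
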